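/- Let $K$ be a field of characteristic $0$ and let $\alpha,\beta\in K$ be such that $K$ contains both roots $r_1,r_2$ of $X^2-\alpha X-\beta$. Assume that $\beta\neq 0$ (that is, $r_1$ and $r_2$ are nonzero) and that $r_1^i r_2^j\neq 1$ for all pairs of integers $(i,j)\neq(0,0)$. Let $A=A(\alpha,\beta,0)$ be the down-up algebra with parameters $\alpha,\beta,0$, that is, the quotient of the free associative algebra $K\langle u,d\rangle$ by the two-sided ideal generated by $d^2u-\alpha\, dud-\beta\, ud^2$ and $du^2-\alpha\, udu-\beta\, u^2d$, with the $\mathbb Z^2$-grading in which $u$ has bidegree $(1,1)$ and $d$ has bidegree $(1,-1)$. This bigrading induces a bigrading $HH^2(A)=\bigoplus_{(m,n)\in\mathbb Z^2}HH^2(A)_{m,n}$ of the second Hochschild cohomology space of $A$ with coefficients in $A$, where $HH^2(A)_{m,n}$ consists of the classes of the bilinear Hochschild cocycles $A\times A\to A$ that are homogeneous of bidegree $(m,n)$. The spaces $HH^2(A)_{m,n}$ are finite dimensional, and the bigraded Hilbert series of $HH^2(A)$ is $$HH^2(A)(t,s)=\sum_{m,n\in\mathbb Z}\dim_K\bigl(HH^2(A)_{m,n}\bigr)\,t^m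 s^n=\frac{1}{t^2}+2+\frac{t^2}{1-t^2},$$ where $\frac{t^2}{1-t^2}$ is expanded as $\sum_{k\ge 1}t^{2k}$. -/

import Mathlib

set_option maxSynthPendingDepth 3

open Polynomial

/-- The two generators: `u` (up) and `d` (down). -/
inductive UDGen : Type
  | u : UDGen
  | d : UDGen

/-- The defining relations of the down-up algebra `A(α, β, γ)` in the free associative algebra
on `u` and `d`: `d²u = α dud + β ud² + γ d` and `du² = α udu + β u²d + γ u`. -/
inductive DownUpRel {K : Type*} [Field K] (α β γ : K) :
    FreeAlgebra K UDGen → FreeAlgebra K UDGen → Prop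
  | ddu : DownUpRel α β γ
      (FreeAlgebra.ι K UDGen.d ^ 2 * FreeAlgebra.ι K UDGen.u)
      (α • (FreeAlgebra.ι K UDGen.d * FreeAlgebra.ι K UDGen.u * FreeAlgebra.ι K UDGen.d)
        + β • (FreeAlgebra.ι K UDGen.u * FreeAlgebra.ι K UDGen.d ^ 2)
        + γ • FreeAlgebra.ι K UDGen.d)
  | duu : DownUpRel α β γ
      (FreeAlgebra.ι K UDGen.d * FreeAlgebra.ι K UDGen.u ^ 2)
      (α • (FreeAlgebra.ι K UDGen.u * FreeAlgebra.ι K UDGen.d * FreeAlgebra.ι K UDGen.u)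
        + β • (FreeAlgebra.ι K UDGen.u ^ 2 * FreeAlgebra.ι K UDGen.d)
        + γ • FreeAlgebra.ι K UDGen.u)

/-- The down-up algebra `A(α, β, γ)`. -/
abbrev DownUpAlgebra {K : Type*} [Field K] (α β γ : K) : Type _ :=
  RingQuot (DownUpRel α β γ)

/-- The image of a generator in the down-up algebra. -/
noncomputable def DownUpAlgebra.gen {K : Type*} [Field K] (α β γ : K) (x : UDGen) :
    DownUpAlgebra α β γ :=
  RingQuot.mkAlgHom K (DownUpRel α β γ) (FreeAlgebra.ι K x)

/-- The image of a word in `u` and `d` in the down-up algebra. -/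
noncomputable def DownUpAlgebra.word {K : Type*} [Field K] (α β γ : K) (w : List UDGen) :
    DownUpAlgebra α β γ :=
  (w.map (DownUpAlgebra.gen α β γ)).prod

/-- The bidegree (usual degree, special degree) of a generator. -/
def UDGen.bideg : UDGen → ℤ × ℤ
  | UDGen.u => (1, 1)
  | UDGen.d => (1, -1)

/-- The bigrading of `A(α, β, 0)`: the component of bidegree `p` is spanned by the words in `u`
and `d` whose letters have total bidegree `p`. -/
def DownUpAlgebra.bigrading {K : Type*} [Field K] (α β : K) (p : ℤ × ℤ) :
    Submodule K (DownUpAlgebra α β 0) :=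
  Submodule.span K
    {a | ∃ w : List UDGen, (w.map UDGen.bideg).sum = p ∧ a = DownUpAlgebra.word α β 0 w}

/-- The family of graded generic down-up algebras `A(α, β, 0)`: the roots `r₁, r₂` of
`X² - α X - β` are in `K`, they are nonzero (that is, `β ≠ 0`), and `r₁ ^ i * r₂ ^ j ≠ 1` for all
pairs of integers `(i, j) ≠ (0, 0)`. -/
def IsGradedGeneric {K : Type*} [Field K] (α β : K) : Prop :=
  β ≠ 0 ∧ ∃ r₁ r₂ : K,
    (X ^ 2 - C α * X - C β : K[X]) = (X - C r₁) * (X - C r₂) ∧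
    ∀ i j : ℤ, (i, j) ≠ (0, 0) → r₁ ^ i * r₂ ^ j ≠ 1

section Hochschild

variable (K : Type*) [Field K] (A : Type*) [Ring A] [Algebra K A]

/-- Hochschild `2`-cocycles of `A` with values in `A`: the kernel of the differential of the
standard (bar) cochain complex on bilinear maps `A × A → A`. -/
def hochschildCocycles₂ : Submodule K (A →ₗ[K] A →ₗ[K] A) where
  carrier := {f | ∀ a b c : A, a * f b c - f (a * b) c + f a (b * c) - f a b * c = 0}
  zero_mem' := by intro a b c; simp
  add_mem' := by
    intro f g hf hg a b c
    have h := congrArg₂ (· + ·) (hf a b c) (hg a b c)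
    simp only [add_zero] at h
    rw [← h]
    simp only [LinearMap.add_apply, mul_add, add_mul]
    abel
  smul_mem' := by
    intro k f hf a b c
    have h := congrArg (k • ·) (hf a b c)
    simp only [smul_zero] at h
    rw [← h]
    simp only [LinearMap.smul_apply, mul_smul_comm, smul_mul_assoc, smul_sub, smul_add]

/-- Hochschild `2`-coboundaries of `A` with values in `A`: the image of the differential of the
standard (bar) cochain complex on linear maps `A → A`. -/
def hochschildCoboundaries₂ : Submodule K (A →ₗ[K] A →ₗ[K] A) where
  carrier := {f | ∃ g : A →ₗ[K] A, ∀ a b : A, f a b = a * g b - g (a * b) + g a * b}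
  zero_mem' := ⟨0, by intro a b; simp⟩
  add_mem' := by
    rintro f₁ f₂ ⟨g₁, h₁⟩ ⟨g₂, h₂⟩
    refine ⟨g₁ + g₂, fun a b => ?_⟩
    simp only [LinearMap.add_apply, h₁, h₂, mul_add, add_mul]
    abel
  smul_mem' := by
    rintro k f ⟨g, h⟩
    refine ⟨k • g, fun a b => ?_⟩
    simp only [LinearMap.smul_apply, h, mul_smul_comm, smul_mul_assoc, smul_sub, smul_add]

theorem hochschildCoboundaries₂_le : hochschildCoboundaries₂ K A ≤ hochschildCocycles₂ K A := by
  rintro f ⟨g, h⟩ a b c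
  simp only [h, mul_add, mul_sub, add_mul, sub_mul, mul_assoc]
  abel

/-- The second Hochschild cohomology space `HH²(A) = HH²(A, A)`. -/
abbrev HH2 : Type _ :=
  hochschildCocycles₂ K A ⧸ (hochschildCoboundaries₂ K A).submoduleOf (hochschildCocycles₂ K A)

variable {A}

/-- Bilinear maps `A × A → A` that are homogeneous of bidegree `p`. -/
def homogeneousCochains₂ (𝒜 : ℤ × ℤ → Submodule K A) (p : ℤ × ℤ) :
    Submodule K (A →ₗ[K] A →ₗ[K] A) where
  carrier := {f | ∀ x y : ℤ × ℤ, ∀ a ∈ 𝒜 x, ∀ b ∈ 𝒜 y, f a b ∈ 𝒜 (x + y + p)}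
  zero_mem' := fun x y _ _ _ _ => (𝒜 (x + y + p)).zero_mem
  add_mem' := fun hf hg x y a ha b hb =>
    (𝒜 (x + y + p)).add_mem (hf x y a ha b hb) (hg x y a ha b hb)
  smul_mem' := fun k _ hf x y a ha b hb =>
    (𝒜 (x + y + p)).smul_mem k (hf x y a ha b hb)

/-- The component of bidegree `p` of `HH²(A)`, for a bigrading `𝒜` of `A`: the classes of the
`2`-cocycles that are homogeneous of bidegree `p`. -/
def HH2.component (𝒜 : ℤ × ℤ → Submodule K A) (p : ℤ × ℤ) : Submodule K (HH2 K A) :=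
  ((homogeneousCochains₂ K 𝒜 p).submoduleOf (hochschildCocycles₂ K A)).map
    (Submodule.mkQ ((hochschildCoboundaries₂ K A).submoduleOf (hochschildCocycles₂ K A)))

end Hochschild

/-- The field of Hahn series over `ℚ` with exponents in `ℤ × ℤ`, ordered lexicographically; it
contains the Laurent series in `t` whose coefficients are Laurent polynomials in `s`. The
coefficient of `t ^ m * s ^ n` sits at the exponent `(m, n)`. -/
abbrev BigradedSeries : Type := HahnSeries (ℤ ×ₗ ℤ) ℚ

/-- The variable `t`, that records the usual degree. -/
noncomputable def BigradedSeries.t : BigradedSeries :=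
  HahnSeries.single (toLex ((1, 0) : ℤ × ℤ)) 1

/-- The subspaces `V p` form a bigrading of `M` with finite dimensional components, and the
bigraded Hilbert series of `M`, in which the coefficient of `t ^ m * s ^ n` is the dimension of
`V (m, n)`, is `h`. -/
def HasBigradedHilbertSeries {K M : Type*} [Field K] [AddCommGroup M] [Module K M]
    (V : ℤ × ℤ → Submodule K M) (h : BigradedSeries) : Prop :=
  DirectSum.IsInternal V ∧
    ∀ p : ℤ × ℤ, FiniteDimensional K (V p) ∧ (Module.finrank K (V p) : ℚ) = h.coeff (toLex p)

/-! A 2-cocycle f defines a square-zero extension of A by A. Evaluating the two relations on lifts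
of u and d gives a pair (a, b) in A × A, the obstruction of f. Changing the lifts changes this pair
by the linearized relations (`lin`), and the single syzygy `relDDU_syzygy` forces `syzygyMap` to
vanish on it. By the universal property of A, f is a coboundary exactly when its obstruction lies in
the range of `lin`. Hence HH²(A) embeds into ker `syzygyMap` / range `lin` (`obstrClass_injective`).

This quotient can be computed. The span of ud and du contains commuting eigenvectors w₁, w₂, and A
is the sum of the spaces K[w₁, w₂] dᵏ and uᵏ K[w₁, w₂], with d p = σ(p) d, p u = u σ(p) and σ(wᵢ) =
rᵢ wᵢ. Multiplicative independence of the roots says that the eigenvalues of σ on distinct monomials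
are distinct. Give u weight 1 and d weight −1. In nonzero weight every pair in the kernel is a
linearized relation; in weight 0 the kernel consists of the pairs (e d, u e) with e in K[w₁, w₂]
(`isNormal_of_syzygyMap_eq_zero`). Such a pair is a linearized relation if and only if e = T(y b)
for some b, where y = du = r₁w₁ + r₂w₂ and T = σ − (r₁ + r₂) + r₁r₂σ⁻¹ (`normalClass_eq_zero_iff`).
The only monomials killed by T are w₁ and w₂, so the cokernel of b ↦ T(y b) is the line of w₁ʲ in
each polynomial degree j ≠ 1 and the plane of w₁, w₂ in degree 1.

Conversely every e occurs. A acts faithfully on sequences by weighted shifts, and a first-order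
deformation of the weights of u with obstruction (e d, u e) amounts to an inhomogeneous linear
recurrence, which is always solvable. The deformation lives in a larger algebra than A, but its
coboundary takes values in A and is the required cocycle (`exists_cocycle`).

A class given by e of polynomial degree j has bidegree (2j − 2, 0), so j = 0 gives t⁻², j = 1 gives
2, and j ≥ 2 gives t² + t⁴ + ⋯. -/

/-- The left-hand side minus the right-hand side of the relation `d²u = α dud + β ud²`. -/
def relDDU {K B : Type*} [Field K] [Ring B] [Algebra K B] (α β : K) (u d : B) : B :=
  d * d * u - α • (d * u * d) - β • (u * d * d)

/-- The left-hand side minus the right-hand side of the relation `du² = α udu + β u²d`. -/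
def relDUU {K B : Type*} [Field K] [Ring B] [Algebra K B] (α β : K) (u d : B) : B :=
  d * u * u - α • (u * d * u) - β • (u * u * d)

/-- The word d²u² is the overlap of the leading words d²u and du²; the identity compares its two
reductions. -/
theorem relDDU_syzygy {K B : Type*} [Field K] [Ring B] [Algebra K B] (α β : K) (u d : B) :
    relDDU α β u d * u + β • (u * relDDU α β u d) - d * relDUU α β u d
      - β • (relDUU α β u d * d) = 0 := by
  simp only [relDDU, relDUU, mul_sub, sub_mul, mul_smul_comm, smul_mul_assoc, smul_sub, smul_smul,
    mul_assoc]
  module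

namespace DownUpAlgebra

/-! ### Universal property and spanning words -/

section Basic

variable {K : Type*} [Field K] (α β : K)

theorem relDDU_gen :
    relDDU α β (gen α β 0 UDGen.u) (gen α β 0 UDGen.d) = 0 := by
  have h := RingQuot.mkAlgHom_rel K (DownUpRel.ddu (α := α) (β := β) (γ := 0))
  simp only [map_mul, map_add, map_smul, pow_two, zero_smul, add_zero] at h
  simp only [relDDU, gen, sub_sub, sub_eq_zero]
  simpa only [mul_assoc] using h

theorem relDUU_gen :
    relDUU α β (gen α β 0 UDGen.u) (gen α β 0 UDGen.d) = 0 := by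
  have h := RingQuot.mkAlgHom_rel K (DownUpRel.duu (α := α) (β := β) (γ := 0))
  simp only [map_mul, map_add, map_smul, pow_two, zero_smul, add_zero] at h
  simp only [relDUU, gen, sub_sub, sub_eq_zero]
  simpa only [mul_assoc] using h

variable {α β} in
/-- The universal property of `A(α, β, 0)`. -/
noncomputable def lift {B : Type*} [Ring B] [Algebra K B] (u d : B)
    (h₁ : relDDU α β u d = 0) (h₂ : relDUU α β u d = 0) : DownUpAlgebra α β 0 →ₐ[K] B :=
  RingQuot.liftAlgHom K ⟨FreeAlgebra.lift K (fun x => UDGen.casesOn x u d), by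
    intro a b h
    cases h
    · simp only [map_mul, map_add, map_smul, pow_two, zero_smul, add_zero, FreeAlgebra.lift_ι_apply]
      simpa only [relDDU, sub_sub, sub_eq_zero, mul_assoc] using h₁
    · simp only [map_mul, map_add, map_smul, pow_two, zero_smul, add_zero, FreeAlgebra.lift_ι_apply]
      simpa only [relDUU, sub_sub, sub_eq_zero, mul_assoc] using h₂⟩

variable {α β} in
@[simp]
theorem lift_u {B : Type*} [Ring B] [Algebra K B] (u d : B)
    (h₁ : relDDU α β u d = 0) (h₂ : relDUU α β u d = 0) :
    lift u d h₁ h₂ (gen α β 0 UDGen.u) = u := by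
  simp [lift, gen]

variable {α β} in
@[simp]
theorem lift_d {B : Type*} [Ring B] [Algebra K B] (u d : B)
    (h₁ : relDDU α β u d = 0) (h₂ : relDUU α β u d = 0) :
    lift u d h₁ h₂ (gen α β 0 UDGen.d) = d := by
  simp [lift, gen]

@[simp]
theorem word_nil : word α β 0 [] = 1 := by simp [word]

theorem word_cons (x : UDGen) (w : List UDGen) :
    word α β 0 (x :: w) = gen α β 0 x * word α β 0 w := by simp [word]

theorem word_append (v w : List UDGen) :
    word α β 0 (v ++ w) = word α β 0 v * word α β 0 w := by simp [word]

theorem span_word : Submodule.span K (Set.range (word α β 0)) = ⊤ := by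
  rw [eq_top_iff]
  rintro a -
  obtain ⟨a, rfl⟩ := RingQuot.mkAlgHom_surjective K (DownUpRel α β (0 : K)) a
  have hmul : ∀ b c : DownUpAlgebra α β 0, b ∈ Submodule.span K (Set.range (word α β 0)) →
      c ∈ Submodule.span K (Set.range (word α β 0)) →
      b * c ∈ Submodule.span K (Set.range (word α β 0)) := by
    intro b c hb hc
    have := Submodule.mul_mem_mul hb hc
    rw [Submodule.span_mul_span] at this
    refine Submodule.span_mono ?_ this
    rintro _ ⟨_, ⟨v, rfl⟩, _, ⟨w, rfl⟩, rfl⟩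
    exact ⟨v ++ w, word_append α β v w⟩
  have hone : (1 : DownUpAlgebra α β 0) ∈ Submodule.span K (Set.range (word α β 0)) :=
    Submodule.subset_span ⟨[], word_nil α β⟩
  induction a using FreeAlgebra.induction with
  | grade0 r =>
    rw [AlgHom.commutes, Algebra.algebraMap_eq_smul_one]
    exact Submodule.smul_mem _ _ hone
  | grade1 x => exact Submodule.subset_span ⟨[x], by simp [word, gen]⟩
  | mul a b ha hb => rw [map_mul]; exact hmul _ _ ha hb
  | add a b ha hb => rw [map_add]; exact Submodule.add_mem _ ha hb

variable {α β} in
theorem linearMap_ext_word {M : Type*} [AddCommMonoid M] [Module K M]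
    {f g : DownUpAlgebra α β 0 →ₗ[K] M} (h : ∀ w, f (word α β 0 w) = g (word α β 0 w)) : f = g :=
  LinearMap.ext_on_range (span_word α β) h

theorem word_induction {P : DownUpAlgebra α β 0 → Prop} (hw : ∀ w, P (word α β 0 w))
    (hadd : ∀ a b, P a → P b → P (a + b)) (hsmul : ∀ (k : K) a, P a → P (k • a))
    (a : DownUpAlgebra α β 0) : P a := by
  have ha : a ∈ Submodule.span K (Set.range (word α β 0)) := by rw [span_word]; trivial
  induction ha using Submodule.span_induction with
  | mem x hx => obtain ⟨w, rfl⟩ := hx; exact hw w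
  | zero => simpa using hsmul 0 _ (hw [])
  | add x y _ _ hx hy => exact hadd _ _ hx hy
  | smul k x _ hx => exact hsmul k _ hx

end Basic

/-! ### Gradings of A as coactions -/

section Grading

variable {K : Type*} [Field K] (α β : K) {G : Type*} [AddCommGroup G] (deg : UDGen → G)

/-- The span of the words whose letters have total degree `p`. -/
def grading (p : G) : Submodule K (DownUpAlgebra α β 0) :=
  Submodule.span K {a | ∃ w : List UDGen, (w.map deg).sum = p ∧ a = word α β 0 w}

theorem word_mem_grading (w : List UDGen) : word α β 0 w ∈ grading α β deg (w.map deg).sum :=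
  Submodule.subset_span ⟨w, rfl, rfl⟩

theorem gen_mem_grading (x : UDGen) : gen α β 0 x ∈ grading α β deg (deg x) := by
  simpa [word] using word_mem_grading α β deg [x]

theorem one_mem_grading : (1 : DownUpAlgebra α β 0) ∈ grading α β deg 0 := by
  simpa [word] using word_mem_grading α β deg []

variable {α β deg} in
theorem mul_mem_grading {p q : G} {a b : DownUpAlgebra α β 0} (ha : a ∈ grading α β deg p)
    (hb : b ∈ grading α β deg q) : a * b ∈ grading α β deg (p + q) := by
  have := Submodule.mul_mem_mul ha hb
  rw [grading, grading, Submodule.span_mul_span] at this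
  refine Submodule.span_mono ?_ this
  rintro _ ⟨_, ⟨v, rfl, rfl⟩, _, ⟨w, rfl, rfl⟩, rfl⟩
  exact ⟨v ++ w, by simp, (word_append α β v w).symm⟩

variable {α β deg} in
theorem pow_mem_grading {p : G} {a : DownUpAlgebra α β 0} (ha : a ∈ grading α β deg p) (n : ℕ) :
    a ^ n ∈ grading α β deg (n • p) := by
  induction n with
  | zero => simpa using one_mem_grading α β deg
  | succ n ih => rw [pow_succ, succ_nsmul]; exact mul_mem_grading ih ha

/-- The coaction `A → A[G]` that defines the grading. -/
noncomputable def coaction : DownUpAlgebra α β 0 →ₐ[K] AddMonoidAlgebra (DownUpAlgebra α β 0) G :=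
  lift (AddMonoidAlgebra.single (deg UDGen.u) (gen α β 0 UDGen.u))
    (AddMonoidAlgebra.single (deg UDGen.d) (gen α β 0 UDGen.d))
    (by
      have h := relDDU_gen α β
      rw [relDDU] at h ⊢
      simp only [AddMonoidAlgebra.single_mul_single, AddMonoidAlgebra.smul_single]
      rw [show deg UDGen.d + deg UDGen.u + deg UDGen.d = deg UDGen.d + deg UDGen.d + deg UDGen.u by
        abel, show deg UDGen.u + deg UDGen.d + deg UDGen.d =
        deg UDGen.d + deg UDGen.d + deg UDGen.u by abel, ← AddMonoidAlgebra.single_sub,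
        ← AddMonoidAlgebra.single_sub, h, AddMonoidAlgebra.single_zero])
    (by
      have h := relDUU_gen α β
      rw [relDUU] at h ⊢
      simp only [AddMonoidAlgebra.single_mul_single, AddMonoidAlgebra.smul_single]
      rw [show deg UDGen.u + deg UDGen.d + deg UDGen.u = deg UDGen.d + deg UDGen.u + deg UDGen.u by
        abel, show deg UDGen.u + deg UDGen.u + deg UDGen.d =
        deg UDGen.d + deg UDGen.u + deg UDGen.u by abel, ← AddMonoidAlgebra.single_sub,
        ← AddMonoidAlgebra.single_sub, h, AddMonoidAlgebra.single_zero])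

theorem coaction_gen (x : UDGen) :
    coaction α β deg (gen α β 0 x) = AddMonoidAlgebra.single (deg x) (gen α β 0 x) := by
  cases x <;> simp [coaction]

theorem coaction_word (w : List UDGen) :
    coaction α β deg (word α β 0 w) = AddMonoidAlgebra.single (w.map deg).sum (word α β 0 w) := by
  induction w with
  | nil => simp [AddMonoidAlgebra.one_def]
  | cons x w ih =>
    rw [word_cons, map_mul, ih, coaction_gen, AddMonoidAlgebra.single_mul_single]
    simp

variable {α β deg} in
theorem coaction_of_mem {p : G} {a : DownUpAlgebra α β 0} (ha : a ∈ grading α β deg p) :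
    coaction α β deg a = AddMonoidAlgebra.single p a := by
  induction ha using Submodule.span_induction with
  | mem x hx => obtain ⟨w, rfl, rfl⟩ := hx; exact coaction_word α β deg w
  | zero => simp
  | add x y _ _ hx hy => rw [map_add, hx, hy, AddMonoidAlgebra.single_add]
  | smul k x _ hx => rw [map_smul, hx, AddMonoidAlgebra.smul_single]

/-- The component of degree `p` of an element of `A(α, β, 0)`. -/
noncomputable def proj (p : G) : DownUpAlgebra α β 0 →ₗ[K] DownUpAlgebra α β 0 where
  toFun a := (coaction α β deg a).coeff p
  map_add' a b := by simp
  map_smul' k a := by simp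

theorem coeff_coaction (p : G) (a : DownUpAlgebra α β 0) :
    (coaction α β deg a).coeff p = proj α β deg p a := rfl

variable {α β deg} in
theorem proj_of_mem {p : G} {a : DownUpAlgebra α β 0} (ha : a ∈ grading α β deg p) :
    proj α β deg p a = a := by
  simp [← coeff_coaction, coaction_of_mem ha]

variable {α β deg} in
theorem proj_of_mem_ne {p q : G} {a : DownUpAlgebra α β 0} (ha : a ∈ grading α β deg p)
    (h : p ≠ q) : proj α β deg q a = 0 := by
  simp [← coeff_coaction, coaction_of_mem ha, h]

theorem proj_mem (p : G) (a : DownUpAlgebra α β 0) : proj α β deg p a ∈ grading α β deg p := by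
  induction a using word_induction with
  | hw w =>
    by_cases h : (w.map deg).sum = p
    · subst h
      rw [proj_of_mem (word_mem_grading α β deg w)]
      exact word_mem_grading α β deg w
    · rw [proj_of_mem_ne (word_mem_grading α β deg w) h]
      exact Submodule.zero_mem _
  | hadd a b ha hb => rw [map_add]; exact Submodule.add_mem _ ha hb
  | hsmul k a ha => rw [map_smul]; exact Submodule.smul_mem _ _ ha

theorem sum_proj (a : DownUpAlgebra α β 0) :
    ((coaction α β deg a).coeff.sum fun _ b => b) = a := by
  induction a using word_induction with
  | hw w => simp [coaction_word]
  | hadd a b ha hb =>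
    rw [map_add, AddMonoidAlgebra.coeff_add, Finsupp.sum_add_index' (by simp) (by simp), ha, hb]
  | hsmul k a ha =>
    rw [map_smul, AddMonoidAlgebra.coeff_smul, Finsupp.sum_smul_index' (by simp),
      ← Finsupp.smul_sum, ha]

/-- Any larger index set is allowed, so that two elements can be decomposed over a common one. -/
theorem exists_finset_sum_proj (a : DownUpAlgebra α β 0) :
    ∃ s : Finset G, ∀ t : Finset G, s ⊆ t → ∑ p ∈ t, proj α β deg p a = a := by
  refine ⟨(coaction α β deg a).coeff.support, fun t ht => ?_⟩
  conv_rhs => rw [← sum_proj α β deg a, Finsupp.sum]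
  symm
  refine Finset.sum_subset ht fun p _ hp => ?_
  simpa using hp

theorem proj_mul_right (p q : G) (a b : DownUpAlgebra α β 0) (hb : b ∈ grading α β deg q) :
    proj α β deg (p + q) (a * b) = proj α β deg p a * b := by
  rw [← coeff_coaction, map_mul, coaction_of_mem hb, AddMonoidAlgebra.coeff_mul_single_add]
  rfl

theorem proj_mul_left (p q : G) (a b : DownUpAlgebra α β 0) (ha : a ∈ grading α β deg q) :
    proj α β deg (q + p) (a * b) = a * proj α β deg p b := by
  rw [← coeff_coaction, map_mul, coaction_of_mem ha, AddMonoidAlgebra.coeff_single_mul_add]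
  rfl

end Grading

end DownUpAlgebra

namespace DownUpAlgebra

/-! ### Homogeneous components of cochains and of HH² -/

section Component

variable {K : Type*} [Field K] (α β : K) {G : Type*} [AddCommGroup G] (deg : UDGen → G)

/-- The homogeneous component of degree `p` of a bilinear map `A × A → A`. -/
noncomputable def cochainComponent (p : G) :
    (DownUpAlgebra α β 0 →ₗ[K] DownUpAlgebra α β 0 →ₗ[K] DownUpAlgebra α β 0) →ₗ[K]
      (DownUpAlgebra α β 0 →ₗ[K] DownUpAlgebra α β 0 →ₗ[K] DownUpAlgebra α β 0) where
  toFun f := LinearMap.mk₂ K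
    (fun a b => (coaction α β deg a).coeff.sum fun x a' => (coaction α β deg b).coeff.sum
      fun y b' => proj α β deg (x + y + p) (f a' b'))
    (fun a a' b => by
      rw [map_add, AddMonoidAlgebra.coeff_add, Finsupp.sum_add_index' (by simp)]
      intro x c c'
      simp [Finsupp.sum_add])
    (fun k a b => by
      rw [map_smul, AddMonoidAlgebra.coeff_smul, Finsupp.sum_smul_index' (by simp)]
      simp [Finsupp.smul_sum])
    (fun a b b' => by
      rw [map_add, AddMonoidAlgebra.coeff_add, ← Finsupp.sum_add]
      refine Finsupp.sum_congr fun x _ => ?_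
      rw [Finsupp.sum_add_index' (by simp) (by simp)])
    (fun k a b => by
      rw [map_smul, AddMonoidAlgebra.coeff_smul, Finsupp.smul_sum]
      refine Finsupp.sum_congr fun x _ => ?_
      rw [Finsupp.sum_smul_index' (by simp)]
      simp [Finsupp.smul_sum])
  map_add' f g := by
    ext a b
    simp [Finsupp.sum_add]
  map_smul' k f := by
    ext a b
    simp [Finsupp.smul_sum]

variable {α β deg}

theorem cochainComponent_apply_of_mem {p x y : G}
    (f : DownUpAlgebra α β 0 →ₗ[K] DownUpAlgebra α β 0 →ₗ[K] DownUpAlgebra α β 0)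
    {a b : DownUpAlgebra α β 0} (ha : a ∈ grading α β deg x) (hb : b ∈ grading α β deg y) :
    cochainComponent α β deg p f a b = proj α β deg (x + y + p) (f a b) := by
  simp [cochainComponent, coaction_of_mem ha, coaction_of_mem hb]

theorem bilin_ext_word {M : Type*} [AddCommMonoid M] [Module K M]
    {f g : DownUpAlgebra α β 0 →ₗ[K] DownUpAlgebra α β 0 →ₗ[K] M}
    (h : ∀ v w, f (word α β 0 v) (word α β 0 w) = g (word α β 0 v) (word α β 0 w)) : f = g :=
  linearMap_ext_word fun v => linearMap_ext_word fun w => h v w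

/-- By trilinearity it suffices to treat words of degrees x, y, z. There the identity for the
component is the part of degree x + y + z + p of the identity for f. -/
theorem cochainComponent_mem_cocycles (p : G)
    {f : DownUpAlgebra α β 0 →ₗ[K] DownUpAlgebra α β 0 →ₗ[K] DownUpAlgebra α β 0}
    (hf : f ∈ hochschildCocycles₂ K (DownUpAlgebra α β 0)) :
    cochainComponent α β deg p f ∈ hochschildCocycles₂ K (DownUpAlgebra α β 0) := by
  intro a b c
  induction a using word_induction with
  | hadd a a' h h' =>
    have := congrArg₂ (· + ·) h h'
    simp only [add_zero] at this
    rw [← this]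
    simp only [map_add, LinearMap.add_apply, add_mul]
    abel
  | hsmul k a h =>
    have := congrArg (k • ·) h
    simp only [smul_zero] at this
    rw [← this]
    simp only [map_smul, LinearMap.smul_apply, smul_mul_assoc, smul_add, smul_sub]
  | hw u =>
  induction b using word_induction with
  | hadd a a' h h' =>
    have := congrArg₂ (· + ·) h h'
    simp only [add_zero] at this
    rw [← this]
    simp only [map_add, LinearMap.add_apply, add_mul, mul_add]
    abel
  | hsmul k a h =>
    have := congrArg (k • ·) h
    simp only [smul_zero] at this
    rw [← this]
    simp only [map_smul, LinearMap.smul_apply, smul_mul_assoc, mul_smul_comm, smul_add, smul_sub]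
  | hw v =>
  induction c using word_induction with
  | hadd a a' h h' =>
    have := congrArg₂ (· + ·) h h'
    simp only [add_zero] at this
    rw [← this]
    simp only [map_add, mul_add]
    abel
  | hsmul k a h =>
    have := congrArg (k • ·) h
    simp only [smul_zero] at this
    rw [← this]
    simp only [map_smul, mul_smul_comm, smul_add, smul_sub]
  | hw w =>
  have hu := word_mem_grading α β deg u
  have hv := word_mem_grading α β deg v
  have hw := word_mem_grading α β deg w
  generalize (List.map deg u).sum = x at hu
  generalize (List.map deg v).sum = y at hv
  generalize (List.map deg w).sum = z at hw
  have h := congrArg (proj α β deg (x + (y + z + p)))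
    (hf (word α β 0 u) (word α β 0 v) (word α β 0 w))
  rw [cochainComponent_apply_of_mem f hv hw, cochainComponent_apply_of_mem f hu hv,
    cochainComponent_apply_of_mem f (mul_mem_grading hu hv) hw,
    cochainComponent_apply_of_mem f hu (mul_mem_grading hv hw), ← proj_mul_left _ _ _ _ _ _ _ hu,
    ← proj_mul_right _ _ _ _ _ _ _ hw]
  rw [map_sub, map_add, map_sub, map_zero] at h
  rw [show x + y + z + p = x + (y + z + p) by abel, show x + (y + z) + p = x + (y + z + p) by abel,
    show x + y + p + z = x + (y + z + p) by abel]
  exact h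

/-- The homogeneous component of degree `p` of a linear map `A → A`. -/
noncomputable def mapComponent (p : G) (g : DownUpAlgebra α β 0 →ₗ[K] DownUpAlgebra α β 0) :
    DownUpAlgebra α β 0 →ₗ[K] DownUpAlgebra α β 0 where
  toFun a := (coaction α β deg a).coeff.sum fun x a' => proj α β deg (x + p) (g a')
  map_add' a b := by
    rw [map_add, AddMonoidAlgebra.coeff_add, Finsupp.sum_add_index' (by simp) (by simp)]
  map_smul' k a := by
    rw [map_smul, AddMonoidAlgebra.coeff_smul, Finsupp.sum_smul_index' (by simp)]
    simp [Finsupp.smul_sum]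

theorem mapComponent_apply_of_mem {p x : G}
    (g : DownUpAlgebra α β 0 →ₗ[K] DownUpAlgebra α β 0)
    {a : DownUpAlgebra α β 0} (ha : a ∈ grading α β deg x) :
    mapComponent (deg := deg) p g a = proj α β deg (x + p) (g a) := by
  simp [mapComponent, coaction_of_mem ha]

theorem cochainComponent_mem_coboundaries (p : G)
    {f : DownUpAlgebra α β 0 →ₗ[K] DownUpAlgebra α β 0 →ₗ[K] DownUpAlgebra α β 0}
    (hf : f ∈ hochschildCoboundaries₂ K (DownUpAlgebra α β 0)) :
    cochainComponent α β deg p f ∈ hochschildCoboundaries₂ K (DownUpAlgebra α β 0) := by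
  obtain ⟨g, hg⟩ := hf
  refine ⟨mapComponent (deg := deg) p g, fun a b => ?_⟩
  induction a using word_induction with
  | hadd a a' h h' =>
    simp only [map_add, LinearMap.add_apply, add_mul, h, h']
    abel
  | hsmul k a h =>
    simp only [map_smul, LinearMap.smul_apply, smul_mul_assoc, smul_add, smul_sub, h]
  | hw u =>
  induction b using word_induction with
  | hadd a a' h h' =>
    simp only [map_add, mul_add, h, h']
    abel
  | hsmul k a h =>
    simp only [map_smul, mul_smul_comm, smul_add, smul_sub, h]
  | hw v =>
  have hu := word_mem_grading α β deg u
  have hv := word_mem_grading α β deg v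
  generalize (List.map deg u).sum = x at hu
  generalize (List.map deg v).sum = y at hv
  rw [cochainComponent_apply_of_mem f hu hv, hg, mapComponent_apply_of_mem g hu,
    mapComponent_apply_of_mem g hv, mapComponent_apply_of_mem g (mul_mem_grading hu hv),
    ← proj_mul_left _ _ _ _ _ _ _ hu, ← proj_mul_right _ _ _ _ _ _ _ hv, map_add, map_sub]
  rw [show x + (y + p) = x + y + p by abel, show x + p + y = x + y + p by abel]

end Component

section HH2

variable {K : Type*} [Field K] {α β : K}

theorem cochainComponent_mem_homogeneous (p : ℤ × ℤ)
    (f : DownUpAlgebra α β 0 →ₗ[K] DownUpAlgebra α β 0 →ₗ[K] DownUpAlgebra α β 0) :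
    cochainComponent α β UDGen.bideg p f ∈ homogeneousCochains₂ K (bigrading α β) p := by
  intro x y a ha b hb
  rw [cochainComponent_apply_of_mem (deg := UDGen.bideg) f ha hb]
  exact proj_mem α β UDGen.bideg _ _

theorem cochainComponent_of_homogeneous {p : ℤ × ℤ}
    {f : DownUpAlgebra α β 0 →ₗ[K] DownUpAlgebra α β 0 →ₗ[K] DownUpAlgebra α β 0}
    (hf : f ∈ homogeneousCochains₂ K (bigrading α β) p) :
    cochainComponent α β UDGen.bideg p f = f := by
  refine bilin_ext_word fun v w => ?_
  have hv := word_mem_grading α β UDGen.bideg v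
  have hw := word_mem_grading α β UDGen.bideg w
  rw [cochainComponent_apply_of_mem f hv hw]
  exact proj_of_mem (deg := UDGen.bideg) (hf _ _ _ hv _ hw)

theorem cochainComponent_of_homogeneous_ne {p q : ℤ × ℤ} (hpq : p ≠ q)
    {f : DownUpAlgebra α β 0 →ₗ[K] DownUpAlgebra α β 0 →ₗ[K] DownUpAlgebra α β 0}
    (hf : f ∈ homogeneousCochains₂ K (bigrading α β) p) :
    cochainComponent α β UDGen.bideg q f = 0 := by
  refine bilin_ext_word fun v w => ?_
  have hv := word_mem_grading α β UDGen.bideg v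
  have hw := word_mem_grading α β UDGen.bideg w
  rw [cochainComponent_apply_of_mem f hv hw]
  exact proj_of_mem_ne (deg := UDGen.bideg) (hf _ _ _ hv _ hw) (by simpa using hpq)

variable (α β) in
/-- The projection of `HH²(A)` onto its component of bidegree `p`. -/
noncomputable def hh2Proj (p : ℤ × ℤ) :
    HH2 K (DownUpAlgebra α β 0) →ₗ[K] HH2 K (DownUpAlgebra α β 0) :=
  Submodule.mapQ _ _
    ((cochainComponent α β UDGen.bideg p).restrict fun _ hf => cochainComponent_mem_cocycles p hf)
    (fun _ hf => cochainComponent_mem_coboundaries p hf)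

theorem iSupIndep_of_projections {K M ι : Type*} [Field K] [AddCommGroup M] [Module K M]
    (V : ι → Submodule K M) (P : ι → M →ₗ[K] M) (h₁ : ∀ i, ∀ x ∈ V i, P i x = x)
    (h₂ : ∀ i j, i ≠ j → ∀ x ∈ V i, P j x = 0) : iSupIndep V := by
  intro i
  rw [Submodule.disjoint_def]
  intro x hx hx'
  have : ⨆ j, ⨆ (_ : j ≠ i), V j ≤ LinearMap.ker (P i) :=
    iSup₂_le fun j hj y hy => h₂ j i hj y hy
  rw [← h₁ i x hx]
  exact this hx'

variable (α β) in
-- The projections give independence only. A bilinear map may have infinitely many nonzero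
-- components, so that the components span HH² has to come from a homogeneous basis.
theorem iSupIndep_component : iSupIndep (HH2.component K (bigrading α β)) := by
  refine iSupIndep_of_projections _ (hh2Proj α β) ?_ ?_
  · rintro p _ ⟨f, hf, rfl⟩
    refine congrArg _ (Subtype.ext ?_)
    exact cochainComponent_of_homogeneous hf
  · rintro p q hpq _ ⟨f, hf, rfl⟩
    have : (cochainComponent α β UDGen.bideg q).restrict
        (fun _ hf => cochainComponent_mem_cocycles q hf) f = 0 :=
      Subtype.ext (cochainComponent_of_homogeneous_ne hpq hf)
    exact (congrArg (Submodule.mkQ _) this).trans (map_zero _)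

end HH2

/-! ### Square-zero extensions, obstructions and linearized relations -/

section Theta

variable {K : Type*} [Field K] {A : Type*} [Ring A] [Algebra K A] (α β : K) (u d : A)

/-- The first component of the obstruction of a bilinear map `f`: the value of `d²u - α dud - β ud²`
in the square-zero extension of `A` by `A` determined by `f`. -/
def obstrDDU (f : A →ₗ[K] A →ₗ[K] A) : A :=
  (f d d * u + f (d * d) u) - α • (f d u * d + f (d * u) d) - β • (f u d * d + f (u * d) d)

/-- The second component of the obstruction of a bilinear map. -/
def obstrDUU (f : A →ₗ[K] A →ₗ[K] A) : A :=
  (f d u * u + f (d * u) u) - α • (f u d * u + f (u * d) u) - β • (f u u * d + f (u * u) d)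

/-- The linearization of the relation `d²u = α dud + β ud²` in the direction `(p, q)`. -/
def linDDU (p q : A) : A :=
  (q * d * u + d * q * u + d * d * p) - α • (q * u * d + d * p * d + d * u * q)
    - β • (p * d * d + u * q * d + u * d * q)

/-- The linearization of the relation `du² = α udu + β u²d` in the direction `(p, q)`. -/
def linDUU (p q : A) : A :=
  (q * u * u + d * p * u + d * u * p) - α • (p * d * u + u * q * u + u * d * p)
    - β • (p * u * d + u * p * d + u * u * q)

theorem linDDU_add (p q p' q' : A) :
    linDDU α β u d (p + p') (q + q') = linDDU α β u d p q + linDDU α β u d p' q' := by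
  simp only [linDDU, mul_add, add_mul]
  module

theorem linDUU_add (p q p' q' : A) :
    linDUU α β u d (p + p') (q + q') = linDUU α β u d p q + linDUU α β u d p' q' := by
  simp only [linDUU, mul_add, add_mul]
  module

theorem linDDU_smul (k : K) (p q : A) :
    linDDU α β u d (k • p) (k • q) = k • linDDU α β u d p q := by
  simp only [linDDU, mul_smul_comm, smul_mul_assoc]
  module

theorem linDUU_smul (k : K) (p q : A) :
    linDUU α β u d (k • p) (k • q) = k • linDUU α β u d p q := by
  simp only [linDUU, mul_smul_comm, smul_mul_assoc]
  module

/-- The map whose kernel contains the obstructions of cocycles. -/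
def syzygyMap (a b : A) : A := a * u + β • (u * a) - d * b - β • (b * d)

variable {α β u d}

/-- Differentiate `relDDU_syzygy` in the direction (p, q): the terms in which an outer letter is
differentiated contain an undifferentiated relation, which vanishes. -/
theorem syzygyMap_lin (h₁ : relDDU α β u d = 0) (h₂ : relDUU α β u d = 0) (p q : A) :
    syzygyMap β u d (linDDU α β u d p q) (linDUU α β u d p q) = 0 := by
  have : syzygyMap β u d (linDDU α β u d p q) (linDUU α β u d p q) =
      - (relDDU α β u d * p + β • (p * relDDU α β u d) - q * relDUU α β u d
        - β • (relDUU α β u d * q)) := by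
    simp only [syzygyMap, linDDU, linDUU, relDDU, relDUU, mul_sub, sub_mul, mul_add, add_mul,
      mul_smul_comm, smul_mul_assoc, smul_sub, smul_add, smul_smul, mul_assoc]
    module
  simp [this, h₁, h₂]

/-- The terms −g(xy) telescope to −g of the relation, which is zero; what remains is the product
rule. -/
theorem obstrDDU_coboundary (h₁ : relDDU α β u d = 0) {f : A →ₗ[K] A →ₗ[K] A} {g : A →ₗ[K] A}
    (hf : ∀ a b, f a b = a * g b - g (a * b) + g a * b) :
    obstrDDU α β u d f = linDDU α β u d (g u) (g d) := by
  have h := congrArg g h₁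
  simp only [relDDU, map_sub, map_smul, map_zero] at h
  simp only [obstrDDU, linDDU, hf, sub_mul, add_mul]
  rw [← sub_eq_zero, ← neg_eq_zero.2 h]
  simp only [mul_assoc]
  module

theorem obstrDUU_coboundary (h₁ : relDUU α β u d = 0) {f : A →ₗ[K] A →ₗ[K] A} {g : A →ₗ[K] A}
    (hf : ∀ a b, f a b = a * g b - g (a * b) + g a * b) :
    obstrDUU α β u d f = linDUU α β u d (g u) (g d) := by
  have h := congrArg g h₁
  simp only [relDUU, map_sub, map_smul, map_zero] at h
  simp only [obstrDUU, linDUU, hf, sub_mul, add_mul]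
  rw [← sub_eq_zero, ← neg_eq_zero.2 h]
  simp only [mul_assoc]
  module

/-- Left multiplication by `(a, c)` in the square-zero extension of `A` by `A` determined by
the bilinear map `f`. -/
def extMul (f : A →ₗ[K] A →ₗ[K] A) : A × A →ₗ[K] Module.End K (A × A) :=
  LinearMap.mk₂ K (fun x y => (x.1 * y.1, x.1 * y.2 + x.2 * y.1 + f x.1 y.1))
    (fun x x' y => by
      ext
      · simp [add_mul]
      · simp [add_mul]; abel)
    (fun k x y => by ext <;> simp)
    (fun x y y' => by
      ext
      · simp [mul_add]
      · simp [mul_add]; abel)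
    (fun k x y => by ext <;> simp)

theorem extMul_apply (f : A →ₗ[K] A →ₗ[K] A) (x y : A × A) :
    extMul f x y = (x.1 * y.1, x.1 * y.2 + x.2 * y.1 + f x.1 y.1) := rfl

variable {f : A →ₗ[K] A →ₗ[K] A}

/-- The cocycle identity is associativity of the extension. Left multiplications live in the ring
`Module.End`, where identities such as `relDDU_syzygy` apply without a ring structure on A × A
attached to f. -/
theorem extMul_mul (hf : f ∈ hochschildCocycles₂ K A) (a c b e : A) :
    extMul f (a, c) * extMul f (b, e) = extMul f (a * b, a * e + c * b + f a b) := by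
  refine LinearMap.ext fun y => ?_
  rw [Module.End.mul_apply]
  ext
  · simp [extMul_apply, mul_assoc]
  · have h : a * f b y.1 - f (a * b) y.1 + f a (b * y.1) - f a b * y.1 = 0 := hf a b y.1
    simp only [extMul_apply, mul_add, add_mul, mul_assoc]
    rw [← sub_eq_zero, ← h]
    abel

theorem relDDU_extMul (hf : f ∈ hochschildCocycles₂ K A) (p q : A) :
    relDDU α β (extMul f (u, p)) (extMul f (d, q)) =
      extMul f (relDDU α β u d, linDDU α β u d p q + obstrDDU α β u d f) := by
  rw [relDDU, extMul_mul hf, extMul_mul hf, extMul_mul hf, extMul_mul hf, extMul_mul hf,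
    extMul_mul hf, ← map_smul, ← map_smul, ← map_sub, ← map_sub]
  congr 1
  ext
  · rfl
  · simp only [Prod.snd_sub, Prod.smul_snd, linDDU, obstrDDU, add_mul, mul_assoc]
    module

theorem relDUU_extMul (hf : f ∈ hochschildCocycles₂ K A) (p q : A) :
    relDUU α β (extMul f (u, p)) (extMul f (d, q)) =
      extMul f (relDUU α β u d, linDUU α β u d p q + obstrDUU α β u d f) := by
  rw [relDUU, extMul_mul hf, extMul_mul hf, extMul_mul hf, extMul_mul hf, extMul_mul hf,
    extMul_mul hf, ← map_smul, ← map_smul, ← map_sub, ← map_sub]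
  congr 1
  ext
  · rfl
  · simp only [Prod.snd_sub, Prod.smul_snd, linDUU, obstrDUU, add_mul, mul_assoc]
    module

/-- Apply the syzygy to the lifts (u, 0) and (d, 0). On these the relations take the values (0,
obstruction), and applying the resulting operator to (1, 0) reads off its second entry. -/
theorem syzygyMap_obstr (hf : f ∈ hochschildCocycles₂ K A)
    (h₁ : relDDU α β u d = 0) (h₂ : relDUU α β u d = 0) :
    syzygyMap β u d (obstrDDU α β u d f) (obstrDUU α β u d f) = 0 := by
  have h := relDDU_syzygy α β (extMul f (u, 0)) (extMul f (d, 0))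
  rw [relDDU_extMul hf, relDUU_extMul hf, h₁, h₂, extMul_mul hf, extMul_mul hf, extMul_mul hf,
    extMul_mul hf, ← map_smul, ← map_smul, ← map_add, ← map_sub, ← map_sub] at h
  have h' := congrArg Prod.snd (LinearMap.congr_fun h (1, 0))
  simpa [extMul_apply, syzygyMap, linDDU, linDUU] using h'

/-- Cocycles are not normalized here: the unit of the extension is (1, −f 1 1), and this identity
makes it a right unit. -/
theorem cocycle_apply_one (hf : f ∈ hochschildCocycles₂ K A) (a : A) : f a 1 = a * f 1 1 := by
  have h : a * f 1 1 - f (a * 1) 1 + f a (1 * 1) - f a 1 * 1 = 0 := hf a 1 1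
  simp only [mul_one, sub_add_cancel] at h
  exact (sub_eq_zero.1 h).symm

end Theta

section Coboundary

variable {K : Type*} [Field K] {α β : K}

/-- For the lifts (u, −p) and (d, −q) the relations hold in the extension, so the universal property
yields an algebra splitting a ↦ (a, g a). Its multiplicativity says that f is the coboundary of −g.
-/
theorem mem_coboundaries_of_obstr_eq_lin
    {f : DownUpAlgebra α β 0 →ₗ[K] DownUpAlgebra α β 0 →ₗ[K] DownUpAlgebra α β 0}
    (hf : f ∈ hochschildCocycles₂ K (DownUpAlgebra α β 0)) (p q : DownUpAlgebra α β 0)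
    (h₁ : obstrDDU α β (gen α β 0 UDGen.u) (gen α β 0 UDGen.d) f =
      linDDU α β (gen α β 0 UDGen.u) (gen α β 0 UDGen.d) p q)
    (h₂ : obstrDUU α β (gen α β 0 UDGen.u) (gen α β 0 UDGen.d) f =
      linDUU α β (gen α β 0 UDGen.u) (gen α β 0 UDGen.d) p q) :
    f ∈ hochschildCoboundaries₂ K (DownUpAlgebra α β 0) := by
  have neg_lin₁ : linDDU α β (gen α β 0 UDGen.u) (gen α β 0 UDGen.d) (-p) (-q) =
      - linDDU α β (gen α β 0 UDGen.u) (gen α β 0 UDGen.d) p q := by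
    simpa using linDDU_smul α β (gen α β 0 UDGen.u) (gen α β 0 UDGen.d) (-1 : K) p q
  have neg_lin₂ : linDUU α β (gen α β 0 UDGen.u) (gen α β 0 UDGen.d) (-p) (-q) =
      - linDUU α β (gen α β 0 UDGen.u) (gen α β 0 UDGen.d) p q := by
    simpa using linDUU_smul α β (gen α β 0 UDGen.u) (gen α β 0 UDGen.d) (-1 : K) p q
  let L := lift (α := α) (β := β) (extMul f (gen α β 0 UDGen.u, -p))
    (extMul f (gen α β 0 UDGen.d, -q))
    (by rw [relDDU_extMul hf, relDDU_gen, h₁, neg_lin₁, neg_add_cancel]; exact map_zero _)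
    (by rw [relDUU_extMul hf, relDUU_gen, h₂, neg_lin₂, neg_add_cancel]; exact map_zero _)
  -- Applying the left multiplication by (a, c) to the unit (1, −f 1 1) recovers c.
  let g : DownUpAlgebra α β 0 →ₗ[K] DownUpAlgebra α β 0 :=
    LinearMap.snd K _ _ ∘ₗ LinearMap.applyₗ (1, -f 1 1) ∘ₗ L.toLinearMap
  have hg : ∀ a c, L a = extMul f (a, c) → g a = c := by
    intro a c h
    simp [g, h, extMul_apply, cocycle_apply_one hf a]
  have hone : extMul f (1, - f 1 1) = 1 := by
    refine LinearMap.ext fun y => ?_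
    have h : 1 * f 1 y.1 - f (1 * 1) y.1 + f 1 (1 * y.1) - f 1 1 * y.1 = 0 := hf 1 1 y.1
    simp only [one_mul, sub_self, zero_add, sub_eq_zero] at h
    ext
    · simp [extMul_apply]
    · simp [extMul_apply, h]
  have hL : ∀ a, L a = extMul f (a, g a) := by
    suffices ∀ a, ∃ c, L a = extMul f (a, c) by
      intro a
      obtain ⟨c, hc⟩ := this a
      rw [hg a c hc, hc]
    intro a
    induction a using word_induction with
    | hw w =>
      induction w with
      | nil => exact ⟨-f 1 1, by simp [hone]⟩
      | cons x w ih =>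
        obtain ⟨c, hc⟩ := ih
        have hx : ∃ e, L (gen α β 0 x) = extMul f (gen α β 0 x, e) := by
          cases x
          · exact ⟨-p, by simp [L]⟩
          · exact ⟨-q, by simp [L]⟩
        obtain ⟨e, he⟩ := hx
        rw [word_cons, map_mul, hc, he, extMul_mul hf]
        exact ⟨_, rfl⟩
    | hadd a b ha hb =>
      obtain ⟨c, hc⟩ := ha
      obtain ⟨e, he⟩ := hb
      exact ⟨c + e, by rw [map_add, hc, he, ← map_add]; rfl⟩
    | hsmul k a ha =>
      obtain ⟨c, hc⟩ := ha
      exact ⟨k • c, by rw [map_smul, hc, ← map_smul]; rfl⟩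
  refine ⟨-g, fun a b => ?_⟩
  have h := map_mul L a b
  rw [hL a, hL b, extMul_mul hf] at h
  have := hg _ _ h
  simp only [LinearMap.neg_apply, this]
  noncomm_ring

end Coboundary

end DownUpAlgebra

/-! ### Multiplicatively independent roots and diagonal automorphisms of K[w₁, w₂] -/

/-- Two scalars that are nonzero and multiplicatively independent. -/
structure MulIndep {K : Type*} [Field K] (r₁ r₂ : K) : Prop where
  ne_zero₁ : r₁ ≠ 0
  ne_zero₂ : r₂ ≠ 0
  zpow_ne : ∀ i j : ℤ, (i, j) ≠ (0, 0) → r₁ ^ i * r₂ ^ j ≠ 1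

namespace MulIndep

variable {K : Type*} [Field K] {r₁ r₂ : K}

theorem ne (h : MulIndep r₁ r₂) : r₁ ≠ r₂ := by
  intro e
  refine h.zpow_ne 1 (-1) (by simp) ?_
  rw [e, zpow_one, zpow_neg_one, mul_inv_cancel₀ h.ne_zero₂]

theorem sub_ne_zero (h : MulIndep r₁ r₂) : r₁ - r₂ ≠ 0 := _root_.sub_ne_zero.2 h.ne

theorem pow_mul_pow_eq (h : MulIndep r₁ r₂) {i j k l : ℕ}
    (e : r₁ ^ i * r₂ ^ j = r₁ ^ k * r₂ ^ l) : i = k ∧ j = l := by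
  by_contra hne
  refine h.zpow_ne (i - k) (j - l) (by simp only [ne_eq, Prod.mk.injEq]; omega) ?_
  rw [zpow_sub₀ h.ne_zero₁, zpow_sub₀ h.ne_zero₂]
  simp only [zpow_natCast]
  rw [div_mul_div_comm, e, div_self]
  exact mul_ne_zero (pow_ne_zero _ h.ne_zero₁) (pow_ne_zero _ h.ne_zero₂)

theorem pow_ne_one₁ (h : MulIndep r₁ r₂) (k : ℕ) : r₁ ^ (k + 1) ≠ 1 := by
  intro e
  have := h.pow_mul_pow_eq (i := k + 1) (j := 0) (k := 0) (l := 0) (by simp [e])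
  omega

theorem pow_ne_one₂ (h : MulIndep r₁ r₂) (k : ℕ) : r₂ ^ (k + 1) ≠ 1 := by
  intro e
  have := h.pow_mul_pow_eq (i := 0) (j := k + 1) (k := 0) (l := 0) (by simp [e])
  omega

end MulIndep

section Scale

variable {K : Type*} [Field K]

/-- The automorphism `w₁ ↦ a w₁`, `w₂ ↦ b w₂` of `K[w₁, w₂]`. -/
noncomputable def scale (a b : K) : MvPolynomial (Fin 2) K →ₐ[K] MvPolynomial (Fin 2) K :=
  MvPolynomial.aeval ![a • MvPolynomial.X 0, b • MvPolynomial.X 1]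

@[simp]
theorem scale_X_zero (a b : K) : scale a b (MvPolynomial.X 0) = a • MvPolynomial.X 0 := by
  simp [scale]

@[simp]
theorem scale_X_one (a b : K) : scale a b (MvPolynomial.X 1) = b • MvPolynomial.X 1 := by
  simp [scale]

theorem scale_scale (a b a' b' : K) (p : MvPolynomial (Fin 2) K) :
    scale a b (scale a' b' p) = scale (a * a') (b * b') p := by
  have : (scale a b).comp (scale a' b') = scale (a * a') (b * b') := by
    ext i : 1
    fin_cases i
    · simp [smul_smul, mul_comm]
    · simp [smul_smul, mul_comm]
  exact DFunLike.congr_fun this p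

@[simp]
theorem scale_one_one (p : MvPolynomial (Fin 2) K) : scale 1 1 p = p := by
  have : scale (1 : K) 1 = AlgHom.id K _ := by
    ext i : 1
    fin_cases i <;> simp
  exact DFunLike.congr_fun this p

theorem monomial_eq_smul (m : Fin 2 →₀ ℕ) (c : K) :
    MvPolynomial.monomial m c =
      c • ((MvPolynomial.X 0 : MvPolynomial (Fin 2) K) ^ m 0 * MvPolynomial.X 1 ^ m 1) := by
  rw [MvPolynomial.monomial_eq, Finsupp.prod_fintype _ _ (by simp), Fin.prod_univ_two,
    MvPolynomial.smul_eq_C_mul]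

theorem scale_monomial (a b : K) (m : Fin 2 →₀ ℕ) (c : K) :
    scale a b (MvPolynomial.monomial m c) = MvPolynomial.monomial m (a ^ m 0 * b ^ m 1 * c) := by
  simp only [monomial_eq_smul, map_smul, map_mul, map_pow, scale_X_zero, scale_X_one,
    _root_.smul_pow, smul_mul_smul_comm, smul_smul]
  congr 1
  ring

theorem coeff_scale (a b : K) (m : Fin 2 →₀ ℕ) (p : MvPolynomial (Fin 2) K) :
    MvPolynomial.coeff m (scale a b p) = a ^ m 0 * b ^ m 1 * MvPolynomial.coeff m p := by
  induction p using MvPolynomial.induction_on' with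
  | monomial n c =>
    rw [scale_monomial, MvPolynomial.coeff_monomial, MvPolynomial.coeff_monomial]
    split_ifs with h
    · rw [h]
    · simp
  | add p q hp hq => rw [map_add, MvPolynomial.coeff_add, MvPolynomial.coeff_add, hp, hq, mul_add]

end Scale

/-! ### The commutative subalgebra K[w₁, w₂] of A -/

section Weights

/-- The `n`-th power of the automorphism `w₁ ↦ r₁ w₁`, `w₂ ↦ r₂ w₂` of `K[w₁, w₂]`. -/
noncomputable abbrev scalePow {K : Type*} [Field K] (r₁ r₂ : K) (n : ℤ) :
    MvPolynomial (Fin 2) K →ₐ[K] MvPolynomial (Fin 2) K :=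
  scale (r₁ ^ n) (r₂ ^ n)

theorem scalePow_scalePow {K : Type*} [Field K] {r₁ r₂ : K} (h : MulIndep r₁ r₂) (m n : ℤ)
    (p : MvPolynomial (Fin 2) K) :
    scalePow r₁ r₂ m (scalePow r₁ r₂ n p) = scalePow r₁ r₂ (m + n) p := by
  rw [scalePow, scalePow, scale_scale, ← zpow_add₀ h.ne_zero₁, ← zpow_add₀ h.ne_zero₂]

@[simp]
theorem scalePow_zero {K : Type*} [Field K] {r₁ r₂ : K}
    (p : MvPolynomial (Fin 2) K) :
    scalePow r₁ r₂ 0 p = p := by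
  simp [scalePow]

/-- The down-up algebra `A(r₁ + r₂, - r₁ r₂, 0)`. -/
abbrev RootDownUp {K : Type*} [Field K] (r₁ r₂ : K) : Type _ :=
  DownUpAlgebra (r₁ + r₂) (-(r₁ * r₂)) 0

namespace RootDownUp

variable {K : Type*} [Field K] (r₁ r₂ : K)

/-- The generator `u`. -/
noncomputable abbrev u : RootDownUp r₁ r₂ := DownUpAlgebra.gen _ _ 0 UDGen.u

/-- The generator `d`. -/
noncomputable abbrev d : RootDownUp r₁ r₂ := DownUpAlgebra.gen _ _ 0 UDGen.d

theorem ddu : d r₁ r₂ * d r₁ r₂ * u r₁ r₂ =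
    (r₁ + r₂) • (d r₁ r₂ * u r₁ r₂ * d r₁ r₂) - (r₁ * r₂) • (u r₁ r₂ * d r₁ r₂ * d r₁ r₂) := by
  have h := DownUpAlgebra.relDDU_gen (r₁ + r₂) (-(r₁ * r₂))
  rw [relDDU, sub_sub, sub_eq_zero] at h
  rw [h]
  module

theorem duu : d r₁ r₂ * u r₁ r₂ * u r₁ r₂ =
    (r₁ + r₂) • (u r₁ r₂ * d r₁ r₂ * u r₁ r₂) - (r₁ * r₂) • (u r₁ r₂ * u r₁ r₂ * d r₁ r₂) := by
  have h := DownUpAlgebra.relDUU_gen (r₁ + r₂) (-(r₁ * r₂))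
  rw [relDUU, sub_sub, sub_eq_zero] at h
  rw [h]
  module

/-- The eigenvector `(du - r₂ ud) / (r₁ - r₂)`. -/
noncomputable def w₁ : RootDownUp r₁ r₂ :=
  (r₁ - r₂)⁻¹ • (d r₁ r₂ * u r₁ r₂ - r₂ • (u r₁ r₂ * d r₁ r₂))

/-- The eigenvector `(r₁ ud - du) / (r₁ - r₂)`. -/
noncomputable def w₂ : RootDownUp r₁ r₂ :=
  (r₁ - r₂)⁻¹ • (r₁ • (u r₁ r₂ * d r₁ r₂) - d r₁ r₂ * u r₁ r₂)

/-- Moving d from left to right past an element of the span of ud and du sends ud to du and du to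
(r₁ + r₂) du − r₁r₂ ud. The characteristic polynomial is (X − r₁)(X − r₂), and w₁ belongs to r₁. -/
theorem d_mul_w₁ : d r₁ r₂ * w₁ r₁ r₂ = r₁ • (w₁ r₁ r₂ * d r₁ r₂) := by
  have h := ddu r₁ r₂
  simp only [mul_assoc] at h
  simp only [w₁, mul_smul_comm, smul_mul_assoc, mul_sub, sub_mul, mul_assoc, h]
  module

theorem d_mul_w₂ : d r₁ r₂ * w₂ r₁ r₂ = r₂ • (w₂ r₁ r₂ * d r₁ r₂) := by
  have h := ddu r₁ r₂
  simp only [mul_assoc] at h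
  simp only [w₂, mul_smul_comm, smul_mul_assoc, mul_sub, sub_mul, mul_assoc, h]
  module

theorem w₁_mul_u : w₁ r₁ r₂ * u r₁ r₂ = r₁ • (u r₁ r₂ * w₁ r₁ r₂) := by
  have h := duu r₁ r₂
  simp only [mul_assoc] at h
  simp only [w₁, mul_smul_comm, smul_mul_assoc, mul_sub, sub_mul, mul_assoc, h]
  module

theorem w₂_mul_u : w₂ r₁ r₂ * u r₁ r₂ = r₂ • (u r₁ r₂ * w₂ r₁ r₂) := by
  have h := duu r₁ r₂
  simp only [mul_assoc] at h
  simp only [w₂, mul_smul_comm, smul_mul_assoc, mul_sub, sub_mul, mul_assoc, h]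
  module

variable {r₁ r₂}

theorem w₁_add_w₂ (h : MulIndep r₁ r₂) : w₁ r₁ r₂ + w₂ r₁ r₂ = u r₁ r₂ * d r₁ r₂ := by
  rw [w₁, w₂, ← smul_add, inv_smul_eq_iff₀ h.sub_ne_zero]
  module

theorem smul_w₁_add_smul_w₂ (h : MulIndep r₁ r₂) :
    r₁ • w₁ r₁ r₂ + r₂ • w₂ r₁ r₂ = d r₁ r₂ * u r₁ r₂ := by
  rw [w₁, w₂, smul_comm r₁, smul_comm r₂, ← smul_add, inv_smul_eq_iff₀ h.sub_ne_zero]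
  module

/-- Reduce d²u² by either relation: the results differ by r₁r₂ times the commutator, and r₁r₂ is
nonzero. -/
theorem commute_ud_du (h : MulIndep r₁ r₂) :
    Commute (u r₁ r₂ * d r₁ r₂) (d r₁ r₂ * u r₁ r₂) := by
  have h₁ := congrArg (· * u r₁ r₂) (ddu r₁ r₂)
  have h₂ := congrArg (d r₁ r₂ * ·) (duu r₁ r₂)
  simp only [mul_assoc, sub_mul, mul_sub, smul_mul_assoc, mul_smul_comm] at h₁ h₂
  rw [h₁] at h₂
  have := smul_right_injective (RootDownUp r₁ r₂) (mul_ne_zero h.ne_zero₁ h.ne_zero₂)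
    (sub_right_injective h₂)
  simpa only [Commute, SemiconjBy, mul_assoc] using this

theorem commute_w₁_w₂ (h : MulIndep r₁ r₂) : Commute (w₁ r₁ r₂) (w₂ r₁ r₂) := by
  have hc := commute_ud_du h
  refine Commute.smul_left (Commute.smul_right (Commute.sub_left (Commute.sub_right
    (Commute.smul_right hc.symm _) (Commute.refl _)) (Commute.smul_left (Commute.sub_right
    (Commute.smul_right (Commute.refl _) _) hc) _)) _) _

/-- The embedding of `K[w₁, w₂]`. -/
noncomputable def poly (h : MulIndep r₁ r₂) : MvPolynomial (Fin 2) K →ₐ[K] RootDownUp r₁ r₂ :=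
  AddMonoidAlgebra.lift K (RootDownUp r₁ r₂) (Fin 2 →₀ ℕ)
    { toFun := fun m => w₁ r₁ r₂ ^ m.toAdd 0 * w₂ r₁ r₂ ^ m.toAdd 1
      map_one' := by simp
      map_mul' := fun m n => by
        have hc := ((commute_w₁_w₂ h).pow_pow (n.toAdd 0) (m.toAdd 1)).eq
        simp only [toAdd_mul, Finsupp.add_apply, pow_add, mul_assoc]
        rw [← mul_assoc (w₂ r₁ r₂ ^ m.toAdd 1), ← hc]
        simp only [mul_assoc] }

theorem poly_X_zero (h : MulIndep r₁ r₂) : poly h (MvPolynomial.X 0) = w₁ r₁ r₂ := by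
  simp [poly, MvPolynomial.X, MvPolynomial.monomial]

theorem poly_X_one (h : MulIndep r₁ r₂) : poly h (MvPolynomial.X 1) = w₂ r₁ r₂ := by
  simp [poly, MvPolynomial.X, MvPolynomial.monomial]

theorem u_mul_d (h : MulIndep r₁ r₂) :
    u r₁ r₂ * d r₁ r₂ = poly h (MvPolynomial.X 0 + MvPolynomial.X 1) := by
  rw [map_add, poly_X_zero, poly_X_one, w₁_add_w₂ h]

theorem d_mul_u (h : MulIndep r₁ r₂) :
    d r₁ r₂ * u r₁ r₂ = poly h (r₁ • MvPolynomial.X 0 + r₂ • MvPolynomial.X 1) := by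
  rw [map_add, map_smul, map_smul, poly_X_zero, poly_X_one, smul_w₁_add_smul_w₂ h]

theorem d_mul_poly (h : MulIndep r₁ r₂) (p : MvPolynomial (Fin 2) K) :
    d r₁ r₂ * poly h p = poly h (scalePow r₁ r₂ 1 p) * d r₁ r₂ := by
  induction p using MvPolynomial.induction_on with
  | C a =>
    rw [← MvPolynomial.algebraMap_eq, AlgHom.commutes, AlgHom.commutes, AlgHom.commutes]
    exact (Algebra.commutes _ _).symm
  | add p q hp hq => simp only [map_add, mul_add, add_mul, hp, hq]
  | mul_X p i hp =>
    rw [map_mul, ← mul_assoc, hp, mul_assoc, map_mul, map_mul, mul_assoc]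
    congr 1
    fin_cases i
    · simp [poly_X_zero, d_mul_w₁]
    · simp [poly_X_one, d_mul_w₂]

theorem poly_mul_u (h : MulIndep r₁ r₂) (p : MvPolynomial (Fin 2) K) :
    poly h p * u r₁ r₂ = u r₁ r₂ * poly h (scalePow r₁ r₂ 1 p) := by
  induction p using MvPolynomial.induction_on with
  | C a =>
    rw [← MvPolynomial.algebraMap_eq, AlgHom.commutes, AlgHom.commutes, AlgHom.commutes]
    exact Algebra.commutes _ _
  | add p q hp hq => simp only [map_add, mul_add, add_mul, hp, hq]
  | mul_X p i hp =>
    rw [mul_comm p, map_mul, mul_assoc, hp, ← mul_assoc, map_mul, map_mul, ← mul_assoc]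
    congr 1
    fin_cases i
    · simp [poly_X_zero, w₁_mul_u]
    · simp [poly_X_one, w₂_mul_u]

theorem u_mul_poly (h : MulIndep r₁ r₂) (p : MvPolynomial (Fin 2) K) :
    u r₁ r₂ * poly h p = poly h (scalePow r₁ r₂ (-1) p) * u r₁ r₂ := by
  rw [poly_mul_u, scalePow_scalePow h]
  simp

theorem d_pow_mul_poly (h : MulIndep r₁ r₂) (k : ℕ) (p : MvPolynomial (Fin 2) K) :
    d r₁ r₂ ^ k * poly h p = poly h (scalePow r₁ r₂ k p) * d r₁ r₂ ^ k := by
  induction k generalizing p with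
  | zero => simp
  | succ k ih =>
    rw [pow_succ, mul_assoc, d_mul_poly, ← mul_assoc, ih, scalePow_scalePow h, mul_assoc]
    push_cast
    rfl

theorem u_mul_poly_mul_d (h : MulIndep r₁ r₂) (p : MvPolynomial (Fin 2) K) :
    u r₁ r₂ * poly h p * d r₁ r₂ =
      poly h ((MvPolynomial.X 0 + MvPolynomial.X 1) * scalePow r₁ r₂ (-1) p) := by
  rw [u_mul_poly, mul_assoc, u_mul_d h, ← map_mul, mul_comm (scalePow _ _ _ _)]

theorem scalePow_X_add_X (n : ℤ) :
    scalePow r₁ r₂ n (MvPolynomial.X 0 + MvPolynomial.X 1) =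
      r₁ ^ n • MvPolynomial.X 0 + r₂ ^ n • MvPolynomial.X 1 := by
  simp

theorem d_pow_succ_mul_u (h : MulIndep r₁ r₂) (k : ℕ) :
    d r₁ r₂ ^ (k + 1) * u r₁ r₂ =
      poly h (scalePow r₁ r₂ (k + 1) (MvPolynomial.X 0 + MvPolynomial.X 1)) * d r₁ r₂ ^ k := by
  rw [pow_succ, mul_assoc, d_mul_u h, d_pow_mul_poly, ← scalePow_scalePow h, scalePow_X_add_X]
  simp

end RootDownUp

end Weights

/-! ### A faithful representation by weighted shifts -/

section WeightedShift

/-- The operator `f ↦ (n ↦ a n * f (n + k))` on sequences. -/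
def weightedShift (K : Type*) {R : Type*} [Field K] [CommRing R] [Algebra K R] (a : ℤ → R) (k : ℤ) :
    Module.End K (ℤ → R) where
  toFun f n := a n * f (n + k)
  map_add' f g := by ext n; simp [mul_add]
  map_smul' c f := by ext n; simp

theorem weightedShift_apply {K R : Type*} [Field K] [CommRing R] [Algebra K R] (a : ℤ → R) (k : ℤ)
    (f : ℤ → R) (n : ℤ) : weightedShift K a k f n = a n * f (n + k) := rfl

theorem weightedShift_mul {K R : Type*} [Field K] [CommRing R] [Algebra K R] (a b : ℤ → R)
    (k l : ℤ) : weightedShift K a k * weightedShift K b l =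
      weightedShift K (fun n => a n * b (n + k)) (k + l) := by
  ext f n
  simp [weightedShift_apply, mul_assoc, add_assoc]

end WeightedShift

namespace RootDownUp

variable {K : Type*} [Field K] {r₁ r₂ : K}

section Rep

/-- The sequences r₁ⁿ and r₂ⁿ both satisfy the recurrence. When d is the plain shift and u a
weighted one, both relations of A reduce to this recurrence for the weights of u. -/
theorem scalePow_recurrence (h : MulIndep r₁ r₂) (n : ℤ) :
    scalePow r₁ r₂ (n + 2) (MvPolynomial.X 0 + MvPolynomial.X 1) =
      (r₁ + r₂) • scalePow r₁ r₂ (n + 1) (MvPolynomial.X 0 + MvPolynomial.X 1)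
      - (r₁ * r₂) • scalePow r₁ r₂ n (MvPolynomial.X 0 + MvPolynomial.X 1) := by
  simp only [scalePow_X_add_X, zpow_add₀ h.ne_zero₁, zpow_add₀ h.ne_zero₂, zpow_one, zpow_two]
  module

/-- The representation of `A` by weighted shifts on the sequences `ℤ → K[w₁, w₂]`. -/
noncomputable def rep (h : MulIndep r₁ r₂) :
    RootDownUp r₁ r₂ →ₐ[K] Module.End K (ℤ → MvPolynomial (Fin 2) K) :=
  DownUpAlgebra.lift
    (weightedShift K (fun n => scalePow r₁ r₂ n (MvPolynomial.X 0 + MvPolynomial.X 1)) (-1))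
    (weightedShift K 1 1)
    (by
      refine LinearMap.ext fun f => funext fun n => ?_
      have e := scalePow_recurrence h n
      simp only [relDDU, LinearMap.sub_apply, LinearMap.smul_apply, Module.End.mul_apply,
        Pi.sub_apply, Pi.smul_apply, weightedShift_apply, Pi.one_apply, one_mul,
        LinearMap.zero_apply, Pi.zero_apply, add_assoc, Int.reduceAdd, Int.reduceNeg,
        one_add_one_eq_two] at e ⊢
      rw [e, sub_mul, smul_mul_assoc, smul_mul_assoc]
      module)
    (by
      refine LinearMap.ext fun f => funext fun n => ?_
      have e := scalePow_recurrence h (n + -1)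
      simp only [relDUU, LinearMap.sub_apply, LinearMap.smul_apply, Module.End.mul_apply,
        Pi.sub_apply, Pi.smul_apply, weightedShift_apply, Pi.one_apply, one_mul,
        LinearMap.zero_apply, Pi.zero_apply, add_assoc, Int.reduceAdd, Int.reduceNeg,
        add_zero] at e ⊢
      rw [e, sub_mul, smul_mul_assoc, smul_mul_assoc]
      simp only [mul_left_comm (scalePow r₁ r₂ (n + -1) _)]
      module)

theorem rep_u (h : MulIndep r₁ r₂) : rep h (u r₁ r₂) =
    weightedShift K (fun n => scalePow r₁ r₂ n (MvPolynomial.X 0 + MvPolynomial.X 1)) (-1) := by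
  simp [rep, u]

theorem rep_d (h : MulIndep r₁ r₂) : rep h (d r₁ r₂) = weightedShift K 1 1 := by
  simp [rep, d]

theorem rep_w₁ (h : MulIndep r₁ r₂) : rep h (w₁ r₁ r₂) =
    weightedShift K (fun n => scalePow r₁ r₂ n (MvPolynomial.X 0)) 0 := by
  rw [w₁, map_smul, inv_smul_eq_iff₀ h.sub_ne_zero]
  refine LinearMap.ext fun f => funext fun n => ?_
  simp only [map_sub, map_smul, map_mul, rep_u, rep_d, LinearMap.sub_apply, LinearMap.smul_apply,
    Module.End.mul_apply, Pi.sub_apply, Pi.smul_apply, weightedShift_apply, Pi.one_apply, one_mul,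
    neg_add_cancel_right, add_neg_cancel_right, scalePow_X_add_X, add_zero, scale_X_zero,
    zpow_add₀ h.ne_zero₁, zpow_add₀ h.ne_zero₂, zpow_one, add_mul, smul_mul_assoc]
  module

theorem rep_w₂ (h : MulIndep r₁ r₂) : rep h (w₂ r₁ r₂) =
    weightedShift K (fun n => scalePow r₁ r₂ n (MvPolynomial.X 1)) 0 := by
  rw [w₂, map_smul, inv_smul_eq_iff₀ h.sub_ne_zero]
  refine LinearMap.ext fun f => funext fun n => ?_
  simp only [map_sub, map_smul, map_mul, rep_u, rep_d, LinearMap.sub_apply, LinearMap.smul_apply,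
    Module.End.mul_apply, Pi.sub_apply, Pi.smul_apply, weightedShift_apply, Pi.one_apply, one_mul,
    neg_add_cancel_right, add_neg_cancel_right, scalePow_X_add_X, add_zero, scale_X_one,
    zpow_add₀ h.ne_zero₁, zpow_add₀ h.ne_zero₂, zpow_one, add_mul, smul_mul_assoc]
  module

theorem rep_poly (h : MulIndep r₁ r₂) (p : MvPolynomial (Fin 2) K) :
    rep h (poly h p) = weightedShift K (fun n => scalePow r₁ r₂ n p) 0 := by
  induction p using MvPolynomial.induction_on with
  | C a =>
    refine LinearMap.ext fun f => funext fun n => ?_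
    rw [← MvPolynomial.algebraMap_eq, AlgHom.commutes, AlgHom.commutes]
    simp [weightedShift_apply, Algebra.smul_def]
  | add p q hp hq =>
    refine LinearMap.ext fun f => funext fun n => ?_
    simp [hp, hq, weightedShift_apply, add_mul]
  | mul_X p i hp =>
    rw [map_mul, map_mul, hp]
    refine LinearMap.ext fun f => funext fun n => ?_
    fin_cases i
    · simp [poly_X_zero, rep_w₁, weightedShift_apply, mul_assoc]
    · simp [poly_X_one, rep_w₂, weightedShift_apply, mul_assoc]

theorem rep_d_pow (h : MulIndep r₁ r₂) (k : ℕ) :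
    rep h (d r₁ r₂ ^ k) = weightedShift K 1 k := by
  induction k with
  | zero =>
    refine LinearMap.ext fun f => funext fun n => ?_
    simp [weightedShift_apply]
  | succ k ih =>
    rw [pow_succ, map_mul, ih, rep_d, weightedShift_mul]
    simp [Pi.one_def]

theorem rep_poly_mul_d_pow (h : MulIndep r₁ r₂) (p : MvPolynomial (Fin 2) K) (k : ℕ) :
    rep h (poly h p * d r₁ r₂ ^ k) = weightedShift K (fun n => scalePow r₁ r₂ n p) k := by
  rw [map_mul, rep_poly, rep_d_pow, weightedShift_mul]
  simp

/-- The operator of p dᵏ, applied to the constant sequence 1, has value p at index 0. -/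
theorem poly_mul_d_pow_injective (h : MulIndep r₁ r₂) (k : ℕ) {p q : MvPolynomial (Fin 2) K}
    (e : poly h p * d r₁ r₂ ^ k = poly h q * d r₁ r₂ ^ k) : p = q := by
  have := congrFun (LinearMap.congr_fun (congrArg (rep h) e) 1) 0
  simpa [rep_poly_mul_d_pow, weightedShift_apply] using this

theorem scalePow_injective (h : MulIndep r₁ r₂) (n : ℤ) :
    Function.Injective (scalePow r₁ r₂ n) := by
  intro p q e
  have := congrArg (scalePow r₁ r₂ (-n)) e
  simpa [scalePow_scalePow h] using this

theorem X_add_X_ne_zero : (MvPolynomial.X 0 + MvPolynomial.X 1 : MvPolynomial (Fin 2) K) ≠ 0 := by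
  intro e
  have := congrArg (MvPolynomial.eval ![1, 0]) e
  simp at this

theorem exists_rep_u_pow (h : MulIndep r₁ r₂) (k : ℕ) :
    ∃ a : ℤ → MvPolynomial (Fin 2) K, (∀ n, a n ≠ 0) ∧
      rep h (u r₁ r₂ ^ k) = weightedShift K a (-k) := by
  induction k with
  | zero =>
    refine ⟨1, fun n => one_ne_zero, ?_⟩
    simpa using rep_d_pow h 0
  | succ k ih =>
    obtain ⟨a, ha, e⟩ := ih
    refine ⟨fun n => a n * scalePow r₁ r₂ (n + -k) (MvPolynomial.X 0 + MvPolynomial.X 1), ?_, ?_⟩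
    rotate_left
    · rw [pow_succ, map_mul, e, rep_u, weightedShift_mul]
      push_cast
      rw [neg_add]
    · intro n
      refine mul_ne_zero (ha n) ?_
      rw [ne_eq, map_eq_zero_iff _ (scalePow_injective h _)]
      exact X_add_X_ne_zero

theorem u_pow_mul_poly_eq_zero (h : MulIndep r₁ r₂) (k : ℕ) {p : MvPolynomial (Fin 2) K}
    (e : rep h (u r₁ r₂ ^ k * poly h p) = 0) : p = 0 := by
  obtain ⟨a, ha, hu⟩ := exists_rep_u_pow h k
  have := congrFun (LinearMap.congr_fun e 1) 0
  rw [map_mul, hu, rep_poly, weightedShift_mul] at this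
  simpa [weightedShift_apply, ha, map_eq_zero_iff _ (scalePow_injective h _)] using this

end Rep

section Weight

/-- The weights of the generators: `u` has weight `1` and `d` has weight `-1`. -/
def genWeight : UDGen → ℤ
  | UDGen.u => 1
  | UDGen.d => -1

/-- Since ud and du lie in K[w₁, w₂], a letter put in front of a normal form either extends the
power of u or d or cancels one factor of it into a polynomial. -/
theorem word_form (h : MulIndep r₁ r₂) (w : List UDGen) :
    (∃ (k : ℕ) (p : MvPolynomial (Fin 2) K), (w.map genWeight).sum = -k ∧
      DownUpAlgebra.word _ _ 0 w = poly h p * d r₁ r₂ ^ k) ∨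
    (∃ (k : ℕ) (p : MvPolynomial (Fin 2) K), (w.map genWeight).sum = k ∧
      DownUpAlgebra.word _ _ 0 w = u r₁ r₂ ^ k * poly h p) := by
  induction w with
  | nil => exact Or.inl ⟨0, 1, by simp, by simp⟩
  | cons x w ih =>
    rw [List.map_cons, List.sum_cons, DownUpAlgebra.word_cons]
    cases x
    · rcases ih with ⟨k, p, hk, e⟩ | ⟨k, p, hk, e⟩
      · rcases k with _ | k
        · exact Or.inr ⟨1, p, by simp [hk, genWeight], by rw [e]; simp⟩
        · refine Or.inl ⟨k, (MvPolynomial.X 0 + MvPolynomial.X 1) * scalePow r₁ r₂ (-1) p, ?_, ?_⟩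
          · rw [hk]; simp [genWeight]
          · rw [e, pow_succ', ← mul_assoc, ← mul_assoc, u_mul_poly_mul_d]
      · exact Or.inr ⟨k + 1, p, by rw [hk]; simp [genWeight, add_comm],
          by rw [e, pow_succ', mul_assoc]⟩
    · rcases ih with ⟨k, p, hk, e⟩ | ⟨k, p, hk, e⟩
      · refine Or.inl ⟨k + 1, scalePow r₁ r₂ 1 p, by rw [hk]; simp [genWeight], ?_⟩
        rw [e, ← mul_assoc, d_mul_poly, pow_succ', mul_assoc]
      · rcases k with _ | k
        · refine Or.inl ⟨1, scalePow r₁ r₂ 1 p, by simp [hk, genWeight], ?_⟩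
          rw [e, pow_zero, one_mul, d_mul_poly, pow_one]
        · have hcomm : ∀ q, ∃ q', poly h q * u r₁ r₂ ^ k = u r₁ r₂ ^ k * poly h q' := by
            clear e hk
            induction k with
            | zero => exact fun q => ⟨q, by simp⟩
            | succ k ih =>
              intro q
              obtain ⟨q', hq'⟩ := ih q
              exact ⟨_, by rw [pow_succ, ← mul_assoc, hq', mul_assoc, poly_mul_u, ← mul_assoc]⟩
          obtain ⟨q', hq'⟩ := hcomm (r₁ • MvPolynomial.X 0 + r₂ • MvPolynomial.X 1)
          refine Or.inr ⟨k, q' * p, by rw [hk]; simp [genWeight], ?_⟩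
          rw [e, pow_succ', ← mul_assoc, ← mul_assoc, d_mul_u h, hq', map_mul, mul_assoc]

variable (r₁ r₂) in
/-- The weight components of `A`. -/
abbrev weightSpace (n : ℤ) : Submodule K (RootDownUp r₁ r₂) :=
  DownUpAlgebra.grading (r₁ + r₂) (-(r₁ * r₂)) genWeight n

theorem u_mem_weightSpace : u r₁ r₂ ∈ weightSpace r₁ r₂ 1 :=
  DownUpAlgebra.gen_mem_grading _ _ genWeight UDGen.u

theorem d_mem_weightSpace : d r₁ r₂ ∈ weightSpace r₁ r₂ (-1) :=
  DownUpAlgebra.gen_mem_grading _ _ genWeight UDGen.d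

theorem exists_poly_mul_d_pow (h : MulIndep r₁ r₂) (k : ℕ) {a : RootDownUp r₁ r₂}
    (ha : a ∈ weightSpace r₁ r₂ (-k)) : ∃ p, a = poly h p * d r₁ r₂ ^ k := by
  induction ha using Submodule.span_induction with
  | mem a ha =>
    obtain ⟨w, hw, rfl⟩ := ha
    rcases word_form h w with ⟨l, p, hl, e⟩ | ⟨l, p, hl, e⟩
    · obtain rfl : l = k := by omega
      exact ⟨p, e⟩
    · obtain rfl : l = 0 := by omega
      obtain rfl : k = 0 := by omega
      exact ⟨p, by rw [e]; simp⟩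
  | zero => exact ⟨0, by simp⟩
  | add a b _ _ ha hb =>
    obtain ⟨p, rfl⟩ := ha
    obtain ⟨q, rfl⟩ := hb
    exact ⟨p + q, by rw [map_add, add_mul]⟩
  | smul c a _ ha =>
    obtain ⟨p, rfl⟩ := ha
    exact ⟨c • p, by rw [map_smul, smul_mul_assoc]⟩

theorem exists_u_pow_mul_poly (h : MulIndep r₁ r₂) (k : ℕ) {a : RootDownUp r₁ r₂}
    (ha : a ∈ weightSpace r₁ r₂ k) : ∃ p, a = u r₁ r₂ ^ k * poly h p := by
  induction ha using Submodule.span_induction with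
  | mem a ha =>
    obtain ⟨w, hw, rfl⟩ := ha
    rcases word_form h w with ⟨l, p, hl, e⟩ | ⟨l, p, hl, e⟩
    · obtain rfl : l = 0 := by omega
      obtain rfl : k = 0 := by omega
      exact ⟨p, by rw [e]; simp⟩
    · obtain rfl : l = k := by omega
      exact ⟨p, e⟩
  | zero => exact ⟨0, by simp⟩
  | add a b _ _ ha hb =>
    obtain ⟨p, rfl⟩ := ha
    obtain ⟨q, rfl⟩ := hb
    exact ⟨p + q, by rw [map_add, mul_add]⟩
  | smul c a _ ha =>
    obtain ⟨p, rfl⟩ := ha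
    exact ⟨c • p, by rw [map_smul, mul_smul_comm]⟩

theorem exists_rep_of_mem_weightSpace (h : MulIndep r₁ r₂) (n : ℤ) {a : RootDownUp r₁ r₂}
    (ha : a ∈ weightSpace r₁ r₂ n) :
    (∃ c, rep h a = weightedShift K c (-n)) ∧ (rep h a = 0 → a = 0) := by
  obtain ⟨k, rfl | rfl⟩ := n.eq_nat_or_neg
  · obtain ⟨p, rfl⟩ := exists_u_pow_mul_poly h k ha
    refine ⟨?_, fun e => by rw [u_pow_mul_poly_eq_zero h k e, map_zero, mul_zero]⟩
    obtain ⟨c, -, e⟩ := exists_rep_u_pow h k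
    rw [map_mul, e, rep_poly, weightedShift_mul, add_zero]
    exact ⟨_, rfl⟩
  · obtain ⟨p, rfl⟩ := exists_poly_mul_d_pow h k ha
    rw [rep_poly_mul_d_pow, neg_neg]
    refine ⟨⟨_, rfl⟩, fun e => ?_⟩
    have := congrFun (LinearMap.congr_fun e 1) 0
    simp only [weightedShift_apply, scalePow_zero] at this
    rw [show p = 0 by simpa using this, map_zero, zero_mul]

/-- Weight n acts by a shift by −n, so a sequence supported at one index separates the weights; on a
single weight space `rep` is already injective. -/
theorem rep_injective (h : MulIndep r₁ r₂) : Function.Injective (rep h) := by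
  rw [injective_iff_map_eq_zero]
  intro a ha
  obtain ⟨s, hs⟩ := DownUpAlgebra.exists_finset_sum_proj _ _ genWeight a
  have hs := hs s subset_rfl
  have hmem := fun n => DownUpAlgebra.proj_mem _ _ genWeight n a
  choose c hc using fun n => (exists_rep_of_mem_weightSpace h n (hmem n)).1
  rw [← hs]
  refine Finset.sum_eq_zero fun n hn => (exists_rep_of_mem_weightSpace h n (hmem n)).2 ?_
  rw [hc]
  refine LinearMap.ext fun f => funext fun m => ?_
  -- Among the shifts, only the one by −n sees the support m − n from the index m.
  have e := congrFun (LinearMap.congr_fun ha (Pi.single (m + -n) 1)) m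
  rw [← hs, map_sum, LinearMap.sum_apply, Finset.sum_apply, Finset.sum_eq_single n] at e
  · rw [hc, weightedShift_apply, Pi.single_eq_same, mul_one] at e
    rw [weightedShift_apply, e]
    simp
  · intro l _ hl
    rw [hc, weightedShift_apply, Pi.single_eq_of_ne (by omega), mul_zero]
  · exact fun hn' => absurd hn hn'

end Weight

end RootDownUp

namespace DownUpAlgebra

/-! ### Cocycles from derivations into a larger algebra -/

section Lifting

variable {K : Type*} [Field K]

/-- A derivation of the free algebra along an algebra map `ρ` from `A(α, β, 0)` that maps the
relations to the image of `ρ` maps their ideal to the image of `ρ`. -/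
theorem exists_derivation {α β : K} {B : Type*} [Ring B] [Algebra K B]
    (ρ : DownUpAlgebra α β 0 →ₐ[K] B) (p q : B) (a b : DownUpAlgebra α β 0)
    (ha : linDDU α β (ρ (gen α β 0 UDGen.u)) (ρ (gen α β 0 UDGen.d)) p q = ρ a)
    (hb : linDUU α β (ρ (gen α β 0 UDGen.u)) (ρ (gen α β 0 UDGen.d)) p q = ρ b) :
    ∃ D : FreeAlgebra K UDGen →ₗ[K] B,
      (∀ x y, D (x * y) = ρ (RingQuot.mkAlgHom K (DownUpRel α β 0) x) * D y +
        D x * ρ (RingQuot.mkAlgHom K (DownUpRel α β 0) y)) ∧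
      D (FreeAlgebra.ι K UDGen.u) = p ∧ D (FreeAlgebra.ι K UDGen.d) = q ∧
      ∀ x, RingQuot.mkAlgHom K (DownUpRel α β 0) x = 0 → ∃ c, D x = ρ c := by
  set π := RingQuot.mkAlgHom K (DownUpRel α β (0 : K)) with hπ
  have h0 : (0 : B →ₗ[K] B →ₗ[K] B) ∈ hochschildCocycles₂ K B := Submodule.zero_mem _
  -- A derivation along ρ is the second entry of an algebra map into the trivial square-zero
  -- extension, the one of the zero cocycle.
  let F : FreeAlgebra K UDGen →ₐ[K] Module.End K (B × B) := FreeAlgebra.lift K fun x =>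
    UDGen.casesOn x (extMul 0 (ρ (gen α β 0 UDGen.u), p)) (extMul 0 (ρ (gen α β 0 UDGen.d), q))
  let D : FreeAlgebra K UDGen →ₗ[K] B :=
    LinearMap.snd K _ _ ∘ₗ LinearMap.applyₗ (1, 0) ∘ₗ F.toLinearMap
  have hD : ∀ x c e, F x = extMul 0 (c, e) → D x = e := by
    intro x c e hx
    simp [D, hx, extMul_apply]
  have hFu : F (FreeAlgebra.ι K UDGen.u) = extMul 0 (ρ (gen α β 0 UDGen.u), p) := by simp [F]
  have hFd : F (FreeAlgebra.ι K UDGen.d) = extMul 0 (ρ (gen α β 0 UDGen.d), q) := by simp [F]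
  have hone : extMul (0 : B →ₗ[K] B →ₗ[K] B) (1, 0) = 1 := by
    refine LinearMap.ext fun y => ?_
    simp [extMul_apply]
  have hF : ∀ x, F x = extMul 0 (ρ (π x), D x) := by
    suffices ∀ x, ∃ c, F x = extMul 0 (ρ (π x), c) by
      intro x
      obtain ⟨c, hc⟩ := this x
      rw [hD x _ c hc, hc]
    intro x
    induction x using FreeAlgebra.induction with
    | grade0 r =>
      refine ⟨0, ?_⟩
      rw [AlgHom.commutes, AlgHom.commutes, AlgHom.commutes, Algebra.algebraMap_eq_smul_one,
        Algebra.algebraMap_eq_smul_one, ← hone, ← map_smul]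
      simp
    | grade1 x =>
      cases x
      · exact ⟨p, hFu⟩
      · exact ⟨q, hFd⟩
    | mul x y hx hy =>
      obtain ⟨c, hc⟩ := hx
      obtain ⟨e, he⟩ := hy
      exact ⟨_, by rw [map_mul, hc, he, extMul_mul h0, map_mul, map_mul]⟩
    | add x y hx hy =>
      obtain ⟨c, hc⟩ := hx
      obtain ⟨e, he⟩ := hy
      exact ⟨c + e, by rw [map_add, hc, he, ← map_add, map_add π, map_add ρ]; rfl⟩
  -- Congruence modulo the elements that F sends to some (0, ρ c). It identifies both relations with
  -- 0, so its quotient receives a map from A. Therefore every x in the kernel of the projection to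
  -- A is congruent to 0, that is, D x is in the image of ρ.
  let T : RingCon (FreeAlgebra K UDGen) :=
    { r := fun x y => ∃ c, F x - F y = extMul 0 (0, ρ c)
      iseqv := by
        refine ⟨fun x => ⟨0, ?_⟩, ?_, ?_⟩
        · rw [sub_self, map_zero]; exact (map_zero _).symm
        · rintro x y ⟨c, hc⟩
          refine ⟨-c, ?_⟩
          rw [← neg_sub, hc, ← map_neg]
          exact congrArg _ (by simp)
        · rintro x y z ⟨c, hc⟩ ⟨e, he⟩
          refine ⟨c + e, ?_⟩
          rw [← sub_add_sub_cancel, hc, he, ← map_add]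
          exact congrArg _ (by simp)
      add' := by
        rintro x y z w ⟨c, hc⟩ ⟨e, he⟩
        refine ⟨c + e, ?_⟩
        rw [map_add, map_add, add_sub_add_comm, hc, he, ← map_add]
        exact congrArg _ (by simp)
      mul' := by
        rintro x y z w ⟨c, hc⟩ ⟨e, he⟩
        refine ⟨c * π z + π y * e, ?_⟩
        have : F (x * z) - F (y * w) = (F x - F y) * F z + F y * (F z - F w) := by
          rw [map_mul, map_mul]; noncomm_ring
        rw [this, hc, he, hF z, hF y, extMul_mul h0, extMul_mul h0, ← map_add]
        exact congrArg _ (by simp) }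
  have hTu : T (relDDU α β (FreeAlgebra.ι K UDGen.u) (FreeAlgebra.ι K UDGen.d)) 0 := by
    refine ⟨a, ?_⟩
    have : F (relDDU α β (FreeAlgebra.ι K UDGen.u) (FreeAlgebra.ι K UDGen.d)) =
        relDDU α β (F (FreeAlgebra.ι K UDGen.u)) (F (FreeAlgebra.ι K UDGen.d)) := by
      simp [relDDU]
    have hρ : relDDU α β (ρ (gen α β 0 UDGen.u)) (ρ (gen α β 0 UDGen.d)) = 0 := by
      simpa [relDDU] using congrArg ρ (relDDU_gen α β)
    rw [this, hFu, hFd, relDDU_extMul h0, hρ, ha, map_zero, sub_zero]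
    simp [obstrDDU]
  have hTd : T (relDUU α β (FreeAlgebra.ι K UDGen.u) (FreeAlgebra.ι K UDGen.d)) 0 := by
    refine ⟨b, ?_⟩
    have : F (relDUU α β (FreeAlgebra.ι K UDGen.u) (FreeAlgebra.ι K UDGen.d)) =
        relDUU α β (F (FreeAlgebra.ι K UDGen.u)) (F (FreeAlgebra.ι K UDGen.d)) := by
      simp [relDUU]
    have hρ : relDUU α β (ρ (gen α β 0 UDGen.u)) (ρ (gen α β 0 UDGen.d)) = 0 := by
      simpa [relDUU] using congrArg ρ (relDUU_gen α β)
    rw [this, hFu, hFd, relDUU_extMul h0, hρ, hb, map_zero, sub_zero]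
    simp [obstrDUU]
  let L : DownUpAlgebra α β 0 →ₐ[K] T.Quotient :=
    lift (T.mkₐ (α := K) (FreeAlgebra.ι K UDGen.u)) (T.mkₐ (α := K) (FreeAlgebra.ι K UDGen.d))
      (by
        have := (RingCon.eq T).2 hTu
        simpa [relDDU] using this)
      (by
        have := (RingCon.eq T).2 hTd
        simpa [relDUU] using this)
  have hL : L.comp π = T.mkₐ (α := K) := by
    ext x
    cases x
    · exact lift_u _ _ _ _
    · exact lift_d _ _ _ _
  refine ⟨D, fun x y => ?_, hD _ _ _ hFu, hD _ _ _ hFd, fun x hx => ?_⟩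
  · refine hD _ (ρ (π x) * ρ (π y)) _ ?_
    rw [map_mul, hF x, hF y, extMul_mul h0]
    simp
  · have h1 : T.mkₐ (α := K) x = T.mkₐ (α := K) 0 := by
      rw [← hL, AlgHom.comp_apply, hx, AlgHom.comp_apply, map_zero π]
    obtain ⟨c, hc⟩ := (RingCon.eq T).1 h1
    refine ⟨c, hD x 0 _ ?_⟩
    rw [← hc, map_zero, sub_zero]

/-- A pair of values of the relations that is a coboundary in an extension of `A(α, β, 0)` is the
obstruction of a cocycle, up to the coboundaries. -/
theorem exists_cocycle_of_rep {α β : K} {B : Type*} [Ring B] [Algebra K B]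
    (ρ : DownUpAlgebra α β 0 →ₐ[K] B) (hρ : Function.Injective ρ) (p q : B)
    (a b : DownUpAlgebra α β 0)
    (ha : linDDU α β (ρ (gen α β 0 UDGen.u)) (ρ (gen α β 0 UDGen.d)) p q = ρ a)
    (hb : linDUU α β (ρ (gen α β 0 UDGen.u)) (ρ (gen α β 0 UDGen.d)) p q = ρ b) :
    ∃ f ∈ hochschildCocycles₂ K (DownUpAlgebra α β 0), ∃ x y : DownUpAlgebra α β 0,
      obstrDDU α β (gen α β 0 UDGen.u) (gen α β 0 UDGen.d) f =
        a + linDDU α β (gen α β 0 UDGen.u) (gen α β 0 UDGen.d) x y ∧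
      obstrDUU α β (gen α β 0 UDGen.u) (gen α β 0 UDGen.d) f =
        b + linDUU α β (gen α β 0 UDGen.u) (gen α β 0 UDGen.d) x y := by
  obtain ⟨D, hD, hDu, hDd, hDker⟩ := exists_derivation ρ p q a b ha hb
  have hπ := RingQuot.mkAlgHom_surjective K (DownUpRel α β (0 : K))
  obtain ⟨s, hs⟩ := LinearMap.exists_rightInverse_of_surjective
    (RingQuot.mkAlgHom K (DownUpRel α β (0 : K))).toLinearMap (LinearMap.range_eq_top.2 hπ)
  have hs : ∀ c, RingQuot.mkAlgHom K (DownUpRel α β (0 : K)) (s c) = c :=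
    fun c => LinearMap.congr_fun hs c
  obtain ⟨t, ht⟩ := ρ.toLinearMap.exists_leftInverse_of_injective
    (LinearMap.ker_eq_bot.2 hρ)
  have ht : ∀ c, t (ρ c) = c := fun c => LinearMap.congr_fun ht c
  -- The coboundary of g is D of s x · s y − s (x y), an element of the kernel, so it takes values
  -- in ρ(A) and t pulls it back to A. As g itself takes values in B, the resulting cocycle need not
  -- be a coboundary over A.
  let g : DownUpAlgebra α β 0 →ₗ[K] B := D ∘ₗ s
  let f : DownUpAlgebra α β 0 →ₗ[K] DownUpAlgebra α β 0 →ₗ[K] DownUpAlgebra α β 0 :=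
    LinearMap.mk₂ K (fun x y => t (ρ x * g y - g (x * y) + g x * ρ y))
      (fun x x' y => by rw [← map_add]; congr 1; simp only [map_add, add_mul]; abel)
      (fun k x y => by
        rw [← map_smul]; congr 1
        simp only [map_smul, smul_mul_assoc]; module)
      (fun x y y' => by rw [← map_add]; congr 1; simp only [map_add, mul_add]; abel)
      (fun k x y => by
        rw [← map_smul]; congr 1
        simp only [map_smul, mul_smul_comm]; module)
  have hf : ∀ x y, ρ (f x y) = ρ x * g y - g (x * y) + g x * ρ y := by
    intro x y
    obtain ⟨c, hc⟩ := hDker (s x * s y - s (x * y)) (by rw [map_sub, map_mul, hs, hs, hs, sub_self])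
    have : ρ x * g y - g (x * y) + g x * ρ y = ρ c := by
      rw [← hc, map_sub, hD, hs, hs]
      simp only [g, LinearMap.comp_apply]
      abel
    simp only [f, LinearMap.mk₂_apply]
    rw [this, ht]
  -- The section s need not send the generators of A to the free generators; the differences account
  -- for the correction (x, y).
  obtain ⟨x, hx⟩ := hDker (s (gen α β 0 UDGen.u) - FreeAlgebra.ι K UDGen.u)
    (by rw [map_sub, hs, gen, sub_self])
  obtain ⟨y, hy⟩ := hDker (s (gen α β 0 UDGen.d) - FreeAlgebra.ι K UDGen.d)
    (by rw [map_sub, hs, gen, sub_self])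
  have hgu : g (gen α β 0 UDGen.u) = p + ρ x := by
    rw [← hx, map_sub, hDu]
    simp [g]
  have hgd : g (gen α β 0 UDGen.d) = q + ρ y := by
    rw [← hy, map_sub, hDd]
    simp [g]
  refine ⟨f, fun x y z => hρ ?_, x, y, hρ ?_, hρ ?_⟩
  · simp only [map_add, map_sub, map_mul, hf, map_zero, mul_add, mul_sub, add_mul, sub_mul,
      mul_assoc]
    abel
  · have e : ρ (linDDU α β (gen α β 0 UDGen.u) (gen α β 0 UDGen.d) x y) =
        linDDU α β (ρ (gen α β 0 UDGen.u)) (ρ (gen α β 0 UDGen.d)) (ρ x) (ρ y) := by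
      simp [linDDU]
    have h := congrArg g (relDDU_gen α β)
    simp only [relDDU, map_sub, map_smul, map_zero] at h
    rw [map_add, e, ← ha, ← linDDU_add, ← hgu, ← hgd, ← sub_eq_zero, ← neg_eq_zero.2 h]
    simp only [obstrDDU, linDDU, map_add, map_sub, map_smul, map_mul, hf, sub_mul, add_mul,
      mul_assoc]
    module
  · have e : ρ (linDUU α β (gen α β 0 UDGen.u) (gen α β 0 UDGen.d) x y) =
        linDUU α β (ρ (gen α β 0 UDGen.u)) (ρ (gen α β 0 UDGen.d)) (ρ x) (ρ y) := by
      simp [linDUU]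
    have h := congrArg g (relDUU_gen α β)
    simp only [relDUU, map_sub, map_smul, map_zero] at h
    rw [map_add, e, ← hb, ← linDUU_add, ← hgu, ← hgd, ← sub_eq_zero, ← neg_eq_zero.2 h]
    simp only [obstrDUU, linDUU, map_add, map_sub, map_smul, map_mul, hf, sub_mul, add_mul,
      mul_assoc]
    module

end Lifting

end DownUpAlgebra

/-! ### Existence of cocycles with obstruction (e d, u e) -/

namespace RootDownUp

open DownUpAlgebra

variable {K : Type*} [Field K] {r₁ r₂ : K}

section Solve

/-- Monomials are eigenvectors of σ, so this is a scalar recurrence with right-hand side c lⁿ. A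
multiple of lⁿ solves it unless l is a root, and the resonant case is solved by a multiple of n lⁿ.
-/
theorem exists_recurrence_solution (h : MulIndep r₁ r₂) (e : MvPolynomial (Fin 2) K) :
    ∃ P : ℤ → MvPolynomial (Fin 2) K, ∀ n,
      P (n + 1) - (r₁ + r₂) • P n + (r₁ * r₂) • P (n - 1) = scalePow r₁ r₂ n e := by
  induction e using MvPolynomial.induction_on' with
  | add p q hp hq =>
    obtain ⟨P, hP⟩ := hp
    obtain ⟨Q, hQ⟩ := hq
    refine ⟨P + Q, fun n => ?_⟩
    rw [map_add, ← hP, ← hQ]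
    simp only [Pi.add_apply]
    module
  | monomial m c =>
    suffices ∃ p : ℤ → K, ∀ n : ℤ, p (n + 1) - (r₁ + r₂) * p n + (r₁ * r₂) * p (n - 1) =
        (r₁ ^ m 0 * r₂ ^ m 1) ^ n * c by
      obtain ⟨p, hp⟩ := this
      refine ⟨fun n => MvPolynomial.monomial m (p n), fun n => ?_⟩
      have e : scalePow r₁ r₂ n (MvPolynomial.monomial m c) =
          MvPolynomial.monomial m ((r₁ ^ m 0 * r₂ ^ m 1) ^ n * c) := by
        rw [scale_monomial, mul_zpow, ← zpow_natCast, ← zpow_natCast, ← zpow_natCast,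
          ← zpow_natCast, zpow_comm r₁, zpow_comm r₂]
      rw [e, ← hp]
      simp only [map_add, map_sub, MvPolynomial.smul_monomial, smul_eq_mul]
    have h₁ := h.ne_zero₁
    have h₂ := h.ne_zero₂
    have h₃ := h.sub_ne_zero
    have h₄ : r₁ ^ m 0 * r₂ ^ m 1 ≠ 0 := mul_ne_zero (pow_ne_zero _ h₁) (pow_ne_zero _ h₂)
    generalize r₁ ^ m 0 * r₂ ^ m 1 = l at h₄
    by_cases hl₁ : l = r₁
    · subst hl₁
      -- On n lⁿ with l = r₁ the left-hand side is (r₁ − r₂) lⁿ.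
      refine ⟨fun n => c / (l - r₂) * n * l ^ n, fun n => ?_⟩
      beta_reduce
      rw [zpow_add₀ h₁, zpow_sub₀ h₁, zpow_one]
      push_cast
      field_simp
      ring
    by_cases hl₂ : l = r₂
    · subst hl₂
      refine ⟨fun n => c / (l - r₁) * n * l ^ n, fun n => ?_⟩
      have h₅ : l - r₁ ≠ 0 := sub_ne_zero.2 hl₁
      beta_reduce
      rw [zpow_add₀ h₂, zpow_sub₀ h₂, zpow_one]
      push_cast
      field_simp
      ring
    -- On lⁿ the left-hand side is (l − r₁)(l − r₂) l⁻¹ lⁿ.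
    · refine ⟨fun n => c * l / ((l - r₁) * (l - r₂)) * l ^ n, fun n => ?_⟩
      have h₅ : l - r₁ ≠ 0 := sub_ne_zero.2 hl₁
      have h₆ : l - r₂ ≠ 0 := sub_ne_zero.2 hl₂
      beta_reduce
      rw [zpow_add₀ h₄, zpow_sub₀ h₄, zpow_one]
      field_simp
      ring

/-- Keep d and deform the weights xₙ = σⁿ(w₁ + w₂) of u to xₙ + ε P(n − 1). The first relation
becomes the recurrence for P. In the second, the terms group into xₙ times that recurrence at n − 1
plus P(n − 1) times the homogeneous recurrence of the weights. -/
theorem exists_linear_deformation (h : MulIndep r₁ r₂) (e : MvPolynomial (Fin 2) K) :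
    ∃ p : Module.End K (ℤ → MvPolynomial (Fin 2) K),
      linDDU (r₁ + r₂) (-(r₁ * r₂)) (rep h (u r₁ r₂)) (rep h (d r₁ r₂)) p 0 =
        rep h (poly h e * d r₁ r₂) ∧
      linDUU (r₁ + r₂) (-(r₁ * r₂)) (rep h (u r₁ r₂)) (rep h (d r₁ r₂)) p 0 =
        rep h (u r₁ r₂ * poly h e) := by
  obtain ⟨P, hP⟩ := exists_recurrence_solution h e
  refine ⟨weightedShift K (fun n => P (n + -1)) (-1), ?_, ?_⟩
  · refine LinearMap.ext fun f => funext fun n => ?_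
    rw [map_mul, rep_u, rep_d, rep_poly]
    simp only [linDDU, LinearMap.sub_apply, LinearMap.smul_apply, Module.End.mul_apply, mul_zero,
      zero_mul, Pi.sub_apply, Pi.smul_apply, weightedShift_apply, Pi.one_apply, one_mul,
      add_assoc, Int.reduceAdd, Int.reduceNeg, zero_add, add_zero]
    rw [← hP, sub_eq_add_neg n, add_mul, sub_mul, smul_mul_assoc, smul_mul_assoc]
    module
  · refine LinearMap.ext fun f => funext fun n => ?_
    have e' := scalePow_recurrence h (n + -1)
    rw [map_mul, rep_u, rep_d, rep_poly]
    simp only [linDUU, LinearMap.sub_apply, LinearMap.smul_apply, Module.End.mul_apply, mul_zero,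
      zero_mul, LinearMap.add_apply, Pi.add_apply, Pi.sub_apply, Pi.smul_apply,
      weightedShift_apply, Pi.one_apply, one_mul, add_assoc, Int.reduceAdd, Int.reduceNeg, zero_add,
      add_zero] at e' ⊢
    rw [← hP, e']
    simp only [sub_eq_add_neg (n + -1), add_assoc, Int.reduceAdd, add_zero,
      Int.reduceNeg, Algebra.smul_def, map_add, map_mul, map_neg]
    ring

end Solve

section Existence

theorem exists_cocycle (h : MulIndep r₁ r₂) (e : MvPolynomial (Fin 2) K) :
    ∃ f ∈ hochschildCocycles₂ K (RootDownUp r₁ r₂), ∃ x y : RootDownUp r₁ r₂,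
      obstrDDU (r₁ + r₂) (-(r₁ * r₂)) (u r₁ r₂) (d r₁ r₂) f =
        poly h e * d r₁ r₂ + linDDU (r₁ + r₂) (-(r₁ * r₂)) (u r₁ r₂) (d r₁ r₂) x y ∧
      obstrDUU (r₁ + r₂) (-(r₁ * r₂)) (u r₁ r₂) (d r₁ r₂) f =
        u r₁ r₂ * poly h e + linDUU (r₁ + r₂) (-(r₁ * r₂)) (u r₁ r₂) (d r₁ r₂) x y := by
  obtain ⟨p, hp₁, hp₂⟩ := exists_linear_deformation h e
  exact exists_cocycle_of_rep (rep h) (rep_injective h) p 0 _ _ hp₁ hp₂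

end Existence

end RootDownUp

/-! ### Diagonal operators on monomials -/

section Diagonal

variable {K : Type*} [Field K]

theorem coeff_scalePow (r₁ r₂ : K) (n : ℤ) (m : Fin 2 →₀ ℕ) (p : MvPolynomial (Fin 2) K) :
    MvPolynomial.coeff m (scalePow r₁ r₂ n p) =
      (r₁ ^ m 0 * r₂ ^ m 1) ^ n * MvPolynomial.coeff m p := by
  rw [coeff_scale, mul_zpow, ← zpow_natCast, ← zpow_natCast, ← zpow_natCast, ← zpow_natCast,
    zpow_comm r₁, zpow_comm r₂]

/-- The diagonal operator on polynomials with the given eigenvalues on monomials. -/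
noncomputable def diagonalMap (c : (Fin 2 →₀ ℕ) → K) :
    MvPolynomial (Fin 2) K →ₗ[K] MvPolynomial (Fin 2) K :=
  (MvPolynomial.basisMonomials (Fin 2) K).constr K fun m => MvPolynomial.monomial m (c m)

theorem diagonalMap_monomial (c : (Fin 2 →₀ ℕ) → K) (m : Fin 2 →₀ ℕ) (a : K) :
    diagonalMap c (MvPolynomial.monomial m a) = MvPolynomial.monomial m (c m * a) := by
  have h := (MvPolynomial.basisMonomials (Fin 2) K).constr_basis K
    (fun m => MvPolynomial.monomial m (c m)) m
  rw [MvPolynomial.coe_basisMonomials] at h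
  have e : MvPolynomial.monomial m a = a • MvPolynomial.monomial m (1 : K) := by
    rw [MvPolynomial.smul_monomial, smul_eq_mul, mul_one]
  rw [e, map_smul, diagonalMap, h, MvPolynomial.smul_monomial, smul_eq_mul, mul_comm]

theorem coeff_diagonalMap (c : (Fin 2 →₀ ℕ) → K) (m : Fin 2 →₀ ℕ) (p : MvPolynomial (Fin 2) K) :
    MvPolynomial.coeff m (diagonalMap c p) = c m * MvPolynomial.coeff m p := by
  induction p using MvPolynomial.induction_on' with
  | monomial n a =>
    rw [diagonalMap_monomial, MvPolynomial.coeff_monomial, MvPolynomial.coeff_monomial]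
    split_ifs with h
    · rw [h]
    · simp
  | add p q hp hq => rw [map_add, MvPolynomial.coeff_add, MvPolynomial.coeff_add, hp, hq, mul_add]

/-- The exponent `(i, j)`. -/
noncomputable def expo (i j : ℕ) : Fin 2 →₀ ℕ := Finsupp.single 0 i + Finsupp.single 1 j

@[simp]
theorem expo_zero (i j : ℕ) : expo i j 0 = i := by simp [expo]

@[simp]
theorem expo_one (i j : ℕ) : expo i j 1 = j := by simp [expo]

theorem eq_expo (m : Fin 2 →₀ ℕ) : m = expo (m 0) (m 1) := by
  ext i
  fin_cases i <;> simp

theorem eq_expo_iff (m : Fin 2 →₀ ℕ) (i j : ℕ) : m = expo i j ↔ m 0 = i ∧ m 1 = j := by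
  constructor
  · rintro rfl
    simp
  · rintro ⟨rfl, rfl⟩
    exact eq_expo m

theorem coeff_X_pow_mul_X_pow (i j : ℕ) (m : Fin 2 →₀ ℕ) :
    MvPolynomial.coeff m (MvPolynomial.X 0 ^ i * MvPolynomial.X 1 ^ j : MvPolynomial (Fin 2) K) =
      if m 0 = i ∧ m 1 = j then 1 else 0 := by
  have h := monomial_eq_smul (K := K) (expo i j) 1
  rw [expo_zero, expo_one, one_smul] at h
  rw [← h, MvPolynomial.coeff_monomial]
  simp only [eq_comm (a := expo i j), eq_expo_iff]

theorem coeff_X_zero' (m : Fin 2 →₀ ℕ) :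
    MvPolynomial.coeff m (MvPolynomial.X 0 : MvPolynomial (Fin 2) K) =
      if m 0 = 1 ∧ m 1 = 0 then 1 else 0 := by
  simpa using coeff_X_pow_mul_X_pow (K := K) 1 0 m

theorem coeff_X_one' (m : Fin 2 →₀ ℕ) :
    MvPolynomial.coeff m (MvPolynomial.X 1 : MvPolynomial (Fin 2) K) =
      if m 0 = 0 ∧ m 1 = 1 then 1 else 0 := by
  simpa using coeff_X_pow_mul_X_pow (K := K) 0 1 m

theorem coeff_X_mul_X' (m : Fin 2 →₀ ℕ) :
    MvPolynomial.coeff m (MvPolynomial.X 0 * MvPolynomial.X 1 : MvPolynomial (Fin 2) K) =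
      if m 0 = 1 ∧ m 1 = 1 then 1 else 0 := by
  simpa using coeff_X_pow_mul_X_pow (K := K) 1 1 m

variable {r₁ r₂ : K}

/-- The operator is (σ − r₁)(σ − r₂), diagonal on monomials; by independence its eigenvalue vanishes
on w₁ and w₂ only. -/
theorem exists_characteristic_preimage (h : MulIndep r₁ r₂) (p : MvPolynomial (Fin 2) K) :
    ∃ c, scalePow r₁ r₂ 1 (scalePow r₁ r₂ 1 c) - (r₁ + r₂) • scalePow r₁ r₂ 1 c + (r₁ * r₂) • c =
      p - MvPolynomial.coeff (expo 1 0) p • MvPolynomial.X 0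
        - MvPolynomial.coeff (expo 0 1) p • MvPolynomial.X 1 := by
  -- On w₁ and w₂ the inverse is 0⁻¹ = 0, so these two monomials are left out of the preimage.
  refine ⟨diagonalMap (fun m =>
    ((r₁ ^ m 0 * r₂ ^ m 1 - r₁) * (r₁ ^ m 0 * r₂ ^ m 1 - r₂))⁻¹) p, ?_⟩
  ext m
  simp only [MvPolynomial.coeff_add, MvPolynomial.coeff_sub, MvPolynomial.coeff_smul,
    coeff_scalePow, coeff_diagonalMap, coeff_X_zero', coeff_X_one', smul_eq_mul, zpow_one]
  by_cases h₁ : m 0 = 1 ∧ m 1 = 0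
  · obtain rfl := (eq_expo_iff _ _ _).2 h₁
    simp
  by_cases h₂ : m 0 = 0 ∧ m 1 = 1
  · obtain rfl := (eq_expo_iff _ _ _).2 h₂
    simp
  have h₃ : r₁ ^ m 0 * r₂ ^ m 1 - r₁ ≠ 0 := fun e => h₁
    (h.pow_mul_pow_eq (k := 1) (l := 0) (by simpa using sub_eq_zero.1 e))
  have h₄ : r₁ ^ m 0 * r₂ ^ m 1 - r₂ ≠ 0 := fun e => h₂
    (h.pow_mul_pow_eq (k := 0) (l := 1) (by simpa using sub_eq_zero.1 e))
  rw [if_neg h₁, if_neg h₂]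
  field_simp
  ring

theorem eq_smul_X_mul_X (h : MulIndep r₁ r₂) {p : MvPolynomial (Fin 2) K}
    (e : scalePow r₁ r₂ 1 p = (r₁ * r₂) • p) :
    p = MvPolynomial.coeff (expo 1 1) p • (MvPolynomial.X 0 * MvPolynomial.X 1) := by
  ext m
  have e' := congrArg (MvPolynomial.coeff m) e
  simp only [coeff_scalePow, MvPolynomial.coeff_smul, coeff_X_mul_X', smul_eq_mul, zpow_one] at e' ⊢
  by_cases h₁ : m 0 = 1 ∧ m 1 = 1
  · obtain rfl := (eq_expo_iff _ _ _).2 h₁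
    simp
  · rw [if_neg h₁, mul_zero]
    by_contra hne
    exact h₁ (h.pow_mul_pow_eq (k := 1) (l := 1) (by simpa using mul_right_cancel₀ hne e'))

end Diagonal

/-! ### Linearized relations and the syzygy in negative weight -/

namespace RootDownUp

open DownUpAlgebra

variable {K : Type*} [Field K] {r₁ r₂ : K}

section Formulas

theorem d_mul_poly_mul (h : MulIndep r₁ r₂) (p : MvPolynomial (Fin 2) K) (x : RootDownUp r₁ r₂) :
    d r₁ r₂ * (poly h p * x) = poly h (scalePow r₁ r₂ 1 p) * (d r₁ r₂ * x) := by
  rw [← mul_assoc, d_mul_poly, mul_assoc]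

theorem u_mul_poly_mul_d_mul (h : MulIndep r₁ r₂) (p : MvPolynomial (Fin 2) K)
    (x : RootDownUp r₁ r₂) :
    u r₁ r₂ * (poly h p * (d r₁ r₂ * x)) =
      poly h ((MvPolynomial.X 0 + MvPolynomial.X 1) * scalePow r₁ r₂ (-1) p) * x := by
  rw [← mul_assoc, ← mul_assoc, u_mul_poly_mul_d]

theorem u_mul_d_mul (h : MulIndep r₁ r₂) (x : RootDownUp r₁ r₂) :
    u r₁ r₂ * (d r₁ r₂ * x) = poly h (MvPolynomial.X 0 + MvPolynomial.X 1) * x := by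
  rw [← mul_assoc, u_mul_d h]

theorem d_mul_u_mul (h : MulIndep r₁ r₂) (x : RootDownUp r₁ r₂) :
    d r₁ r₂ * (u r₁ r₂ * x) =
      poly h (scalePow r₁ r₂ 1 (MvPolynomial.X 0 + MvPolynomial.X 1)) * x := by
  rw [← mul_assoc, d_mul_u h, scalePow_X_add_X, zpow_one, zpow_one]

theorem linDDU_poly_mul_d_pow (h : MulIndep r₁ r₂) (k : ℕ) (c : MvPolynomial (Fin 2) K) :
    linDDU (r₁ + r₂) (-(r₁ * r₂)) (u r₁ r₂) (d r₁ r₂) (poly h c * d r₁ r₂ ^ k) 0 =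
      poly h (scalePow r₁ r₂ 1 (scalePow r₁ r₂ 1 c) - (r₁ + r₂) • scalePow r₁ r₂ 1 c
        + (r₁ * r₂) • c) * d r₁ r₂ ^ (k + 2) := by
  simp only [linDDU, mul_assoc, d_mul_poly_mul, ← pow_succ', ← pow_succ, map_add, map_sub, map_smul,
    add_mul, sub_mul, smul_mul_assoc, zero_mul, mul_zero, add_zero, zero_add]
  module

theorem linDUU_poly_mul_d_pow (h : MulIndep r₁ r₂) (k : ℕ) (c : MvPolynomial (Fin 2) K) :
    linDUU (r₁ + r₂) (-(r₁ * r₂)) (u r₁ r₂) (d r₁ r₂) (poly h c * d r₁ r₂ ^ k) 0 =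
      poly h (scalePow r₁ r₂ 1 c * scalePow r₁ r₂ (k + 1) (MvPolynomial.X 0 + MvPolynomial.X 1)
        + scalePow r₁ r₂ 1 (MvPolynomial.X 0 + MvPolynomial.X 1) * c
        - (r₁ + r₂) • (c * scalePow r₁ r₂ (k + 1) (MvPolynomial.X 0 + MvPolynomial.X 1)
          + (MvPolynomial.X 0 + MvPolynomial.X 1) * c)
        + (r₁ * r₂) • (c * scalePow r₁ r₂ k (MvPolynomial.X 0 + MvPolynomial.X 1)
          + (MvPolynomial.X 0 + MvPolynomial.X 1) * scalePow r₁ r₂ (-1) c)) * d r₁ r₂ ^ k := by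
  have e₁ : d r₁ r₂ * (poly h c * d r₁ r₂ ^ k) * u r₁ r₂ =
      poly h (scalePow r₁ r₂ 1 c * scalePow r₁ r₂ (k + 1) (MvPolynomial.X 0 + MvPolynomial.X 1)) *
        d r₁ r₂ ^ k := by
    rw [d_mul_poly_mul, ← pow_succ', mul_assoc, d_pow_succ_mul_u h, ← mul_assoc, ← map_mul]
  have e₂ : d r₁ r₂ * u r₁ r₂ * (poly h c * d r₁ r₂ ^ k) =
      poly h (scalePow r₁ r₂ 1 (MvPolynomial.X 0 + MvPolynomial.X 1) * c) * d r₁ r₂ ^ k := by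
    rw [mul_assoc, d_mul_u_mul h, ← mul_assoc, ← map_mul]
  have e₃ : poly h c * d r₁ r₂ ^ k * d r₁ r₂ * u r₁ r₂ =
      poly h (c * scalePow r₁ r₂ (k + 1) (MvPolynomial.X 0 + MvPolynomial.X 1)) *
        d r₁ r₂ ^ k := by
    rw [mul_assoc _ (d r₁ r₂ ^ k), ← pow_succ, mul_assoc, d_pow_succ_mul_u h, ← mul_assoc,
      ← map_mul]
  have e₄ : u r₁ r₂ * d r₁ r₂ * (poly h c * d r₁ r₂ ^ k) =
      poly h ((MvPolynomial.X 0 + MvPolynomial.X 1) * c) * d r₁ r₂ ^ k := by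
    rw [mul_assoc, u_mul_d_mul h, ← mul_assoc, ← map_mul]
  have e₅ : poly h c * d r₁ r₂ ^ k * u r₁ r₂ * d r₁ r₂ =
      poly h (c * scalePow r₁ r₂ k (MvPolynomial.X 0 + MvPolynomial.X 1)) * d r₁ r₂ ^ k := by
    rw [mul_assoc, u_mul_d h, mul_assoc, d_pow_mul_poly, ← mul_assoc, ← map_mul]
  have e₆ : u r₁ r₂ * (poly h c * d r₁ r₂ ^ k) * d r₁ r₂ =
      poly h ((MvPolynomial.X 0 + MvPolynomial.X 1) * scalePow r₁ r₂ (-1) c) * d r₁ r₂ ^ k := by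
    rw [mul_assoc, mul_assoc, ← pow_succ, pow_succ', u_mul_poly_mul_d_mul]
  simp only [linDUU, zero_mul, mul_zero, add_zero, zero_add, e₁, e₂, e₃, e₄, e₅, e₆,
    map_add (poly h), map_sub (poly h), map_smul (poly h), add_mul, sub_mul, smul_mul_assoc]
  module

/-- The directions (c dᵏ, 0) never produce w₁ or w₂ in the first relation. This direction supplies
one line in their span. -/
theorem linDDU_d_pow (h : MulIndep r₁ r₂) (k : ℕ) :
    linDDU (r₁ + r₂) (-(r₁ * r₂)) (u r₁ r₂) (d r₁ r₂) 0 (d r₁ r₂ ^ (k + 2)) =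
      poly h (((r₁ - r₂) * r₁ * (r₁ ^ (k + 1) - 1)) • MvPolynomial.X 0
        + ((r₂ - r₁) * r₂ * (r₂ ^ (k + 1) - 1)) • MvPolynomial.X 1) * d r₁ r₂ ^ (k + 2) := by
  have e₁ : d r₁ r₂ ^ (k + 2) * d r₁ r₂ * u r₁ r₂ =
      poly h (scalePow r₁ r₂ (k + 3 : ℕ) (MvPolynomial.X 0 + MvPolynomial.X 1)) *
        d r₁ r₂ ^ (k + 2) := by
    rw [← pow_succ, d_pow_succ_mul_u h]
    push_cast
    rfl
  have e₂ : d r₁ r₂ * d r₁ r₂ ^ (k + 2) * u r₁ r₂ =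
      poly h (scalePow r₁ r₂ (k + 3 : ℕ) (MvPolynomial.X 0 + MvPolynomial.X 1)) *
        d r₁ r₂ ^ (k + 2) := by
    rw [← pow_succ', pow_succ, e₁]
  have e₃ : d r₁ r₂ ^ (k + 2) * u r₁ r₂ * d r₁ r₂ =
      poly h (scalePow r₁ r₂ (k + 2 : ℕ) (MvPolynomial.X 0 + MvPolynomial.X 1)) *
        d r₁ r₂ ^ (k + 2) := by
    rw [d_pow_succ_mul_u h, mul_assoc, ← pow_succ]
    push_cast
    rfl
  have e₄ : d r₁ r₂ * u r₁ r₂ * d r₁ r₂ ^ (k + 2) =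
      poly h (scalePow r₁ r₂ 1 (MvPolynomial.X 0 + MvPolynomial.X 1)) * d r₁ r₂ ^ (k + 2) := by
    rw [mul_assoc, d_mul_u_mul h]
  have e₅ : u r₁ r₂ * d r₁ r₂ ^ (k + 2) * d r₁ r₂ =
      poly h (MvPolynomial.X 0 + MvPolynomial.X 1) * d r₁ r₂ ^ (k + 2) := by
    rw [mul_assoc, ← pow_succ, pow_succ', u_mul_d_mul h]
  have e₆ : u r₁ r₂ * d r₁ r₂ * d r₁ r₂ ^ (k + 2) =
      poly h (MvPolynomial.X 0 + MvPolynomial.X 1) * d r₁ r₂ ^ (k + 2) := by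
    rw [mul_assoc, u_mul_d_mul h]
  simp only [linDDU, zero_mul, mul_zero, add_zero, zero_add, e₁, e₂, e₃, e₄, e₅, e₆]
  simp only [← add_mul, ← sub_mul, ← smul_mul_assoc, ← map_add (poly h), ← map_sub (poly h),
    ← map_smul (poly h)]
  congr 2
  simp only [scalePow_X_add_X, zpow_natCast, zpow_one]
  module

/-- Only the shape of this value matters: the second entry is controlled afterwards by the syzygy.
-/
theorem exists_linDUU_d_pow (h : MulIndep r₁ r₂) (k : ℕ) :
    ∃ g, linDUU (r₁ + r₂) (-(r₁ * r₂)) (u r₁ r₂) (d r₁ r₂) 0 (d r₁ r₂ ^ (k + 2)) =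
      poly h g * d r₁ r₂ ^ k := by
  have e₁ : ∃ g, d r₁ r₂ ^ (k + 2) * u r₁ r₂ * u r₁ r₂ = poly h g * d r₁ r₂ ^ k :=
    ⟨_, by rw [d_pow_succ_mul_u h, mul_assoc, d_pow_succ_mul_u h, ← mul_assoc, ← map_mul]⟩
  have e₂ : ∃ g, u r₁ r₂ * d r₁ r₂ ^ (k + 2) * u r₁ r₂ = poly h g * d r₁ r₂ ^ k :=
    ⟨_, by rw [pow_succ', u_mul_d_mul h, mul_assoc, d_pow_succ_mul_u h, ← mul_assoc, ← map_mul]⟩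
  have e₃ : ∃ g, u r₁ r₂ * u r₁ r₂ * d r₁ r₂ ^ (k + 2) = poly h g * d r₁ r₂ ^ k :=
    ⟨_, by rw [mul_assoc, pow_succ', u_mul_d_mul h, pow_succ', u_mul_poly_mul_d_mul]⟩
  obtain ⟨g₁, e₁⟩ := e₁
  obtain ⟨g₂, e₂⟩ := e₂
  obtain ⟨g₃, e₃⟩ := e₃
  refine ⟨g₁ - (r₁ + r₂) • g₂ - (-(r₁ * r₂)) • g₃, ?_⟩
  simp only [linDUU, zero_mul, mul_zero, add_zero, zero_add, e₁, e₂, e₃, map_sub, map_smul,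
    sub_mul, smul_mul_assoc]

theorem syzygyMap_poly_mul_d_pow (h : MulIndep r₁ r₂) (k : ℕ) (r g : MvPolynomial (Fin 2) K) :
    syzygyMap (-(r₁ * r₂)) (u r₁ r₂) (d r₁ r₂) (poly h r * d r₁ r₂ ^ (k + 2))
      (poly h g * d r₁ r₂ ^ k) =
      poly h (r * scalePow r₁ r₂ (k + 2 : ℕ) (MvPolynomial.X 0 + MvPolynomial.X 1)
        - (r₁ * r₂) • ((MvPolynomial.X 0 + MvPolynomial.X 1) * scalePow r₁ r₂ (-1) r)
        - scalePow r₁ r₂ 1 g + (r₁ * r₂) • g) * d r₁ r₂ ^ (k + 1) := by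
  have e₁ : poly h r * d r₁ r₂ ^ (k + 2) * u r₁ r₂ =
      poly h (r * scalePow r₁ r₂ (k + 2 : ℕ) (MvPolynomial.X 0 + MvPolynomial.X 1)) *
        d r₁ r₂ ^ (k + 1) := by
    rw [mul_assoc, d_pow_succ_mul_u h, ← mul_assoc, ← map_mul]
    push_cast
    rfl
  have e₂ : u r₁ r₂ * (poly h r * d r₁ r₂ ^ (k + 2)) =
      poly h ((MvPolynomial.X 0 + MvPolynomial.X 1) * scalePow r₁ r₂ (-1) r) *
        d r₁ r₂ ^ (k + 1) := by
    rw [pow_succ', u_mul_poly_mul_d_mul]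
  have e₃ : d r₁ r₂ * (poly h g * d r₁ r₂ ^ k) =
      poly h (scalePow r₁ r₂ 1 g) * d r₁ r₂ ^ (k + 1) := by
    rw [d_mul_poly_mul, ← pow_succ']
  have e₄ : poly h g * d r₁ r₂ ^ k * d r₁ r₂ = poly h g * d r₁ r₂ ^ (k + 1) := by
    rw [mul_assoc, ← pow_succ]
  simp only [syzygyMap, e₁, e₂, e₃, e₄, map_add (poly h), map_sub (poly h), map_smul (poly h),
    add_mul, sub_mul, smul_mul_assoc]
  module

end Formulas

end RootDownUp

/-! ### Normal forms in the kernel of the syzygy map -/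

namespace RootDownUp

open DownUpAlgebra

variable {K : Type*} [Field K] {r₁ r₂ : K}

/-- A pair of values of the relations that is equal to `(e d, u e)` for a polynomial `e`, up to
the linearized relations. -/
def IsNormal (h : MulIndep r₁ r₂) (a b : RootDownUp r₁ r₂) : Prop :=
  ∃ (e : MvPolynomial (Fin 2) K) (p q : RootDownUp r₁ r₂),
    a = poly h e * d r₁ r₂ + linDDU (r₁ + r₂) (-(r₁ * r₂)) (u r₁ r₂) (d r₁ r₂) p q ∧
    b = u r₁ r₂ * poly h e + linDUU (r₁ + r₂) (-(r₁ * r₂)) (u r₁ r₂) (d r₁ r₂) p q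

theorem IsNormal.zero (h : MulIndep r₁ r₂) : IsNormal h 0 0 :=
  ⟨0, 0, 0, by simp [linDDU], by simp [linDUU]⟩

theorem IsNormal.add {h : MulIndep r₁ r₂} {a b a' b' : RootDownUp r₁ r₂} (H : IsNormal h a b)
    (H' : IsNormal h a' b') : IsNormal h (a + a') (b + b') := by
  obtain ⟨e, p, q, rfl, rfl⟩ := H
  obtain ⟨e', p', q', rfl, rfl⟩ := H'
  refine ⟨e + e', p + p', q + q', ?_, ?_⟩
  · rw [linDDU_add, map_add, add_mul]; abel
  · rw [linDUU_add, map_add, mul_add]; abel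

theorem isNormal_lin (h : MulIndep r₁ r₂) (p q : RootDownUp r₁ r₂) :
    IsNormal h (linDDU (r₁ + r₂) (-(r₁ * r₂)) (u r₁ r₂) (d r₁ r₂) p q)
      (linDUU (r₁ + r₂) (-(r₁ * r₂)) (u r₁ r₂) (d r₁ r₂) p q) :=
  ⟨0, p, q, by simp, by simp⟩

theorem IsNormal.of_sub_lin {h : MulIndep r₁ r₂} {a b : RootDownUp r₁ r₂} (p q : RootDownUp r₁ r₂)
    (H : IsNormal h (a - linDDU (r₁ + r₂) (-(r₁ * r₂)) (u r₁ r₂) (d r₁ r₂) p q)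
      (b - linDUU (r₁ + r₂) (-(r₁ * r₂)) (u r₁ r₂) (d r₁ r₂) p q)) : IsNormal h a b := by
  simpa using H.add (isNormal_lin h p q)

theorem IsNormal.sum {h : MulIndep r₁ r₂} {ι : Type*} (s : Finset ι) {a b : ι → RootDownUp r₁ r₂}
    (H : ∀ i, IsNormal h (a i) (b i)) : IsNormal h (∑ i ∈ s, a i) (∑ i ∈ s, b i) := by
  classical
  induction s using Finset.induction_on with
  | empty => simpa using IsNormal.zero h
  | insert i s hi ih => rw [Finset.sum_insert hi, Finset.sum_insert hi]; exact (H i).add ih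

theorem syzygyMap_sub (β : K) {A : Type*} [Ring A] [Algebra K A] (u d a b a' b' : A) :
    syzygyMap β u d (a - a') (b - b') = syzygyMap β u d a b - syzygyMap β u d a' b' := by
  simp only [syzygyMap, sub_mul, mul_sub]
  module

theorem syzygyMap_sub_lin {a b : RootDownUp r₁ r₂} (p q : RootDownUp r₁ r₂)
    (H : syzygyMap (-(r₁ * r₂)) (u r₁ r₂) (d r₁ r₂) a b = 0) :
    syzygyMap (-(r₁ * r₂)) (u r₁ r₂) (d r₁ r₂)
      (a - linDDU (r₁ + r₂) (-(r₁ * r₂)) (u r₁ r₂) (d r₁ r₂) p q)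
      (b - linDUU (r₁ + r₂) (-(r₁ * r₂)) (u r₁ r₂) (d r₁ r₂) p q) = 0 := by
  rw [syzygyMap_sub, H, syzygyMap_lin (relDDU_gen _ _) (relDUU_gen _ _), sub_zero]

/-- The direction (w₁ dᵏ, 0) leaves the first relation unchanged, as (σ − r₁)(σ − r₂) kills w₁, and
so can remove the last remainder w₁w₂ from the second. -/
theorem linDUU_X_zero_mul_d_pow (h : MulIndep r₁ r₂) (k : ℕ) :
    linDUU (r₁ + r₂) (-(r₁ * r₂)) (u r₁ r₂) (d r₁ r₂) (poly h (MvPolynomial.X 0) * d r₁ r₂ ^ k) 0 =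
      ((r₂ - r₁) * (1 - r₂ ^ (k + 1))) •
        (poly h (MvPolynomial.X 0 * MvPolynomial.X 1) * d r₁ r₂ ^ k) := by
  rw [linDUU_poly_mul_d_pow, ← smul_mul_assoc, ← map_smul]
  congr 2
  have e₁ : r₁ ^ (-1 : ℤ) * r₁ = 1 := by simp [h.ne_zero₁]
  simp only [scalePow_X_add_X, scale_X_zero, zpow_add₀ h.ne_zero₁, zpow_add₀ h.ne_zero₂,
    zpow_natCast, zpow_one, MvPolynomial.smul_eq_C_mul, MvPolynomial.C_mul, MvPolynomial.C_sub,
    MvPolynomial.C_add, MvPolynomial.C_pow, MvPolynomial.C_1, zpow_neg]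
  have e₂ : (MvPolynomial.C r₁ * MvPolynomial.C r₁⁻¹ : MvPolynomial (Fin 2) K) = 1 := by
    rw [← MvPolynomial.C_mul, mul_inv_cancel₀ h.ne_zero₁, MvPolynomial.C_1]
  linear_combination (MvPolynomial.C r₂ * MvPolynomial.X 0 *
    (MvPolynomial.X 0 + MvPolynomial.X 1)) * e₂

/-- The polynomial e is 0 here: three directions exhaust the pair. A direction (c dᵏ, 0) reduces r
to a w₁ + b w₂. The syzygy makes this proportional to the value of the direction (0, dᵏ⁺²), which
removes it. The syzygy then says σ(g) = r₁r₂ g, so g is a multiple of w₁w₂, and (w₁ dᵏ, 0) removes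
that. -/
theorem isNormal_of_poly_mul_d_pow (h : MulIndep r₁ r₂) (k : ℕ) (r g : MvPolynomial (Fin 2) K)
    (H : syzygyMap (-(r₁ * r₂)) (u r₁ r₂) (d r₁ r₂) (poly h r * d r₁ r₂ ^ (k + 2))
      (poly h g * d r₁ r₂ ^ k) = 0) :
    IsNormal h (poly h r * d r₁ r₂ ^ (k + 2)) (poly h g * d r₁ r₂ ^ k) := by
  obtain ⟨c, hc⟩ := exists_characteristic_preimage h r
  have hlin := linDDU_poly_mul_d_pow h k c
  have hlin' := linDUU_poly_mul_d_pow h k c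
  rw [hc] at hlin
  generalize (scalePow r₁ r₂ 1) c * _ + _ - _ + _ = g₀ at hlin'
  generalize MvPolynomial.coeff (expo 1 0) r = a at hlin hc
  generalize MvPolynomial.coeff (expo 0 1) r = b at hlin hc
  have H₁ := syzygyMap_sub_lin (poly h c * d r₁ r₂ ^ k) 0 H
  refine IsNormal.of_sub_lin (poly h c * d r₁ r₂ ^ k) 0 ?_
  rw [hlin, hlin', ← sub_mul, ← sub_mul, ← map_sub, ← map_sub, sub_sub r, sub_sub_cancel] at H₁ ⊢
  clear hlin hlin' hc H
  generalize g - g₀ = g₁ at H₁ ⊢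
  clear g₀ c r g
  -- Compare coefficients of w₁w₂: the contribution −σ(g₁) + r₁r₂ g₁ vanishes there because σ has
  -- eigenvalue r₁r₂ on w₁w₂.
  have hab : a * (r₂ * (r₂ ^ (k + 1) - 1)) + b * (r₁ * (r₁ ^ (k + 1) - 1)) = 0 := by
    rw [syzygyMap_poly_mul_d_pow] at H₁
    have H₂ : _ = (0 : MvPolynomial (Fin 2) K) :=
      poly_mul_d_pow_injective h (k + 1) (H₁.trans (by simp))
    have e := congrArg (MvPolynomial.coeff (expo 1 1)) H₂
    have e' : (a • MvPolynomial.X 0 + b • MvPolynomial.X 1) *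
          scalePow r₁ r₂ (k + 2 : ℕ) (MvPolynomial.X 0 + MvPolynomial.X 1)
        - (r₁ * r₂) • ((MvPolynomial.X 0 + MvPolynomial.X 1) *
          scalePow r₁ r₂ (-1) (a • MvPolynomial.X 0 + b • MvPolynomial.X 1)) =
        (a * r₁ ^ (k + 2) - a * r₂) • (MvPolynomial.X 0 ^ 2 * MvPolynomial.X 1 ^ 0) +
        (a * (r₂ * (r₂ ^ (k + 1) - 1)) + b * (r₁ * (r₁ ^ (k + 1) - 1))) •
          (MvPolynomial.X 0 ^ 1 * MvPolynomial.X 1 ^ 1) +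
        (b * r₂ ^ (k + 2) - b * r₁) • (MvPolynomial.X 0 ^ 0 * MvPolynomial.X 1 ^ 2) := by
      have e₁ : (MvPolynomial.C r₁ * MvPolynomial.C r₁⁻¹ : MvPolynomial (Fin 2) K) = 1 := by
        rw [← MvPolynomial.C_mul, mul_inv_cancel₀ h.ne_zero₁, MvPolynomial.C_1]
      have e₂ : (MvPolynomial.C r₂ * MvPolynomial.C r₂⁻¹ : MvPolynomial (Fin 2) K) = 1 := by
        rw [← MvPolynomial.C_mul, mul_inv_cancel₀ h.ne_zero₂, MvPolynomial.C_1]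
      simp only [map_add, map_smul, scale_X_zero, scale_X_one, zpow_natCast, zpow_neg, zpow_one]
      simp only [MvPolynomial.smul_eq_C_mul, MvPolynomial.C_mul, MvPolynomial.C_sub,
        MvPolynomial.C_add, MvPolynomial.C_pow, MvPolynomial.C_1]
      linear_combination (-(MvPolynomial.X 0 + MvPolynomial.X 1) * MvPolynomial.C a *
        MvPolynomial.C r₂ * MvPolynomial.X 0) * e₁ - ((MvPolynomial.X 0 + MvPolynomial.X 1) *
        MvPolynomial.C b * MvPolynomial.C r₁ * MvPolynomial.X 1) * e₂
    rw [e', sub_eq_add_neg] at e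
    simp only [MvPolynomial.coeff_add, MvPolynomial.coeff_neg, MvPolynomial.coeff_smul,
      coeff_X_pow_mul_X_pow, coeff_scalePow, smul_eq_mul, expo_zero, expo_one,
      MvPolynomial.coeff_zero] at e
    norm_num at e
    linear_combination e
  obtain ⟨g₂, hg₂⟩ := exists_linDUU_d_pow h k
  have hd := linDDU_d_pow h k
  have hr₁ : r₁ ^ (k + 1) - 1 ≠ 0 := sub_ne_zero.2 (h.pow_ne_one₁ k)
  have hr₂ : r₂ ^ (k + 1) - 1 ≠ 0 := sub_ne_zero.2 (h.pow_ne_one₂ k)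
  have h₁ := h.ne_zero₁
  have h₂ := h.ne_zero₂
  have h₃ := h.sub_ne_zero
  -- The factor that matches the coefficient of w₁; `hab` makes the coefficient of w₂ match too.
  set t : K := a / ((r₁ - r₂) * r₁ * (r₁ ^ (k + 1) - 1)) with ht
  have ha : a = t * ((r₁ - r₂) * r₁ * (r₁ ^ (k + 1) - 1)) := by
    rw [ht, div_mul_cancel₀]
    exact mul_ne_zero (mul_ne_zero h₃ h₁) hr₁
  have hb : b = t * ((r₂ - r₁) * r₂ * (r₂ ^ (k + 1) - 1)) := by
    have : b * (r₁ * (r₁ ^ (k + 1) - 1)) =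
        t * ((r₂ - r₁) * r₂ * (r₂ ^ (k + 1) - 1)) * (r₁ * (r₁ ^ (k + 1) - 1)) := by
      rw [ha] at hab
      linear_combination hab
    exact mul_right_cancel₀ (mul_ne_zero h₁ hr₁) this
  have H₂ := syzygyMap_sub_lin (t • 0) (t • d r₁ r₂ ^ (k + 2)) H₁
  refine IsNormal.of_sub_lin (t • 0) (t • d r₁ r₂ ^ (k + 2)) ?_
  rw [linDDU_smul, linDUU_smul, hd, hg₂, ← smul_mul_assoc, ← smul_mul_assoc, ← map_smul,
    ← map_smul, ← sub_mul, ← sub_mul, ← map_sub, ← map_sub, smul_add, smul_smul, smul_smul,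
    ← ha, ← hb, sub_self, map_zero, zero_mul] at H₂ ⊢
  generalize g₁ - t • g₂ = g at H₂ ⊢
  have H₃ : scalePow r₁ r₂ 1 g = (r₁ * r₂) • g := by
    have := syzygyMap_poly_mul_d_pow h k 0 g
    simp only [map_zero, zero_mul, mul_zero, smul_zero, sub_zero, zero_sub, H₂] at this
    have e : (0 : MvPolynomial (Fin 2) K) = _ :=
      poly_mul_d_pow_injective h (k + 1) ((by simp : _ = _).trans this)
    rw [← sub_eq_zero, ← neg_eq_zero, e]
    abel
  rw [eq_smul_X_mul_X h H₃]
  generalize MvPolynomial.coeff (expo 1 1) g = c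
  set s : K := c / ((r₂ - r₁) * (1 - r₂ ^ (k + 1))) with hs
  have hs' : s * ((r₂ - r₁) * (1 - r₂ ^ (k + 1))) = c := by
    rw [hs, div_mul_cancel₀]
    refine mul_ne_zero ?_ ?_
    · rw [← neg_sub]; exact neg_ne_zero.2 h₃
    · rw [← neg_sub]; exact neg_ne_zero.2 hr₂
  refine IsNormal.of_sub_lin (s • (poly h (MvPolynomial.X 0) * d r₁ r₂ ^ k)) (s • 0) ?_
  rw [linDDU_smul, linDUU_smul, linDUU_X_zero_mul_d_pow, linDDU_poly_mul_d_pow, smul_smul, hs',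
    map_smul, smul_mul_assoc, sub_self]
  convert IsNormal.zero h using 1
  rw [zero_sub, neg_eq_zero, smul_eq_zero]
  right
  rw [show scalePow r₁ r₂ 1 (scalePow r₁ r₂ 1 (MvPolynomial.X 0)) - (r₁ + r₂) •
    scalePow r₁ r₂ 1 (MvPolynomial.X 0) + (r₁ * r₂) • MvPolynomial.X 0 =
    (0 : MvPolynomial (Fin 2) K) by
      simp only [scale_X_zero, map_smul, zpow_one]
      module, map_zero, zero_mul]

/-- The syzygy says that z = (w₁ + w₂) σ⁻¹(e − g) has eigenvalue r₁r₂ under σ, so z is a multiple of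
w₁w₂. Being divisible by w₁ + w₂ it vanishes at (1, −1), hence z = 0 and e = g. -/
theorem isNormal_of_weight_zero (h : MulIndep r₁ r₂) (e g : MvPolynomial (Fin 2) K)
    (H : syzygyMap (-(r₁ * r₂)) (u r₁ r₂) (d r₁ r₂) (poly h e * d r₁ r₂) (u r₁ r₂ * poly h g) = 0) :
    IsNormal h (poly h e * d r₁ r₂) (u r₁ r₂ * poly h g) := by
  suffices e = g by
    subst this
    exact ⟨e, 0, 0, by simp [linDDU], by simp [linDUU]⟩
  set z := (MvPolynomial.X 0 + MvPolynomial.X 1) * scalePow r₁ r₂ (-1) (e - g) with hz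
  have hS : scalePow r₁ r₂ 1 z = (r₁ * r₂) • z := by
    have e₁ : poly h e * d r₁ r₂ * u r₁ r₂ =
        poly h (scalePow r₁ r₂ 1 (MvPolynomial.X 0 + MvPolynomial.X 1) * e) := by
      rw [mul_assoc, d_mul_u h, ← map_mul, scalePow_X_add_X, zpow_one, zpow_one, mul_comm e]
    have e₂ : u r₁ r₂ * (poly h e * d r₁ r₂) =
        poly h ((MvPolynomial.X 0 + MvPolynomial.X 1) * scalePow r₁ r₂ (-1) e) := by
      rw [← mul_assoc, u_mul_poly_mul_d]
    have e₃ : d r₁ r₂ * (u r₁ r₂ * poly h g) =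
        poly h (scalePow r₁ r₂ 1 (MvPolynomial.X 0 + MvPolynomial.X 1) * g) := by
      rw [d_mul_u_mul h, ← map_mul]
    have e₄ : u r₁ r₂ * poly h g * d r₁ r₂ =
        poly h ((MvPolynomial.X 0 + MvPolynomial.X 1) * scalePow r₁ r₂ (-1) g) :=
      u_mul_poly_mul_d h g
    rw [syzygyMap, e₁, e₂, e₃, e₄, ← map_smul, ← map_smul, ← map_add, ← map_sub, ← map_sub] at H
    rw [← map_zero (poly h)] at H
    have H' := poly_mul_d_pow_injective h 0 (congrArg (· * d r₁ r₂ ^ 0) H)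
    rw [hz, map_mul (scalePow r₁ r₂ 1), scalePow_scalePow h, add_neg_cancel, scalePow_zero,
      map_sub (scalePow r₁ r₂ (-1))]
    simp only [MvPolynomial.smul_eq_C_mul, MvPolynomial.C_neg] at H' ⊢
    linear_combination H'
  have hzz := eq_smul_X_mul_X h hS
  generalize MvPolynomial.coeff (expo 1 1) z = c at hzz
  have hc : c = 0 := by
    have := congrArg (MvPolynomial.eval ![1, -1]) hzz
    simpa [hz] using this
  rw [hc, zero_smul] at hzz
  rw [hzz] at hz
  have := (mul_eq_zero.1 hz.symm).resolve_left X_add_X_ne_zero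
  rwa [map_eq_zero_iff _ (scalePow_injective h _), sub_eq_zero] at this

/-! ### The anti-automorphism exchanging u and d -/

section Swap

/-- The anti-automorphism of `A` that exchanges `u` and `d`. -/
noncomputable def swap : RootDownUp r₁ r₂ →ₗ[K] RootDownUp r₁ r₂ :=
  (MulOpposite.opLinearEquiv K).symm.toLinearMap ∘ₗ
    (DownUpAlgebra.lift (MulOpposite.op (d r₁ r₂)) (MulOpposite.op (u r₁ r₂))
      (by
        have := congrArg MulOpposite.op (relDUU_gen (r₁ + r₂) (-(r₁ * r₂)))
        simpa [relDDU, relDUU, mul_assoc] using this)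
      (by
        have := congrArg MulOpposite.op (relDDU_gen (r₁ + r₂) (-(r₁ * r₂)))
        simpa [relDDU, relDUU, mul_assoc] using this) :
      RootDownUp r₁ r₂ →ₐ[K] (RootDownUp r₁ r₂)ᵐᵒᵖ).toLinearMap

theorem swap_mul (a b : RootDownUp r₁ r₂) : swap (a * b) = swap b * swap a := by
  simp [swap]

theorem swap_one : swap (1 : RootDownUp r₁ r₂) = 1 := by
  simp [swap]

theorem swap_u : swap (u r₁ r₂) = d r₁ r₂ := by
  simp [swap, u]

theorem swap_d : swap (d r₁ r₂) = u r₁ r₂ := by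
  simp [swap, d]

theorem swap_swap (a : RootDownUp r₁ r₂) : swap (swap a) = a := by
  induction a using word_induction with
  | hadd a b ha hb => rw [map_add, map_add, ha, hb]
  | hsmul k a ha => rw [map_smul, map_smul, ha]
  | hw w =>
    induction w with
    | nil => rw [word_nil, swap_one, swap_one]
    | cons x w ih =>
      rw [word_cons, swap_mul, swap_mul, ih]
      congr 1
      cases x
      · exact (congrArg swap swap_u).trans swap_d
      · exact (congrArg swap swap_d).trans swap_u

theorem swap_mem_weightSpace {n : ℤ} {a : RootDownUp r₁ r₂} (ha : a ∈ weightSpace r₁ r₂ n) :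
    swap a ∈ weightSpace r₁ r₂ (-n) := by
  induction ha using Submodule.span_induction with
  | zero => rw [map_zero]; exact Submodule.zero_mem _
  | add a b _ _ ha hb => rw [map_add]; exact Submodule.add_mem _ ha hb
  | smul k a _ ha => rw [map_smul]; exact Submodule.smul_mem _ _ ha
  | mem a ha =>
    obtain ⟨w, rfl, rfl⟩ := ha
    induction w with
    | nil =>
      rw [word_nil, swap_one]
      simpa using one_mem_grading (r₁ + r₂) (-(r₁ * r₂)) genWeight
    | cons x w ih =>
      rw [word_cons, swap_mul, List.map_cons, List.sum_cons, neg_add_rev]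
      refine mul_mem_grading ih ?_
      cases x
      · exact (swap_u (r₁ := r₁) (r₂ := r₂)).symm ▸ d_mem_weightSpace
      · exact (swap_d (r₁ := r₁) (r₂ := r₂)).symm ▸ u_mem_weightSpace

theorem swap_linDDU (p q : RootDownUp r₁ r₂) :
    swap (linDDU (r₁ + r₂) (-(r₁ * r₂)) (u r₁ r₂) (d r₁ r₂) p q) =
      linDUU (r₁ + r₂) (-(r₁ * r₂)) (u r₁ r₂) (d r₁ r₂) (swap q) (swap p) := by
  simp only [linDDU, linDUU, map_add, map_sub, map_smul, swap_mul, swap_u, swap_d, mul_assoc]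
  module

theorem swap_linDUU (p q : RootDownUp r₁ r₂) :
    swap (linDUU (r₁ + r₂) (-(r₁ * r₂)) (u r₁ r₂) (d r₁ r₂) p q) =
      linDDU (r₁ + r₂) (-(r₁ * r₂)) (u r₁ r₂) (d r₁ r₂) (swap q) (swap p) := by
  simp only [linDDU, linDUU, map_add, map_sub, map_smul, swap_mul, swap_u, swap_d, mul_assoc]
  module

theorem swap_syzygyMap (β : K) (a b : RootDownUp r₁ r₂) :
    swap (syzygyMap β (u r₁ r₂) (d r₁ r₂) a b) =
      - syzygyMap β (u r₁ r₂) (d r₁ r₂) (swap b) (swap a) := by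
  simp only [syzygyMap, map_add, map_sub, map_smul, swap_mul, swap_u, swap_d]
  module

/-- Both ud and du are fixed, and an anti-automorphism respects products in the commutative algebra
K[w₁, w₂]. Hence the normal pair (e d, u e) keeps its shape under the exchange. -/
theorem swap_poly (h : MulIndep r₁ r₂) (e : MvPolynomial (Fin 2) K) :
    swap (poly h e) = poly h e := by
  have h₁ : swap (w₁ r₁ r₂) = w₁ r₁ r₂ := by
    simp only [w₁, map_smul, map_sub, swap_mul, swap_u, swap_d]
  have h₂ : swap (w₂ r₁ r₂) = w₂ r₁ r₂ := by
    simp only [w₂, map_smul, map_sub, swap_mul, swap_u, swap_d]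
  induction e using MvPolynomial.induction_on with
  | C a =>
    rw [← MvPolynomial.algebraMap_eq, AlgHom.commutes, Algebra.algebraMap_eq_smul_one, map_smul,
      swap_one]
  | add p q hp hq => rw [map_add, map_add, hp, hq]
  | mul_X p i hp =>
    have hX : swap (poly h (MvPolynomial.X i)) = poly h (MvPolynomial.X i) := by
      fin_cases i
      · exact (congrArg swap (poly_X_zero h)).trans (h₁.trans (poly_X_zero h).symm)
      · exact (congrArg swap (poly_X_one h)).trans (h₂.trans (poly_X_one h).symm)
    rw [map_mul, swap_mul, hX, hp, ← map_mul, ← map_mul, mul_comm p]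

theorem IsNormal.of_swap {h : MulIndep r₁ r₂} {a b : RootDownUp r₁ r₂}
    (H : IsNormal h (swap b) (swap a)) : IsNormal h a b := by
  obtain ⟨e, p, q, hb, ha⟩ := H
  refine ⟨e, swap q, swap p, ?_, ?_⟩
  · rw [← swap_swap a, ha, map_add, swap_linDUU, swap_mul, swap_poly, swap_u]
  · rw [← swap_swap b, hb, map_add, swap_linDDU, swap_mul, swap_poly, swap_d]

end Swap

/-- The relations have weights −1 and 1, so a pair of weight n has entries of weights n − 1 and n +
1. Positive n reduces to negative n by `swap`. -/
theorem isNormal_of_mem_weightSpace (h : MulIndep r₁ r₂) (n : ℤ) {a b : RootDownUp r₁ r₂}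
    (ha : a ∈ weightSpace r₁ r₂ (n - 1)) (hb : b ∈ weightSpace r₁ r₂ (n + 1))
    (H : syzygyMap (-(r₁ * r₂)) (u r₁ r₂) (d r₁ r₂) a b = 0) : IsNormal h a b := by
  have hneg : ∀ (k : ℕ) {a b : RootDownUp r₁ r₂}, a ∈ weightSpace r₁ r₂ (-(k + 2 : ℕ)) →
      b ∈ weightSpace r₁ r₂ (-k) → syzygyMap (-(r₁ * r₂)) (u r₁ r₂) (d r₁ r₂) a b = 0 →
      IsNormal h a b := by
    intro k a b ha hb H
    obtain ⟨p, rfl⟩ := exists_poly_mul_d_pow h (k + 2) ha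
    obtain ⟨q, rfl⟩ := exists_poly_mul_d_pow h k hb
    exact isNormal_of_poly_mul_d_pow h k p q H
  rcases lt_trichotomy n 0 with hn | rfl | hn
  · obtain ⟨k, rfl⟩ : ∃ k : ℕ, n = -(k + 1 : ℕ) := ⟨(-n - 1).toNat, by omega⟩
    refine hneg k ?_ ?_ H
    · convert ha using 2; omega
    · convert hb using 2; omega
  · obtain ⟨p, rfl⟩ := exists_poly_mul_d_pow h 1 (a := a) (by simpa using ha)
    obtain ⟨q, rfl⟩ := exists_u_pow_mul_poly h 1 (a := b) (by simpa using hb)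
    rw [pow_one, pow_one] at *
    exact isNormal_of_weight_zero h p q H
  · obtain ⟨k, rfl⟩ : ∃ k : ℕ, n = (k + 1 : ℕ) := ⟨(n - 1).toNat, by omega⟩
    refine IsNormal.of_swap (hneg k ?_ ?_ ?_)
    · convert swap_mem_weightSpace hb using 2; omega
    · convert swap_mem_weightSpace ha using 2; omega
    · rw [← neg_eq_zero, ← swap_syzygyMap, H, map_zero]

theorem isNormal_of_syzygyMap_eq_zero (h : MulIndep r₁ r₂) {a b : RootDownUp r₁ r₂}
    (H : syzygyMap (-(r₁ * r₂)) (u r₁ r₂) (d r₁ r₂) a b = 0) : IsNormal h a b := by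
  obtain ⟨s, hs⟩ := exists_finset_sum_proj _ _ genWeight a
  obtain ⟨t, ht⟩ := exists_finset_sum_proj _ _ genWeight b
  -- The supports of a and b are shifted by 1 and −1 so that one index n serves both entries.
  set T : Finset ℤ := s.map (Equiv.addRight (1 : ℤ)).toEmbedding ∪
    t.map (Equiv.subRight (1 : ℤ)).toEmbedding with hT
  have ha : a = ∑ n ∈ T, proj _ _ genWeight (n - 1) a := by
    refine ((Finset.sum_map T (Equiv.subRight (1 : ℤ)).toEmbedding
      (fun n => proj (r₁ + r₂) (-(r₁ * r₂)) genWeight n a)).symm.trans (hs _ fun n hn => ?_)).symm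
    rw [Finset.mem_map]
    exact ⟨n + 1, Finset.mem_union_left _ (Finset.mem_map.2 ⟨n, hn, rfl⟩), by simp⟩
  have hb : b = ∑ n ∈ T, proj _ _ genWeight (n + 1) b := by
    refine ((Finset.sum_map T (Equiv.addRight (1 : ℤ)).toEmbedding
      (fun n => proj (r₁ + r₂) (-(r₁ * r₂)) genWeight n b)).symm.trans (ht _ fun n hn => ?_)).symm
    rw [Finset.mem_map]
    exact ⟨n - 1, Finset.mem_union_right _ (Finset.mem_map.2 ⟨n, hn, rfl⟩), by simp⟩
  rw [ha, hb]
  refine IsNormal.sum T fun n => isNormal_of_mem_weightSpace h n (proj_mem _ _ _ _ _)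
    (proj_mem _ _ _ _ _) ?_
  have e := congrArg (proj _ _ genWeight n) H
  have e₁ : proj _ _ genWeight n (a * u r₁ r₂) = proj _ _ genWeight (n - 1) a * u r₁ r₂ := by
    rw [← proj_mul_right _ _ _ _ _ _ _ u_mem_weightSpace, sub_add_cancel]
  have e₂ : proj _ _ genWeight n (u r₁ r₂ * a) = u r₁ r₂ * proj _ _ genWeight (n - 1) a := by
    rw [← proj_mul_left _ _ _ _ _ _ _ u_mem_weightSpace, add_sub_cancel]
  have e₃ : proj _ _ genWeight n (d r₁ r₂ * b) = d r₁ r₂ * proj _ _ genWeight (n + 1) b := by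
    rw [← proj_mul_left _ _ _ _ _ _ _ d_mem_weightSpace, neg_add_cancel_comm_assoc]
  have e₄ : proj _ _ genWeight n (b * d r₁ r₂) = proj _ _ genWeight (n + 1) b * d r₁ r₂ := by
    rw [← proj_mul_right _ _ _ _ _ _ _ d_mem_weightSpace, add_neg_cancel_right]
  rw [syzygyMap, map_sub, map_sub, map_add, map_smul, map_smul, e₁, e₂, e₃, e₄, map_zero] at e
  exact e

end RootDownUp

/-! ### The cokernel of the weight-zero operator -/

section WeightZeroOperator

variable {K : Type*} [Field K] (r₁ r₂ : K)

/-- The operator `σ - (r₁ + r₂) + r₁ r₂ σ⁻¹` on `K[w₁, w₂]`, where `σ(wᵢ) = rᵢ wᵢ`. -/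
noncomputable def charOp : MvPolynomial (Fin 2) K →ₗ[K] MvPolynomial (Fin 2) K :=
  (scalePow r₁ r₂ 1).toLinearMap - (r₁ + r₂) • LinearMap.id
    + (r₁ * r₂) • (scalePow r₁ r₂ (-1)).toLinearMap

theorem charOp_apply (p : MvPolynomial (Fin 2) K) :
    charOp r₁ r₂ p = scalePow r₁ r₂ 1 p - (r₁ + r₂) • p + (r₁ * r₂) • scalePow r₁ r₂ (-1) p := rfl

/-- The eigenvalue of `charOp` on the monomial `m`. -/
noncomputable def charEigenvalue (m : Fin 2 →₀ ℕ) : K :=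
  r₁ ^ m 0 * r₂ ^ m 1 - (r₁ + r₂) + r₁ * r₂ * (r₁ ^ m 0 * r₂ ^ m 1)⁻¹

theorem coeff_charOp (m : Fin 2 →₀ ℕ) (p : MvPolynomial (Fin 2) K) :
    MvPolynomial.coeff m (charOp r₁ r₂ p) = charEigenvalue r₁ r₂ m * MvPolynomial.coeff m p := by
  simp only [charOp_apply, MvPolynomial.coeff_add, MvPolynomial.coeff_sub, MvPolynomial.coeff_smul,
    coeff_scalePow, charEigenvalue, smul_eq_mul, zpow_one, zpow_neg]
  ring

theorem charOp_X_pow_mul_X_pow (i j : ℕ) :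
    charOp r₁ r₂ (MvPolynomial.X 0 ^ i * MvPolynomial.X 1 ^ j) =
      charEigenvalue r₁ r₂ (expo i j) • (MvPolynomial.X 0 ^ i * MvPolynomial.X 1 ^ j) := by
  ext m
  rw [coeff_charOp, MvPolynomial.coeff_smul, coeff_X_pow_mul_X_pow, smul_eq_mul]
  split_ifs with h
  · rw [(eq_expo_iff m i j).2 h]
  · simp

variable {r₁ r₂}

/-- With l the eigenvalue of σ on the monomial, the value is (l − r₁)(l − r₂)/l. -/
theorem charEigenvalue_eq_zero_iff (h : MulIndep r₁ r₂) (m : Fin 2 →₀ ℕ) :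
    charEigenvalue r₁ r₂ m = 0 ↔ (m 0 = 1 ∧ m 1 = 0) ∨ (m 0 = 0 ∧ m 1 = 1) := by
  have hl : r₁ ^ m 0 * r₂ ^ m 1 ≠ 0 :=
    mul_ne_zero (pow_ne_zero _ h.ne_zero₁) (pow_ne_zero _ h.ne_zero₂)
  have e : charEigenvalue r₁ r₂ m =
      (r₁ ^ m 0 * r₂ ^ m 1 - r₁) * (r₁ ^ m 0 * r₂ ^ m 1 - r₂) * (r₁ ^ m 0 * r₂ ^ m 1)⁻¹ := by
    rw [charEigenvalue]
    generalize r₁ ^ m 0 * r₂ ^ m 1 = l at hl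
    field_simp
    ring
  rw [e, mul_eq_zero, mul_eq_zero, or_iff_left (inv_ne_zero hl), sub_eq_zero, sub_eq_zero]
  refine or_congr ⟨fun e => h.pow_mul_pow_eq (k := 1) (l := 0) (by simpa using e), ?_⟩
    ⟨fun e => h.pow_mul_pow_eq (k := 0) (l := 1) (by simpa using e), ?_⟩
  · rintro ⟨h₀, h₁⟩
    simp [h₀, h₁]
  · rintro ⟨h₀, h₁⟩
    simp [h₀, h₁]

variable (r₁ r₂) in
/-- The map `b ↦ charOp (y b)` with `y = r₁ w₁ + r₂ w₂ = du`. -/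
noncomputable def charOpMul : MvPolynomial (Fin 2) K →ₗ[K] MvPolynomial (Fin 2) K :=
  charOp r₁ r₂ ∘ₗ LinearMap.mulLeft K
    (scalePow r₁ r₂ 1 (MvPolynomial.X 0 + MvPolynomial.X 1))

theorem charOpMul_apply (b : MvPolynomial (Fin 2) K) : charOpMul r₁ r₂ b =
    charOp r₁ r₂ (scalePow r₁ r₂ 1 (MvPolynomial.X 0 + MvPolynomial.X 1) * b) := rfl

/-- Polynomials whose classes are a basis of the cokernel of `charOpMul`. -/
noncomputable def cokerBasis (K : Type*) [Field K] : Option ℕ → MvPolynomial (Fin 2) K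
  | none => MvPolynomial.X 1
  | some j => MvPolynomial.X 0 ^ j

/-- Induction on the exponent of w₂: the image of w₁ⁱw₂ʲ is a combination of w₁ⁱ⁺¹w₂ʲ and w₁ⁱw₂ʲ⁺¹,
and the second coefficient is nonzero unless i = j = 0. -/
theorem span_cokerBasis_sup_range (h : MulIndep r₁ r₂) :
    Submodule.span K (Set.range (cokerBasis K)) ⊔ LinearMap.range (charOpMul r₁ r₂) = ⊤ := by
  set W := Submodule.span K (Set.range (cokerBasis K)) ⊔ LinearMap.range (charOpMul r₁ r₂)
  have hb : ∀ i, cokerBasis K i ∈ W :=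
    fun i => Submodule.mem_sup_left (Submodule.subset_span ⟨i, rfl⟩)
  have hm : ∀ j i : ℕ,
      (MvPolynomial.X 0 ^ i * MvPolynomial.X 1 ^ j : MvPolynomial (Fin 2) K) ∈ W := by
    intro j
    induction j with
    | zero => exact fun i => by simpa [cokerBasis] using hb (some i)
    | succ j ih =>
      intro i
      -- The exception is the monomial w₂, which is itself among the chosen representatives.
      by_cases hij : i = 0 ∧ j = 0
      · obtain ⟨rfl, rfl⟩ := hij
        simpa [cokerBasis] using hb none
      have h₁ : charOpMul r₁ r₂ (MvPolynomial.X 0 ^ i * MvPolynomial.X 1 ^ j) ∈ W :=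
        Submodule.mem_sup_right ⟨_, rfl⟩
      have e : scalePow r₁ r₂ 1 (MvPolynomial.X 0 + MvPolynomial.X 1) *
          (MvPolynomial.X 0 ^ i * MvPolynomial.X 1 ^ j) =
          r₁ • (MvPolynomial.X 0 ^ (i + 1) * MvPolynomial.X 1 ^ j) +
          r₂ • (MvPolynomial.X 0 ^ i * MvPolynomial.X 1 ^ (j + 1)) := by
        simp only [RootDownUp.scalePow_X_add_X, zpow_one, MvPolynomial.smul_eq_C_mul]
        ring
      rw [charOpMul_apply, e, map_add, map_smul, map_smul, charOp_X_pow_mul_X_pow,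
        charOp_X_pow_mul_X_pow, smul_smul r₂] at h₁
      have h₂ := (Submodule.add_mem_iff_right _ (Submodule.smul_mem _ r₁
        (Submodule.smul_mem _ (charEigenvalue r₁ r₂ (expo (i + 1) j)) (ih (i + 1))))).1 h₁
      refine (Submodule.smul_mem_iff _ (mul_ne_zero h.ne_zero₂ ?_)).1 h₂
      rw [ne_eq, charEigenvalue_eq_zero_iff h]
      simp only [expo_zero, expo_one]
      omega
  rw [eq_top_iff]
  rintro p -
  induction p using MvPolynomial.induction_on' with
  | monomial m c => rw [monomial_eq_smul]; exact Submodule.smul_mem _ _ (hm _ _)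
  | add p q hp hq => exact Submodule.add_mem _ hp hq

theorem linearCombination_functional {ι M : Type*} [AddCommGroup M] [Module K M] (v : ι → M)
    (L : M →ₗ[K] K) (i₀ : ι) (hL : ∀ i, i ≠ i₀ → L (v i) = 0) (c : ι →₀ K) :
    L (Finsupp.linearCombination K v c) = c i₀ * L (v i₀) := by
  rw [Finsupp.linearCombination_apply, map_finsuppSum, Finsupp.sum_eq_single i₀]
  · simp
  · intro i _ hi
    simp [hL i hi]
  · simp

/-- Each representative is detected by a functional vanishing on the range and on the other
representatives. For w₁ and w₂ this is the coefficient, since `charOp` kills these monomials. For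
w₁ʲ with j ≠ 1, undo `charOp`, restrict to the line y = 0 and take the coefficient in degree j. -/
theorem eq_zero_of_linearCombination_cokerBasis (h : MulIndep r₁ r₂) (c : Option ℕ →₀ K)
    (b : MvPolynomial (Fin 2) K)
    (e : Finsupp.linearCombination K (cokerBasis K) c = charOpMul r₁ r₂ b) : c = 0 := by
  have hcoeff : ∀ m, charEigenvalue r₁ r₂ m = 0 → ∀ i₀,
      (∀ i, i ≠ i₀ → MvPolynomial.coeff m (cokerBasis K i) = 0) →
      MvPolynomial.coeff m (cokerBasis K i₀) ≠ 0 → c i₀ = 0 := by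
    intro m hm i₀ hi hi₀
    have := linearCombination_functional (cokerBasis K) (MvPolynomial.lcoeff K m) i₀ hi c
    rw [e] at this
    simp only [MvPolynomial.lcoeff_apply, charOpMul_apply, coeff_charOp, hm, zero_mul] at this
    exact (mul_eq_zero.1 this.symm).resolve_right hi₀
  ext i
  by_cases hi : i = none
  · subst hi
    refine hcoeff (expo 0 1) ((charEigenvalue_eq_zero_iff h _).2 (by simp)) none ?_ ?_
    · rintro (_ | j) hj
      · exact absurd rfl hj
      · simpa [cokerBasis] using coeff_X_pow_mul_X_pow (K := K) j 0 (expo 0 1)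
    · simp [cokerBasis, coeff_X_one']
  by_cases hi' : i = some 1
  · subst hi'
    refine hcoeff (expo 1 0) ((charEigenvalue_eq_zero_iff h _).2 (by simp)) (some 1) ?_ ?_
    · rintro (_ | j) hj
      · simp [cokerBasis, coeff_X_one']
      · have : j ≠ 1 := fun e => hj (by rw [e])
        have := coeff_X_pow_mul_X_pow (K := K) j 0 (expo 1 0)
        simp only [expo_zero, expo_one, pow_zero, mul_one] at this
        rw [cokerBasis, this, if_neg (by omega)]
    · simp [cokerBasis, coeff_X_zero']
  obtain ⟨j, rfl⟩ := Option.ne_none_iff_exists'.1 hi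
  have hj : j ≠ 1 := fun e => hi' (by rw [e])
  -- A parametrization of the line r₁w₁ + r₂w₂ = 0.
  let ψ : MvPolynomial (Fin 2) K →ₐ[K] K[X] :=
    MvPolynomial.aeval ![r₂ • Polynomial.X, (-r₁) • Polynomial.X]
  have hψ₀ : ψ (MvPolynomial.X 0) = r₂ • Polynomial.X := by simp [ψ]
  have hψ₁ : ψ (MvPolynomial.X 1) = (-r₁) • Polynomial.X := by simp [ψ]
  -- Since 0⁻¹ = 0, δ inverts `charOp` up to multiples of w₁ and w₂. These only contribute in degree
  -- 1, hence not to the coefficient of degree j ≠ 1.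
  let δ := diagonalMap fun m => (charEigenvalue r₁ r₂ m)⁻¹
  have hδ : ∀ z, ∃ x y : K, δ (charOp r₁ r₂ z) =
      z - x • MvPolynomial.X 0 - y • MvPolynomial.X 1 := by
    intro z
    refine ⟨MvPolynomial.coeff (expo 1 0) z, MvPolynomial.coeff (expo 0 1) z, ?_⟩
    ext m
    simp only [δ, coeff_diagonalMap, coeff_charOp, MvPolynomial.coeff_sub, MvPolynomial.coeff_smul,
      coeff_X_zero', coeff_X_one', smul_eq_mul]
    by_cases h₁ : m 0 = 1 ∧ m 1 = 0
    · obtain rfl := (eq_expo_iff _ _ _).2 h₁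
      rw [(charEigenvalue_eq_zero_iff h _).2 (by simp)]
      simp
    by_cases h₂ : m 0 = 0 ∧ m 1 = 1
    · obtain rfl := (eq_expo_iff _ _ _).2 h₂
      rw [(charEigenvalue_eq_zero_iff h _).2 (by simp)]
      simp
    have h₃ : charEigenvalue r₁ r₂ m ≠ 0 := by
      rw [ne_eq, charEigenvalue_eq_zero_iff h]
      exact not_or.2 ⟨h₁, h₂⟩
    rw [if_neg h₁, if_neg h₂, inv_mul_cancel_left₀ h₃]
    simp
  have hδX : ∀ i k, δ (MvPolynomial.X 0 ^ i * MvPolynomial.X 1 ^ k) =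
      (charEigenvalue r₁ r₂ (expo i k))⁻¹ • (MvPolynomial.X 0 ^ i * MvPolynomial.X 1 ^ k) := by
    intro i k
    ext m
    simp only [δ, coeff_diagonalMap, coeff_X_pow_mul_X_pow, MvPolynomial.coeff_smul, smul_eq_mul]
    split_ifs with hm
    · rw [(eq_expo_iff m i k).2 hm]
    · simp
  let L : MvPolynomial (Fin 2) K →ₗ[K] K := Polynomial.lcoeff K j ∘ₗ ψ.toLinearMap ∘ₗ δ
  have hL : ∀ i k, ψ (δ (MvPolynomial.X 0 ^ i * MvPolynomial.X 1 ^ k)) =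
      ((charEigenvalue r₁ r₂ (expo i k))⁻¹ * r₂ ^ i * (-r₁) ^ k) • Polynomial.X ^ (i + k) := by
    intro i k
    rw [hδX, map_smul, map_mul, map_pow, map_pow, hψ₀, hψ₁, _root_.smul_pow, _root_.smul_pow,
      smul_mul_smul_comm, ← pow_add, smul_smul, mul_assoc]
  have h₁ := linearCombination_functional (cokerBasis K) L (some j) (by
    rintro (_ | i) hi
    · have := hL 0 1
      simp only [pow_zero, one_mul, pow_one, zero_add] at this
      simp only [L, LinearMap.comp_apply, cokerBasis, AlgHom.toLinearMap_apply, this, map_smul]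
      simp [Polynomial.coeff_X, hj.symm]
    · have := hL i 0
      simp only [pow_zero, mul_one, add_zero] at this
      have hij : j ≠ i := fun e => hi (by rw [e])
      simp only [L, LinearMap.comp_apply, cokerBasis, AlgHom.toLinearMap_apply, this, map_smul]
      simp [Polynomial.coeff_X_pow, hij]) c
  have h₂ : L (cokerBasis K (some j)) = (charEigenvalue r₁ r₂ (expo j 0))⁻¹ * r₂ ^ j := by
    have := hL j 0
    simp only [pow_zero, mul_one, add_zero] at this
    simp only [L, LinearMap.comp_apply, cokerBasis, AlgHom.toLinearMap_apply, this, map_smul]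
    simp
  have h₃ : L (charOpMul r₁ r₂ b) = 0 := by
    obtain ⟨x, y, hxy⟩ := hδ (scalePow r₁ r₂ 1 (MvPolynomial.X 0 + MvPolynomial.X 1) * b)
    have hy : ψ (scalePow r₁ r₂ 1 (MvPolynomial.X 0 + MvPolynomial.X 1)) = 0 := by
      rw [RootDownUp.scalePow_X_add_X, map_add, map_smul, map_smul, hψ₀, hψ₁, zpow_one, zpow_one]
      module
    simp only [L, LinearMap.comp_apply, charOpMul_apply, hxy, AlgHom.toLinearMap_apply, map_sub,
      map_mul, hy, map_smul, hψ₀, hψ₁]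
    simp [Polynomial.coeff_X, hj.symm]
  rw [e, h₃, h₂] at h₁
  refine (mul_eq_zero.1 h₁.symm).resolve_right (mul_ne_zero (inv_ne_zero ?_)
    (pow_ne_zero _ h.ne_zero₂))
  rw [ne_eq, charEigenvalue_eq_zero_iff h]
  simpa using hj

end WeightZeroOperator

/-! ### Compatibility of obstructions and linearized relations with gradings -/

namespace DownUpAlgebra

section ProjLin

variable {K : Type*} [Field K] (α β : K) {G : Type*} [AddCommGroup G] (deg : UDGen → G)

theorem proj_mul_mul_right {p q r s : G} (a : DownUpAlgebra α β 0) {b c : DownUpAlgebra α β 0}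
    (hb : b ∈ grading α β deg q) (hc : c ∈ grading α β deg r) (e : s = p + q + r) :
    proj α β deg s (a * b * c) = proj α β deg p a * b * c := by
  rw [e, proj_mul_right _ _ _ _ _ _ _ hc, proj_mul_right _ _ _ _ _ _ _ hb]

theorem proj_mul_mul_mid {p q r s : G} (a : DownUpAlgebra α β 0) {b c : DownUpAlgebra α β 0}
    (hb : b ∈ grading α β deg q) (hc : c ∈ grading α β deg r) (e : s = p + q + r) :
    proj α β deg s (b * a * c) = b * proj α β deg p a * c := by
  rw [e, proj_mul_right _ _ _ _ _ _ _ hc, add_comm p, proj_mul_left _ _ _ _ _ _ _ hb]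

theorem proj_mul_mul_left {p q r s : G} (a : DownUpAlgebra α β 0) {b c : DownUpAlgebra α β 0}
    (hb : b ∈ grading α β deg q) (hc : c ∈ grading α β deg r) (e : s = p + q + r) :
    proj α β deg s (b * c * a) = b * c * proj α β deg p a := by
  rw [e, show p + q + r = q + r + p by abel, proj_mul_left _ _ _ _ _ _ _ (mul_mem_grading hb hc)]

/-- A direction of degree p changes u in degree p + deg u and d in degree p + deg d, so the two
components of (x, y) are taken in different degrees. -/
theorem proj_linDDU (p : G) (x y : DownUpAlgebra α β 0) :
    proj α β deg (p + deg UDGen.d + deg UDGen.d + deg UDGen.u)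
      (linDDU α β (gen α β 0 UDGen.u) (gen α β 0 UDGen.d) x y) =
      linDDU α β (gen α β 0 UDGen.u) (gen α β 0 UDGen.d)
        (proj α β deg (p + deg UDGen.u) x) (proj α β deg (p + deg UDGen.d) y) := by
  have hu := gen_mem_grading α β deg UDGen.u
  have hd := gen_mem_grading α β deg UDGen.d
  simp only [linDDU, map_add, map_sub, map_smul]
  rw [proj_mul_mul_right α β deg (p := p + deg UDGen.d) y hd hu (by abel),
    proj_mul_mul_mid α β deg (p := p + deg UDGen.d) y hd hu (by abel),
    proj_mul_mul_left α β deg (p := p + deg UDGen.u) x hd hd (by abel),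
    proj_mul_mul_right α β deg (p := p + deg UDGen.d) y hu hd (by abel),
    proj_mul_mul_mid α β deg (p := p + deg UDGen.u) x hd hd (by abel),
    proj_mul_mul_left α β deg (p := p + deg UDGen.d) y hd hu (by abel),
    proj_mul_mul_right α β deg (p := p + deg UDGen.u) x hd hd (by abel),
    proj_mul_mul_mid α β deg (p := p + deg UDGen.d) y hu hd (by abel),
    proj_mul_mul_left α β deg (p := p + deg UDGen.d) y hu hd (by abel)]

theorem proj_linDUU (p : G) (x y : DownUpAlgebra α β 0) :
    proj α β deg (p + deg UDGen.d + deg UDGen.u + deg UDGen.u)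
      (linDUU α β (gen α β 0 UDGen.u) (gen α β 0 UDGen.d) x y) =
      linDUU α β (gen α β 0 UDGen.u) (gen α β 0 UDGen.d)
        (proj α β deg (p + deg UDGen.u) x) (proj α β deg (p + deg UDGen.d) y) := by
  have hu := gen_mem_grading α β deg UDGen.u
  have hd := gen_mem_grading α β deg UDGen.d
  simp only [linDUU, map_add, map_sub, map_smul]
  rw [proj_mul_mul_right α β deg (p := p + deg UDGen.d) y hu hu (by abel),
    proj_mul_mul_mid α β deg (p := p + deg UDGen.u) x hd hu (by abel),
    proj_mul_mul_left α β deg (p := p + deg UDGen.u) x hd hu (by abel),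
    proj_mul_mul_right α β deg (p := p + deg UDGen.u) x hd hu (by abel),
    proj_mul_mul_mid α β deg (p := p + deg UDGen.d) y hu hu (by abel),
    proj_mul_mul_left α β deg (p := p + deg UDGen.u) x hu hd (by abel),
    proj_mul_mul_right α β deg (p := p + deg UDGen.u) x hu hd (by abel),
    proj_mul_mul_mid α β deg (p := p + deg UDGen.u) x hu hd (by abel),
    proj_mul_mul_left α β deg (p := p + deg UDGen.d) y hu hu (by abel)]

theorem cochainComponent_mul_add {p x y z s : G}
    (f : DownUpAlgebra α β 0 →ₗ[K] DownUpAlgebra α β 0 →ₗ[K] DownUpAlgebra α β 0)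
    {a b c : DownUpAlgebra α β 0} (ha : a ∈ grading α β deg x) (hb : b ∈ grading α β deg y)
    (hc : c ∈ grading α β deg z) (e : s = p + x + y + z) :
    cochainComponent α β deg p f a b * c + cochainComponent α β deg p f (a * b) c =
      proj α β deg s (f a b * c + f (a * b) c) := by
  rw [cochainComponent_apply_of_mem f ha hb,
    cochainComponent_apply_of_mem f (mul_mem_grading ha hb) hc, map_add, e,
    show x + y + z + p = p + x + y + z by abel, ← proj_mul_right _ _ _ _ _ _ _ hc,
    show x + y + p + z = p + x + y + z by abel]

theorem obstrDDU_cochainComponent (p : G)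
    (f : DownUpAlgebra α β 0 →ₗ[K] DownUpAlgebra α β 0 →ₗ[K] DownUpAlgebra α β 0) :
    obstrDDU α β (gen α β 0 UDGen.u) (gen α β 0 UDGen.d) (cochainComponent α β deg p f) =
      proj α β deg (p + deg UDGen.d + deg UDGen.d + deg UDGen.u)
        (obstrDDU α β (gen α β 0 UDGen.u) (gen α β 0 UDGen.d) f) := by
  have hu := gen_mem_grading α β deg UDGen.u
  have hd := gen_mem_grading α β deg UDGen.d
  rw [obstrDDU, obstrDDU, cochainComponent_mul_add α β deg f hd hd hu rfl,
    cochainComponent_mul_add α β deg f hd hu hd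
      (s := p + deg UDGen.d + deg UDGen.d + deg UDGen.u) (by abel),
    cochainComponent_mul_add α β deg f hu hd hd
      (s := p + deg UDGen.d + deg UDGen.d + deg UDGen.u) (by abel)]
  simp only [map_sub, map_smul]

theorem obstrDUU_cochainComponent (p : G)
    (f : DownUpAlgebra α β 0 →ₗ[K] DownUpAlgebra α β 0 →ₗ[K] DownUpAlgebra α β 0) :
    obstrDUU α β (gen α β 0 UDGen.u) (gen α β 0 UDGen.d) (cochainComponent α β deg p f) =
      proj α β deg (p + deg UDGen.d + deg UDGen.u + deg UDGen.u)
        (obstrDUU α β (gen α β 0 UDGen.u) (gen α β 0 UDGen.d) f) := by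
  have hu := gen_mem_grading α β deg UDGen.u
  have hd := gen_mem_grading α β deg UDGen.d
  rw [obstrDUU, obstrDUU, cochainComponent_mul_add α β deg f hd hu hu rfl,
    cochainComponent_mul_add α β deg f hu hd hu
      (s := p + deg UDGen.d + deg UDGen.u + deg UDGen.u) (by abel),
    cochainComponent_mul_add α β deg f hu hu hd
      (s := p + deg UDGen.d + deg UDGen.u + deg UDGen.u) (by abel)]
  simp only [map_sub, map_smul]

end ProjLin

end DownUpAlgebra

/-! ### Linearized relations in weight zero -/

namespace RootDownUp

open DownUpAlgebra

variable {K : Type*} [Field K] {r₁ r₂ : K}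

section WeightZero

/-- Only b + c enters: in the direction (u c, −c d) the products ud and du do not change to first
order. -/
theorem linDDU_weight_zero (h : MulIndep r₁ r₂) (b c : MvPolynomial (Fin 2) K) :
    linDDU (r₁ + r₂) (-(r₁ * r₂)) (u r₁ r₂) (d r₁ r₂) (u r₁ r₂ * poly h c)
      (poly h b * d r₁ r₂) = poly h (charOpMul r₁ r₂ (b + c)) * d r₁ r₂ := by
  have hX := scalePow_recurrence h 0
  rw [zero_add, zero_add, scalePow_zero] at hX
  have hyy : scalePow r₁ r₂ 1 (scalePow r₁ r₂ 1 (MvPolynomial.X 0 + MvPolynomial.X 1)) =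
      scalePow r₁ r₂ 2 (MvPolynomial.X 0 + MvPolynomial.X 1) := by
    rw [scalePow_scalePow h]; norm_num
  have hy : scalePow r₁ r₂ (-1) (scalePow r₁ r₂ 1 (MvPolynomial.X 0 + MvPolynomial.X 1)) =
      MvPolynomial.X 0 + MvPolynomial.X 1 := by
    rw [scalePow_scalePow h]; simp
  rw [charOpMul_apply, charOp_apply, map_mul, map_mul, map_add (scalePow r₁ r₂ 1) b c,
    map_add (scalePow r₁ r₂ (-1)) b c, hyy, hy, hX]
  set x : MvPolynomial (Fin 2) K := MvPolynomial.X 0 + MvPolynomial.X 1 with hx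
  set y := scalePow r₁ r₂ 1 x with hyd
  have hddu : d r₁ r₂ * (d r₁ r₂ * u r₁ r₂) = poly h (scalePow r₁ r₂ 1 y) * d r₁ r₂ := by
    rw [d_mul_u h, d_mul_poly, hyd, hx, scalePow_X_add_X, zpow_one, zpow_one]
  have e₁ : poly h b * d r₁ r₂ * d r₁ r₂ * u r₁ r₂ =
      poly h (b * scalePow r₁ r₂ 1 y) * d r₁ r₂ := by
    rw [mul_assoc, mul_assoc, hddu, ← mul_assoc, ← map_mul]
  have e₂ : d r₁ r₂ * (poly h b * d r₁ r₂) * u r₁ r₂ =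
      poly h (scalePow r₁ r₂ 1 b * scalePow r₁ r₂ 1 y) * d r₁ r₂ := by
    rw [← mul_assoc, d_mul_poly]
    rw [mul_assoc, mul_assoc, hddu, ← mul_assoc, ← map_mul]
  have e₃ : d r₁ r₂ * d r₁ r₂ * (u r₁ r₂ * poly h c) =
      poly h (scalePow r₁ r₂ 1 y * scalePow r₁ r₂ 1 c) * d r₁ r₂ := by
    rw [mul_assoc, d_mul_u_mul h, ← map_mul, d_mul_poly, map_mul]
  have e₄ : poly h b * d r₁ r₂ * u r₁ r₂ * d r₁ r₂ = poly h (b * y) * d r₁ r₂ := by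
    rw [mul_assoc (poly h b), d_mul_u h, ← map_mul, hyd, hx, scalePow_X_add_X, zpow_one, zpow_one]
  have e₅ : d r₁ r₂ * (u r₁ r₂ * poly h c) * d r₁ r₂ = poly h (y * c) * d r₁ r₂ := by
    rw [d_mul_u_mul h, ← map_mul]
  have e₆ : d r₁ r₂ * u r₁ r₂ * (poly h b * d r₁ r₂) = poly h (y * b) * d r₁ r₂ := by
    rw [mul_assoc, d_mul_u_mul h, ← mul_assoc, ← map_mul]
  have e₇ : u r₁ r₂ * poly h c * d r₁ r₂ * d r₁ r₂ =
      poly h (x * scalePow r₁ r₂ (-1) c) * d r₁ r₂ := by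
    rw [u_mul_poly_mul_d]
  have e₈ : u r₁ r₂ * (poly h b * d r₁ r₂) * d r₁ r₂ =
      poly h (x * scalePow r₁ r₂ (-1) b) * d r₁ r₂ := by
    rw [← mul_assoc, u_mul_poly_mul_d]
  have e₉ : u r₁ r₂ * d r₁ r₂ * (poly h b * d r₁ r₂) = poly h (x * b) * d r₁ r₂ := by
    rw [mul_assoc, u_mul_d_mul h, ← mul_assoc, ← map_mul]
  rw [linDDU, e₁, e₂, e₃, e₄, e₅, e₆, e₇, e₈, e₉, hyy, hX]
  simp only [← add_mul, ← sub_mul, ← smul_mul_assoc, ← map_add (poly h), ← map_sub (poly h),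
    ← map_smul (poly h)]
  congr 2
  simp only [MvPolynomial.smul_eq_C_mul, MvPolynomial.C_neg, MvPolynomial.C_mul, MvPolynomial.C_add]
  ring

theorem linDUU_weight_zero (h : MulIndep r₁ r₂) (b : MvPolynomial (Fin 2) K) :
    linDUU (r₁ + r₂) (-(r₁ * r₂)) (u r₁ r₂) (d r₁ r₂) 0 (poly h b * d r₁ r₂) =
      u r₁ r₂ * poly h (charOpMul r₁ r₂ b) := by
  have hy : scalePow r₁ r₂ (-1) (scalePow r₁ r₂ 1 (MvPolynomial.X 0 + MvPolynomial.X 1)) =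
      MvPolynomial.X 0 + MvPolynomial.X 1 := by
    rw [scalePow_scalePow h]; simp
  have hdu : d r₁ r₂ * u r₁ r₂ =
      poly h (scalePow r₁ r₂ 1 (MvPolynomial.X 0 + MvPolynomial.X 1)) := by
    rw [d_mul_u h, scalePow_X_add_X, zpow_one, zpow_one]
  rw [charOpMul_apply, charOp_apply]
  set y := scalePow r₁ r₂ 1 (MvPolynomial.X 0 + MvPolynomial.X 1) with hyd
  have e₁ : poly h b * d r₁ r₂ * u r₁ r₂ * u r₁ r₂ =
      u r₁ r₂ * poly h (scalePow r₁ r₂ 1 (y * b)) := by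
    rw [mul_assoc (poly h b), hdu, ← map_mul, poly_mul_u, mul_comm b]
  have e₂ : u r₁ r₂ * (poly h b * d r₁ r₂) * u r₁ r₂ = u r₁ r₂ * poly h (y * b) := by
    rw [mul_assoc, mul_assoc (poly h b), hdu, ← map_mul, mul_comm b]
  have e₃ : u r₁ r₂ * u r₁ r₂ * (poly h b * d r₁ r₂) =
      u r₁ r₂ * poly h (scalePow r₁ r₂ (-1) (y * b)) := by
    rw [mul_assoc, ← mul_assoc (u r₁ r₂) (poly h b), u_mul_poly_mul_d, map_mul (scalePow _ _ _), hy]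
  simp only [linDUU, zero_mul, mul_zero, add_zero, zero_add, e₁, e₂, e₃, map_add (poly h),
    map_sub (poly h), map_smul (poly h), mul_add, mul_sub, mul_smul_comm]
  module

theorem w₁_mem_grading {G : Type*} [AddCommGroup G] (deg : UDGen → G) :
    w₁ r₁ r₂ ∈ grading (r₁ + r₂) (-(r₁ * r₂)) deg (deg UDGen.u + deg UDGen.d) := by
  have hu := gen_mem_grading (r₁ + r₂) (-(r₁ * r₂)) deg UDGen.u
  have hd := gen_mem_grading (r₁ + r₂) (-(r₁ * r₂)) deg UDGen.d
  exact Submodule.smul_mem _ _ (Submodule.sub_mem _ (add_comm (deg UDGen.u) _ ▸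
    mul_mem_grading hd hu) (Submodule.smul_mem _ _ (mul_mem_grading hu hd)))

theorem w₂_mem_grading {G : Type*} [AddCommGroup G] (deg : UDGen → G) :
    w₂ r₁ r₂ ∈ grading (r₁ + r₂) (-(r₁ * r₂)) deg (deg UDGen.u + deg UDGen.d) := by
  have hu := gen_mem_grading (r₁ + r₂) (-(r₁ * r₂)) deg UDGen.u
  have hd := gen_mem_grading (r₁ + r₂) (-(r₁ * r₂)) deg UDGen.d
  exact Submodule.smul_mem _ _ (Submodule.sub_mem _ (Submodule.smul_mem _ _
    (mul_mem_grading hu hd)) (add_comm (deg UDGen.u) _ ▸ mul_mem_grading hd hu))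

theorem poly_mem_weightSpace_zero (h : MulIndep r₁ r₂) (e : MvPolynomial (Fin 2) K) :
    poly h e ∈ weightSpace r₁ r₂ 0 := by
  induction e using MvPolynomial.induction_on with
  | C a =>
    rw [← MvPolynomial.algebraMap_eq, AlgHom.commutes, Algebra.algebraMap_eq_smul_one]
    exact Submodule.smul_mem _ _ (one_mem_grading _ _ _)
  | add p q hp hq => rw [map_add]; exact Submodule.add_mem _ hp hq
  | mul_X p i hp =>
    rw [map_mul, ← add_zero (0 : ℤ)]
    refine mul_mem_grading hp ?_
    fin_cases i
    · exact (poly_X_zero h).symm ▸ w₁_mem_grading genWeight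
    · exact (poly_X_one h).symm ▸ w₂_mem_grading genWeight

/-- Only the weight −1 part of the equation matters, and there the direction has the form (u c, b
d). -/
theorem mem_range_charOpMul_of_eq_lin (h : MulIndep r₁ r₂) {e : MvPolynomial (Fin 2) K}
    {p q : RootDownUp r₁ r₂}
    (H : poly h e * d r₁ r₂ = linDDU (r₁ + r₂) (-(r₁ * r₂)) (u r₁ r₂) (d r₁ r₂) p q) :
    ∃ b, e = charOpMul r₁ r₂ b := by
  have hmem : poly h e * d r₁ r₂ ∈ weightSpace r₁ r₂ (-1) := by
    simpa using mul_mem_grading (poly_mem_weightSpace_zero h e) d_mem_weightSpace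
  have H' := congrArg (proj (r₁ + r₂) (-(r₁ * r₂)) genWeight (-1)) H
  rw [proj_of_mem hmem] at H'
  have := proj_linDDU (r₁ + r₂) (-(r₁ * r₂)) genWeight 0 p q
  simp only [genWeight] at this
  norm_num at this
  rw [this] at H'
  obtain ⟨c, hc⟩ := exists_u_pow_mul_poly h 1 (proj_mem (r₁ + r₂) (-(r₁ * r₂)) genWeight 1 p)
  obtain ⟨b, hb⟩ := exists_poly_mul_d_pow h 1 (proj_mem (r₁ + r₂) (-(r₁ * r₂)) genWeight (-1) q)
  rw [pow_one] at hc hb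
  rw [hc, hb, linDDU_weight_zero] at H'
  exact ⟨b + c, poly_mul_d_pow_injective h 1 (by simpa using H')⟩

end WeightZero

end RootDownUp

/-! ### Bases adapted to independent subspaces -/

section GradedBasis

variable {K M ι J : Type*} [Field K] [AddCommGroup M] [Module K M]

/-- If a basis of `M` consists of elements of independent subspaces `V p`, then these subspaces are
spanned by the basis elements that they contain. -/
theorem eq_span_image_of_iSupIndep {V : J → Submodule K M} (hV : iSupIndep V) {b : ι → M}
    (hspan : Submodule.span K (Set.range b) = ⊤) {deg : ι → J} (hb : ∀ i, b i ∈ V (deg i)) (p : J) :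
    V p = Submodule.span K (b '' {i | deg i = p}) := by
  have hle : ∀ q, Submodule.span K (b '' {i | deg i = q}) ≤ V q := by
    intro q
    rw [Submodule.span_le]
    rintro _ ⟨i, rfl, rfl⟩
    exact hb i
  refine le_antisymm (fun x hx => ?_) (hle p)
  have hx' : x ∈ Submodule.span K (b '' {i | deg i = p}) ⊔
      ⨆ q, ⨆ (_ : q ≠ p), Submodule.span K (b '' {i | deg i = q}) := by
    have htop : (⊤ : Submodule K M) ≤ Submodule.span K (b '' {i | deg i = p}) ⊔
        ⨆ q, ⨆ (_ : q ≠ p), Submodule.span K (b '' {i | deg i = q}) := by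
      rw [← hspan, Submodule.span_le]
      rintro _ ⟨i, rfl⟩
      by_cases hi : deg i = p
      · exact Submodule.mem_sup_left (Submodule.subset_span ⟨i, hi, rfl⟩)
      · exact Submodule.mem_sup_right (Submodule.mem_iSup_of_mem (deg i)
          (Submodule.mem_iSup_of_mem hi (Submodule.subset_span ⟨i, rfl, rfl⟩)))
    exact htop trivial
  obtain ⟨y, hy, z, hz, rfl⟩ := Submodule.mem_sup.1 hx'
  have hz' : z ∈ ⨆ q, ⨆ (_ : q ≠ p), V q := iSup₂_mono (fun q _ => hle q) hz
  have hzp : z ∈ V p := by simpa using Submodule.sub_mem _ hx (hle p hy)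
  rw [Submodule.disjoint_def.1 (hV p) z hzp hz', add_zero]
  exact hy

theorem iSup_eq_top_of_mem {V : J → Submodule K M} {b : ι → M}
    (hspan : Submodule.span K (Set.range b) = ⊤) {deg : ι → J} (hb : ∀ i, b i ∈ V (deg i)) :
    ⨆ p, V p = ⊤ := by
  rw [eq_top_iff, ← hspan, Submodule.span_le]
  rintro _ ⟨i, rfl⟩
  exact Submodule.mem_iSup_of_mem _ (hb i)

theorem finrank_span_image_eq_ncard {b : ι → M} (hli : LinearIndependent K b) {s : Set ι}
    (hs : s.Finite) : FiniteDimensional K (Submodule.span K (b '' s)) ∧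
      Module.finrank K (Submodule.span K (b '' s)) = s.ncard := by
  refine ⟨FiniteDimensional.span_of_finite K (hs.image b), ?_⟩
  have := hs.fintype
  rw [Set.image_eq_range]
  refine (finrank_span_eq_card (hli.comp ((↑) : s → ι) Subtype.val_injective)).trans ?_
  rw [← Nat.card_eq_fintype_card, Nat.card_coe_set_eq]

end GradedBasis

/-! ### A homogeneous basis of HH²(A) -/

namespace RootDownUp

open DownUpAlgebra

variable {K : Type*} [Field K] {r₁ r₂ : K}

variable (r₁ r₂) in
/-- The obstruction of a bilinear map, as a linear map. -/
noncomputable def obstr :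
    (RootDownUp r₁ r₂ →ₗ[K] RootDownUp r₁ r₂ →ₗ[K] RootDownUp r₁ r₂) →ₗ[K]
      RootDownUp r₁ r₂ × RootDownUp r₁ r₂ where
  toFun f := (obstrDDU (r₁ + r₂) (-(r₁ * r₂)) (u r₁ r₂) (d r₁ r₂) f,
    obstrDUU (r₁ + r₂) (-(r₁ * r₂)) (u r₁ r₂) (d r₁ r₂) f)
  map_add' f g := by
    ext
    · simp only [obstrDDU, LinearMap.add_apply, add_mul, Prod.fst_add]
      module
    · simp only [obstrDUU, LinearMap.add_apply, add_mul, Prod.snd_add]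
      module
  map_smul' k f := by
    ext
    · simp only [obstrDDU, LinearMap.smul_apply, smul_mul_assoc, Prod.smul_fst, RingHom.id_apply]
      module
    · simp only [obstrDUU, LinearMap.smul_apply, smul_mul_assoc, Prod.smul_snd, RingHom.id_apply]
      module

variable (r₁ r₂) in
/-- The linearization of the relations, as a linear map. -/
noncomputable def lin :
    RootDownUp r₁ r₂ × RootDownUp r₁ r₂ →ₗ[K] RootDownUp r₁ r₂ × RootDownUp r₁ r₂ where
  toFun x := (linDDU (r₁ + r₂) (-(r₁ * r₂)) (u r₁ r₂) (d r₁ r₂) x.1 x.2,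
    linDUU (r₁ + r₂) (-(r₁ * r₂)) (u r₁ r₂) (d r₁ r₂) x.1 x.2)
  map_add' x y := by simp only [Prod.fst_add, Prod.snd_add, linDDU_add, linDUU_add, Prod.mk_add_mk]
  map_smul' k x := by
    simp only [Prod.smul_fst, Prod.smul_snd, linDDU_smul, linDUU_smul, Prod.smul_mk,
      RingHom.id_apply]

/-- The class of `(e d, u e)` modulo the linearized relations. -/
noncomputable def normalClass (h : MulIndep r₁ r₂) : MvPolynomial (Fin 2) K →ₗ[K]
    (RootDownUp r₁ r₂ × RootDownUp r₁ r₂) ⧸ LinearMap.range (lin r₁ r₂) :=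
  Submodule.mkQ _ ∘ₗ LinearMap.prod
    (LinearMap.mulRight K (d r₁ r₂) ∘ₗ (poly h).toLinearMap)
    (LinearMap.mulLeft K (u r₁ r₂) ∘ₗ (poly h).toLinearMap)

theorem normalClass_eq_zero_iff (h : MulIndep r₁ r₂) (e : MvPolynomial (Fin 2) K) :
    normalClass h e = 0 ↔ ∃ b, e = charOpMul r₁ r₂ b := by
  have key : normalClass h e = 0 ↔
      (poly h e * d r₁ r₂, u r₁ r₂ * poly h e) ∈ LinearMap.range (lin r₁ r₂) :=
    Submodule.Quotient.mk_eq_zero _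
  rw [key]
  constructor
  · rintro ⟨⟨p, q⟩, hpq⟩
    exact mem_range_charOpMul_of_eq_lin h (congrArg Prod.fst hpq).symm
  · rintro ⟨b, rfl⟩
    refine ⟨(0, poly h b * d r₁ r₂), Prod.ext ?_ ?_⟩
    · have := linDDU_weight_zero h b 0
      rwa [map_zero, mul_zero, add_zero] at this
    · exact linDUU_weight_zero h b

variable (r₁ r₂) in
/-- The class of the obstruction of a cocycle modulo the linearized relations. -/
noncomputable def obstrClass : HH2 K (RootDownUp r₁ r₂) →ₗ[K]
    (RootDownUp r₁ r₂ × RootDownUp r₁ r₂) ⧸ LinearMap.range (lin r₁ r₂) :=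
  Submodule.mapQ _ _ (obstr r₁ r₂ ∘ₗ Submodule.subtype _) (by
    rintro f ⟨g, hg⟩
    exact ⟨(g (u r₁ r₂), g (d r₁ r₂)), Prod.ext (obstrDDU_coboundary (relDDU_gen _ _) hg).symm
      (obstrDUU_coboundary (relDUU_gen _ _) hg).symm⟩)

theorem obstrClass_mk (f : hochschildCocycles₂ K (RootDownUp r₁ r₂)) :
    obstrClass r₁ r₂ (Submodule.Quotient.mk f) = Submodule.Quotient.mk (obstr r₁ r₂ f) := rfl

/-- This is the universal property again: an obstruction that is a linearized relation can be
removed by changing the lifts. -/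
theorem obstrClass_injective : Function.Injective (obstrClass r₁ r₂) := by
  rw [injective_iff_map_eq_zero]
  intro z hz
  obtain ⟨f, rfl⟩ := Submodule.Quotient.mk_surjective _ z
  rw [obstrClass_mk, Submodule.Quotient.mk_eq_zero] at hz
  obtain ⟨⟨p, q⟩, hpq⟩ := hz
  rw [Submodule.Quotient.mk_eq_zero]
  exact mem_coboundaries_of_obstr_eq_lin f.2 p q (congrArg Prod.fst hpq).symm
    (congrArg Prod.snd hpq).symm

theorem exists_obstrClass_eq_normalClass (h : MulIndep r₁ r₂) (z : HH2 K (RootDownUp r₁ r₂)) :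
    ∃ e, obstrClass r₁ r₂ z = normalClass h e := by
  obtain ⟨f, rfl⟩ := Submodule.Quotient.mk_surjective _ z
  obtain ⟨e, p, q, h₁, h₂⟩ := isNormal_of_syzygyMap_eq_zero h
    (syzygyMap_obstr f.2 (relDDU_gen _ _) (relDUU_gen _ _))
  refine ⟨e, (Submodule.Quotient.eq _).2 ⟨(p, q), Prod.ext ?_ ?_⟩⟩
  · exact eq_sub_of_add_eq' h₁.symm
  · exact eq_sub_of_add_eq' h₂.symm

/-- The bidegrees of the basis elements of `HH²(A)`. -/
def basisBidegree : Option ℕ → ℤ × ℤ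
  | none => (0, 0)
  | some j => (2 * j - 2, 0)

/-- The relations have bidegrees (3, −1) and (3, 1), while e d and u e exceed e by (1, −1) and (1,
1). The difference (2, 0) is the gap between the bidegree of the polynomial and that of the class.
-/
theorem poly_cokerBasis_mem (h : MulIndep r₁ r₂) (i : Option ℕ) :
    poly h (cokerBasis K i) ∈
      grading (r₁ + r₂) (-(r₁ * r₂)) UDGen.bideg (basisBidegree i + (2, 0)) := by
  rcases i with _ | j
  · rw [cokerBasis, poly_X_one]
    exact w₂_mem_grading UDGen.bideg
  · rw [cokerBasis, map_pow, poly_X_zero]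
    have := pow_mem_grading (w₁_mem_grading (r₁ := r₁) (r₂ := r₂) UDGen.bideg) j
    convert this using 2
    simp [basisBidegree, UDGen.bideg, mul_comm]

/-- Take the homogeneous component of a cocycle with this obstruction class. The normal pair is
homogeneous and survives the projection; only the direction (x, y) is replaced by its component. -/
theorem exists_mem_component (h : MulIndep r₁ r₂) (i : Option ℕ) :
    ∃ z ∈ HH2.component K (bigrading (r₁ + r₂) (-(r₁ * r₂))) (basisBidegree i),
      obstrClass r₁ r₂ z = normalClass h (cokerBasis K i) := by
  obtain ⟨f, hf, x, y, h₁, h₂⟩ := exists_cocycle h (cokerBasis K i)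
  set p := basisBidegree i with hp
  have hmem := poly_cokerBasis_mem h i
  have hu := gen_mem_grading (r₁ + r₂) (-(r₁ * r₂)) UDGen.bideg UDGen.u
  have hd := gen_mem_grading (r₁ + r₂) (-(r₁ * r₂)) UDGen.bideg UDGen.d
  have hpd : p + UDGen.bideg UDGen.d + UDGen.bideg UDGen.d + UDGen.bideg UDGen.u =
      p + (2, 0) + UDGen.bideg UDGen.d := by
    simp only [UDGen.bideg, add_assoc]; rfl
  have hpu : p + UDGen.bideg UDGen.d + UDGen.bideg UDGen.u + UDGen.bideg UDGen.u =
      UDGen.bideg UDGen.u + (p + (2, 0)) := by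
    rw [add_comm (UDGen.bideg UDGen.u)]
    simp only [UDGen.bideg, add_assoc]; rfl
  have e₁ := obstrDDU_cochainComponent _ _ UDGen.bideg p f
  rw [h₁, map_add, proj_linDDU, hpd, proj_of_mem (mul_mem_grading hmem hd)] at e₁
  have e₂ := obstrDUU_cochainComponent _ _ UDGen.bideg p f
  rw [h₂, map_add, proj_linDUU, hpu, proj_of_mem (mul_mem_grading hu hmem)] at e₂
  refine ⟨Submodule.Quotient.mk ⟨cochainComponent _ _ UDGen.bideg p f,
    cochainComponent_mem_cocycles p hf⟩, ⟨_, cochainComponent_mem_homogeneous p f, rfl⟩, ?_⟩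
  refine (Submodule.Quotient.eq _).2 ⟨(proj _ _ UDGen.bideg (p + UDGen.bideg UDGen.u) x,
    proj _ _ UDGen.bideg (p + UDGen.bideg UDGen.d) y), Prod.ext ?_ ?_⟩
  · exact eq_sub_of_add_eq' e₁.symm
  · exact eq_sub_of_add_eq' e₂.symm

/-- Both properties are transported along the injection `obstrClass`, whose image is the cokernel of
`charOpMul`, embedded by `normalClass`. -/
theorem exists_homogeneous_basis (h : MulIndep r₁ r₂) :
    ∃ b : Option ℕ → HH2 K (RootDownUp r₁ r₂),
      (∀ i, b i ∈ HH2.component K (bigrading (r₁ + r₂) (-(r₁ * r₂))) (basisBidegree i)) ∧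
      LinearIndependent K b ∧ Submodule.span K (Set.range b) = ⊤ := by
  choose b hb hbc using exists_mem_component h
  have hlc : ∀ c : Option ℕ →₀ K, obstrClass r₁ r₂ (Finsupp.linearCombination K b c) =
      normalClass h (Finsupp.linearCombination K (cokerBasis K) c) := by
    intro c
    simp only [Finsupp.linearCombination_apply, map_finsuppSum, map_smul, hbc]
  refine ⟨b, hb, ?_, ?_⟩
  · rw [linearIndependent_iff]
    intro c hc
    have e := hlc c
    rw [hc, map_zero, eq_comm, normalClass_eq_zero_iff] at e
    obtain ⟨x, hx⟩ := e
    exact eq_zero_of_linearCombination_cokerBasis h c x hx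
  · rw [eq_top_iff]
    rintro z -
    obtain ⟨e, he⟩ := exists_obstrClass_eq_normalClass h z
    have hmem : e ∈ Submodule.span K (Set.range (cokerBasis K)) ⊔
        LinearMap.range (charOpMul r₁ r₂) := by
      rw [span_cokerBasis_sup_range h]; trivial
    obtain ⟨v, hv, _, ⟨x, rfl⟩, rfl⟩ := Submodule.mem_sup.1 hmem
    obtain ⟨c, rfl⟩ := (Finsupp.mem_span_range_iff_exists_finsupp (R := K)).1 hv
    rw [map_add, (normalClass_eq_zero_iff h _).2 ⟨x, rfl⟩, add_zero] at he
    have : z = Finsupp.linearCombination K b c := obstrClass_injective (he.trans (hlc c).symm)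
    rw [this]
    exact (Finsupp.mem_span_range_iff_exists_finsupp (R := K)).2 ⟨c, rfl⟩

end RootDownUp

/-! ### Coefficients of the Hilbert series -/

namespace BigradedSeries

theorem t_sq : t ^ 2 = HahnSeries.single (toLex ((2, 0) : ℤ × ℤ)) 1 := by
  rw [t, pow_two, HahnSeries.single_mul_single, mul_one]
  rfl

theorem one_div_t_sq : 1 / t ^ 2 = HahnSeries.single (toLex ((-2, 0) : ℤ × ℤ)) 1 := by
  rw [div_eq_iff (by rw [t_sq]; simp), t_sq, HahnSeries.single_mul_single, mul_one]
  rfl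

theorem two_eq_single : (2 : BigradedSeries) = HahnSeries.single 0 2 := by
  rw [← one_add_one_eq_two, ← one_add_one_eq_two (R := ℚ), HahnSeries.single_add]
  rfl

theorem strictMono_evenExponent :
    StrictMono fun k : ℕ => (toLex ((2 * k + 2, 0) : ℤ × ℤ)) := by
  intro a b hab
  rw [Prod.Lex.toLex_lt_toLex]
  left
  simp only
  omega

open Classical in
/-- The series `t² + t⁴ + t⁶ + ⋯`. -/
noncomputable def evenPowers : BigradedSeries where
  coeff x := if x ∈ Set.range fun k : ℕ => (toLex ((2 * k + 2, 0) : ℤ × ℤ)) then 1 else 0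
  isPWO_support' := by
    have hpwo : (Set.range fun k : ℕ => (toLex ((2 * k + 2, 0) : ℤ × ℤ))).IsPWO := by
      rw [← Set.image_univ]
      exact (Set.IsWF.of_wellFoundedLT _).isPWO.image_of_monotone strictMono_evenExponent.monotone
    refine hpwo.mono fun x hx => ?_
    by_contra h
    exact hx (if_neg h)

open Classical in
theorem coeff_evenPowers (m n : ℤ) : evenPowers.coeff (toLex (m, n)) =
    if n = 0 ∧ 2 ≤ m ∧ 2 ∣ m then 1 else 0 := by
  have : evenPowers.coeff (toLex (m, n)) = if toLex (m, n) ∈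
    Set.range fun k : ℕ => (toLex ((2 * k + 2, 0) : ℤ × ℤ)) then 1 else 0 := rfl
  rw [this]
  refine if_congr ?_ rfl rfl
  simp only [Set.mem_range, EmbeddingLike.apply_eq_iff_eq, Prod.mk.injEq]
  constructor
  · rintro ⟨k, h, rfl⟩
    omega
  · rintro ⟨rfl, h, k, hk⟩
    exact ⟨(k - 1).toNat, by omega, rfl⟩

theorem t_sq_div_one_sub : t ^ 2 / (1 - t ^ 2) = evenPowers := by
  have hne : (1 - t ^ 2 : BigradedSeries) ≠ 0 := by
    intro h
    have := congrArg (fun x : BigradedSeries => x.coeff (toLex ((2, 0) : ℤ × ℤ))) h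
    rw [t_sq, ← HahnSeries.single_zero_one] at this
    simp at this
  rw [div_eq_iff hne, mul_sub, mul_one, t_sq]
  ext x
  obtain ⟨⟨m, n⟩, rfl⟩ := toLex.surjective x
  have hx : (toLex (m, n) : ℤ ×ₗ ℤ) = toLex (m - 2, n) + toLex (2, 0) := by
    rw [← toLex_add, Prod.mk_add_mk, sub_add_cancel, add_zero]
  rw [HahnSeries.coeff_sub]
  conv_rhs => rw [hx, HahnSeries.coeff_mul_single_add, ← hx, coeff_evenPowers, coeff_evenPowers]
  rw [HahnSeries.coeff_single]
  simp only [EmbeddingLike.apply_eq_iff_eq, Prod.mk.injEq]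
  split_ifs <;> first | omega | norm_num

theorem coeff_hilbertSeries (m n : ℤ) :
    (1 / t ^ 2 + 2 + t ^ 2 / (1 - t ^ 2)).coeff (toLex (m, n)) =
      (if m = -2 ∧ n = 0 then 1 else 0) + (if m = 0 ∧ n = 0 then 2 else 0) +
        if n = 0 ∧ 2 ≤ m ∧ 2 ∣ m then 1 else 0 := by
  rw [t_sq_div_one_sub, one_div_t_sq, two_eq_single, HahnSeries.coeff_add, HahnSeries.coeff_add,
    coeff_evenPowers, HahnSeries.coeff_single, HahnSeries.coeff_single, ← toLex_zero,
    Prod.zero_eq_mk]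
  simp only [EmbeddingLike.apply_eq_iff_eq, Prod.mk.injEq]

end BigradedSeries

/-! ### Counting basis elements in each bidegree -/

namespace RootDownUp

theorem finite_basisBidegree_fiber (p : ℤ × ℤ) : {i | basisBidegree i = p}.Finite := by
  refine (Set.toFinite {none, some ((p.1 + 2) / 2).toNat}).subset ?_
  rintro (_ | j) hi
  · simp
  · simp only [Set.mem_ofPred_eq, basisBidegree] at hi
    subst hi
    right
    simp only [Set.mem_singleton_iff, Option.some.injEq]
    omega

theorem ncard_basisBidegree_fiber (m n : ℤ) :
    ({i | basisBidegree i = (m, n)}.ncard : ℚ) =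
      (if m = -2 ∧ n = 0 then 1 else 0) + (if m = 0 ∧ n = 0 then 2 else 0) +
        if n = 0 ∧ 2 ≤ m ∧ 2 ∣ m then 1 else 0 := by
  by_cases h₀ : m = 0 ∧ n = 0
  · obtain ⟨rfl, rfl⟩ := h₀
    -- The classes of w₂ and of w₁ share the bidegree (0, 0), whence the coefficient 2.
    have : {i | basisBidegree i = ((0 : ℤ), (0 : ℤ))} = {none, some 1} := by
      ext (_ | j)
      · simp [basisBidegree]
      · simp only [basisBidegree, Set.mem_ofPred_eq, Prod.mk.injEq, Set.mem_insert_iff,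
          Set.mem_singleton_iff, Option.some.injEq, reduceCtorEq, and_true, false_or]
        omega
    rw [this, Set.ncard_pair (by simp)]
    norm_num
  · by_cases h₁ : n = 0 ∧ -2 ≤ m ∧ 2 ∣ m
    · have : {i | basisBidegree i = (m, n)} = {some ((m + 2) / 2).toNat} := by
        ext (_ | j)
        · simp only [basisBidegree, Set.mem_ofPred_eq, Prod.mk.injEq,
            Set.mem_singleton_iff, reduceCtorEq, iff_false]
          omega
        · simp only [basisBidegree, Set.mem_ofPred_eq, Prod.mk.injEq,
            Set.mem_singleton_iff, Option.some.injEq]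
          omega
      rw [this, Set.ncard_singleton, if_neg h₀]
      split_ifs <;> first | omega | norm_num
    · have : {i | basisBidegree i = (m, n)} = ∅ := by
        ext (_ | j)
        · simp only [basisBidegree, Set.mem_ofPred_eq, Prod.mk.injEq, Set.mem_empty_iff_false,
            iff_false]
          omega
        · simp only [basisBidegree, Set.mem_ofPred_eq, Prod.mk.injEq, Set.mem_empty_iff_false,
            iff_false]
          omega
      rw [this, Set.ncard_empty, if_neg h₀]
      split_ifs <;> first | omega | norm_num

theorem hasBigradedHilbertSeries {K : Type*} [Field K] {r₁ r₂ : K} (h : MulIndep r₁ r₂) :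
    HasBigradedHilbertSeries
      (HH2.component K (DownUpAlgebra.bigrading (r₁ + r₂) (-(r₁ * r₂))))
      (1 / BigradedSeries.t ^ 2 + 2 + BigradedSeries.t ^ 2 / (1 - BigradedSeries.t ^ 2)) := by
  obtain ⟨b, hb, hli, hspan⟩ := exists_homogeneous_basis h
  have hind := DownUpAlgebra.iSupIndep_component (r₁ + r₂) (-(r₁ * r₂))
  refine ⟨(DirectSum.isInternal_submodule_iff_iSupIndep_and_iSup_eq_top _).2
    ⟨hind, iSup_eq_top_of_mem hspan hb⟩, fun p => ?_⟩
  obtain ⟨hfin, hrank⟩ := finrank_span_image_eq_ncard hli (finite_basisBidegree_fiber p)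
  rw [eq_span_image_of_iSupIndep hind hspan hb p]
  refine ⟨hfin, ?_⟩
  rw [hrank, BigradedSeries.coeff_hilbertSeries, ← ncard_basisBidegree_fiber]

end RootDownUp

theorem IsGradedGeneric.exists_mulIndep {K : Type*} [Field K] {α β : K}
    (hA : IsGradedGeneric α β) :
    ∃ r₁ r₂ : K, α = r₁ + r₂ ∧ β = -(r₁ * r₂) ∧ MulIndep r₁ r₂ := by
  obtain ⟨hβ, r₁, r₂, hpoly, hgen⟩ := hA
  -- Evaluation at 0 and at 1 recovers the product and the sum of the roots.
  have h₀ := congrArg (eval 0) hpoly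
  have h₁ := congrArg (eval 1) hpoly
  simp only [eval_sub, eval_mul, eval_pow, eval_X, eval_C] at h₀ h₁
  have eβ : β = -(r₁ * r₂) := by linear_combination -h₀
  have eα : α = r₁ + r₂ := by linear_combination h₀ - h₁
  rw [eβ, neg_ne_zero, mul_ne_zero_iff] at hβ
  exact ⟨r₁, r₂, eα, eβ, ⟨hβ.1, hβ.2, hgen⟩⟩

theorem proposition4p6 {K : Type*} [Field K] [CharZero K] (α β : K)
    (hA : IsGradedGeneric α β) :
    HasBigradedHilbertSeries
      (HH2.component K (DownUpAlgebra.bigrading α β))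
      (1 / BigradedSeries.t ^ 2 + 2 + BigradedSeries.t ^ 2 / (1 - BigradedSeries.t ^ 2)) := by
  obtain ⟨r₁, r₂, rfl, rfl, h⟩ := hA.exists_mulIndep
  exact RootDownUp.hasBigradedHilbertSeries h
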